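/- Let $M$ be a smooth $n$-manifold and let $\mathcal E=T^*\Pi TM\cong T^*\Pi T^*M$, an even symplectic supermanifold. Over a chart $(x^i)$ of $M$ it has Darboux coordinates $x^i,p_i$ (even) and $\xi^i=dx^i,\theta_i$ (odd). Functions on $\mathcal E$ are locally polynomials in $\xi,\theta,p$ with coefficients smooth in $x$. They carry a double grading with $x^i,\xi^i,\theta_i,p_i$ of bidegree $(0,0),(0,1),(1,0),(1,1)$, and the canonical Poisson bracket of bidegree $(-1,-1)$ with $\{p_i,x^j\}=\{\theta_i,\xi^j\}=\delta_i^j$. Under the change of coordinates $x'=x'(x)$ one has $\xi'^i=\frac{\partial x'^i}{\partial x^j}\xi^j$, $\theta_j=\frac{\partial x'^i}{\partial x^j}\theta'_i$, $p_k=\frac{\partial x'^i}{\partial x^k}p'_i+\frac{\partial^2x'^i}{\partial x^j\partial x^k}\xi^j\theta'_i$. Functions of bidegree $(k,0)$ are $k$-vector fields and those of bidegree $(0,l)$ are $l$-forms. For a vector field $v$ on $\Pi TM$ or on $\Pi T^*M$, $h_v$ denotes its linear hamiltonian on $\mathcal E$, so that $\{h_v,f\}=v(f)$; $d=\xi^i\partial/\partial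 x^i$ is the de Rham vector field on $\Pi TM$, and $h_d=\xi^ip_i$. Further, $[\cdot,\cdot]$ is the Schouten bracket of multivector fields, and for $\Theta$ of total degree $3$ put $d_\Theta=\{\Theta,\cdot\}$ and $[X,Y]_\Theta=\{\{X,\Theta\},Y\}$. Let $\mu$ and $\gamma$ be functions on $\mathcal E$ of bidegree $(1,2)$ and $(2,1)$. The pair $(\mu,\gamma)$ is a Lie bialgebroid structure on $(TM,T^*M)$ if $d_\mu^2=0$ on forms, $d_\gamma^2=0$ on multivector fields, and $d_\mu$ is a derivation of the bracket $[\cdot,\cdot]_\gamma$ of forms. It is a Lie bialgebroid structure on $(T^*M,TM)$ if $d_\mu^2=0$ on forms, $d_\gamma^2=0$ on multivector fields, and $d_\gamma$ is a derivation of the bracket $[\cdot,\cdot]_\mu$ of multivector fields. For $\psi$ of bidegree $(3,0)$, $(\mu,\gamma,\psi)$ is a quasi-Lie bialgebroid structure on $(T^*M,TM)$ if $\tfrac12\{\gamma,\gamma\}+\{\mu,\psi\}=0$, $\{\mu,\mu\}=0$, $\{\mu,\gamma\}=0$ and $\{\gamma,\psi\}=0$. Let $\pi$ be an arbitrary smooth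 bivector field on $M$, regarded as the function $\frac12\pi^{ij}\theta_i\theta_j$ on $\mathcal E$, let $X_\pi=\{\pi,\cdot\}$, and let $\Theta_\pi=(\exp X_\pi)h_d=\sum_{k\ge0}\frac1{k!}X_\pi^kh_d$ be the twist of $h_d$ by $\pi$. Then: 1. $(h_d,0)$ is a Lie bialgebroid structure on $(TM,T^*M)$, $\{h_d,h_d\}=0$, and $[\cdot,\cdot]_{h_d}$ is the Schouten bracket of multivector fields. 2. $X_\pi^kh_d=0$ for $k\ge3$, and the unique decomposition $\Theta_\pi=\mu_\pi+\gamma_\pi+\phi_\pi+\psi_\pi$ into components of bidegrees $(1,2),(2,1),(0,3),(3,0)$ is given by $$\mu_\pi=h_d,\qquad \gamma_\pi=h_{[\pi,\cdot]},\qquad \phi_\pi=0,\qquad \psi_\pi=-\tfrac12[\pi,\pi].$$ 3. $\{\Theta_\pi,\Theta_\pi\}=0$, and $(\mu_\pi,\gamma_\pi,\psi_\pi)$ is a quasi-Lie bialgebroid structure on $(T^*M,TM)$. 4. $(\mu_\pi,\gamma_\pi)$ is a Lie bialgebroid structure on $(T^*M,TM)$ if and only if $[\pi,\pi]=0$. Equivalently,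 $(\mu_\pi,\gamma_\pi,0)$ is a quasi-Lie bialgebroid structure on $(T^*M,TM)$ if and only if $[\pi,\pi]=0$. -/

import Mathlib

open scoped Manifold ContDiff TensorProduct

namespace SuperCotangent

/-! ## The fibre algebra: polynomials in the Darboux coordinates `ξ`, `θ`, `p` -/

/-- The fibre Darboux coordinates on `T*ΠTM` over a chart of `M`: the odd coordinates
`ξ^i = dx^i` and `θ_i`, and the even momenta `p_i`. -/
inductive Gen (n : ℕ) : Type
  | xi (i : Fin n) : Gen n
  | theta (i : Fin n) : Gen n
  | p (i : Fin n) : Gen n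
  deriving DecidableEq

/-- `true` for the odd coordinates `ξ^i`, `θ_i`, and `false` for the even ones `p_i`. -/
def Gen.odd {n : ℕ} : Gen n → Bool
  | Gen.xi _ => true
  | Gen.theta _ => true
  | Gen.p _ => false

/-- The double degree: `(0,1)` for `ξ^i`, `(1,0)` for `θ_i` and `(1,1)` for `p_i`. -/
def Gen.bidegree {n : ℕ} : Gen n → ℕ × ℕ
  | Gen.xi _ => (0, 1)
  | Gen.theta _ => (1, 0)
  | Gen.p _ => (1, 1)

/-- The Koszul sign `(-1)^{|g||h|}`. -/
def koszul {n : ℕ} (g h : Gen n) : ℝ := if g.odd && h.odd then -1 else 1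

/-- The supercommutation relations `g h = (-1)^{|g||h|} h g`. -/
inductive Rel (n : ℕ) : FreeAlgebra ℝ (Gen n) → FreeAlgebra ℝ (Gen n) → Prop
  | swap (g h : Gen n) :
      Rel n (FreeAlgebra.ι ℝ g * FreeAlgebra.ι ℝ h)
        (koszul g h • (FreeAlgebra.ι ℝ h * FreeAlgebra.ι ℝ g))

/-- The free supercommutative real algebra on `ξ^i`, `θ_i`, `p_i`. -/
def FibreAlg (n : ℕ) : Type := RingQuot (Rel n)

noncomputable instance (n : ℕ) : Ring (FibreAlg n) := inferInstanceAs (Ring (RingQuot (Rel n)))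

noncomputable instance (n : ℕ) : Algebra ℝ (FibreAlg n) :=
  inferInstanceAs (Algebra ℝ (RingQuot (Rel n)))

/-- The quotient map from the free algebra. -/
noncomputable def FibreAlg.mk (n : ℕ) : FreeAlgebra ℝ (Gen n) →ₐ[ℝ] FibreAlg n :=
  RingQuot.mkAlgHom ℝ (Rel n)

/-- A coordinate as an element of the fibre algebra. -/
noncomputable def gen {n : ℕ} (g : Gen n) : FibreAlg n :=
  FibreAlg.mk n (FreeAlgebra.ι ℝ g)

theorem gen_swap {n : ℕ} (g h : Gen n) : gen g * gen h = koszul g h • (gen h * gen g) := by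
  have : FibreAlg.mk n _ = FibreAlg.mk n _ := RingQuot.mkAlgHom_rel ℝ (Rel.swap g h)
  simpa [gen] using this

/-- The universal property of the fibre algebra. -/
noncomputable def liftGen {n : ℕ} {A : Type*} [Ring A] [Algebra ℝ A] (f : Gen n → A)
    (hf : ∀ g h, f g * f h = koszul g h • (f h * f g)) : FibreAlg n →ₐ[ℝ] A :=
  show RingQuot (Rel n) →ₐ[ℝ] A from RingQuot.liftAlgHom ℝ ⟨FreeAlgebra.lift ℝ f, by
    rintro _ _ ⟨g, h⟩
    simpa using hf g h⟩

theorem koszul_cases {n : ℕ} (g h : Gen n) :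
    koszul g h = 1 ∨ koszul g h = -1 := by
  unfold koszul; split_ifs <;> simp

theorem koszul_symm {n : ℕ} (g h : Gen n) : koszul g h = koszul h g := by
  unfold koszul; rw [Bool.and_comm]

theorem koszul_self_mul {n : ℕ} (g h : Gen n) : koszul g h * koszul g h = 1 := by
  rcases koszul_cases g h with e | e <;> rw [e] <;> norm_num

/-- The algebra homomorphism `a ↦ !![±a, ∂a; 0, a]`, where `∂` is the left derivative by the
coordinate `g₀` and the sign is `(-1)^{|g₀||a|}`. -/
noncomputable def leftDerivHom {n : ℕ} (g₀ : Gen n) :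
    FibreAlg n →ₐ[ℝ] Matrix (Fin 2) (Fin 2) (FibreAlg n) :=
  liftGen (fun g => !![koszul g₀ g • gen g, if g₀ = g then 1 else 0; 0, gen g]) (by
    intro g h
    have hs := gen_swap g h
    have hk := koszul_symm g h
    by_cases h1 : g₀ = g <;> by_cases h2 : g₀ = h
    · subst h1; subst h2
      rcases koszul_cases g₀ g₀ with e | e <;> rw [e] at hs <;> ext i j <;>
        fin_cases i <;> fin_cases j <;> simp [Matrix.mul_apply, e] <;> simpa using hs
    · subst h1
      ext i j
      fin_cases i <;> fin_cases j <;> simp [Matrix.mul_apply, h2, hs, smul_smul,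
        koszul_self_mul, mul_comm, mul_left_comm]
    · subst h2
      ext i j
      fin_cases i <;> fin_cases j <;> simp [Matrix.mul_apply, h1, hs, hk, smul_smul,
        koszul_self_mul, mul_comm, mul_left_comm]
    · ext i j
      fin_cases i <;> fin_cases j <;> simp [Matrix.mul_apply, h1, h2, hs, smul_smul,
        mul_comm, mul_left_comm, mul_assoc])

/-- The left derivative `∂/∂g₀`: it sends `g` to `δ`, and
`∂(ab) = (∂a) b + (-1)^{|g₀||a|} a ∂b`. -/
noncomputable def leftDeriv {n : ℕ} (g₀ : Gen n) : FibreAlg n →ₗ[ℝ] FibreAlg n :=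
  (Matrix.entryLinearMap ℝ (FibreAlg n) 0 1).comp (leftDerivHom g₀).toLinearMap

/-- The algebra homomorphism `a ↦ !![a, a∂; 0, ±a]`, where `a∂` is the right derivative by the
coordinate `g₀` and the sign is `(-1)^{|g₀||a|}`. -/
noncomputable def rightDerivHom {n : ℕ} (g₀ : Gen n) :
    FibreAlg n →ₐ[ℝ] Matrix (Fin 2) (Fin 2) (FibreAlg n) :=
  liftGen (fun g => !![gen g, if g₀ = g then 1 else 0; 0, koszul g₀ g • gen g]) (by
    intro g h
    have hs := gen_swap g h
    have hk := koszul_symm g h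
    by_cases h1 : g₀ = g <;> by_cases h2 : g₀ = h
    · subst h1; subst h2
      rcases koszul_cases g₀ g₀ with e | e <;> rw [e] at hs <;> ext i j <;>
        fin_cases i <;> fin_cases j <;> simp [Matrix.mul_apply, e] <;> simpa using hs
    · subst h1
      ext i j
      fin_cases i <;> fin_cases j <;> simp [Matrix.mul_apply, h2, hs, smul_smul,
        koszul_self_mul, mul_comm, mul_left_comm]
    · subst h2
      ext i j
      fin_cases i <;> fin_cases j <;> simp [Matrix.mul_apply, h1, hs, hk, smul_smul,
        koszul_self_mul, mul_comm, mul_left_comm]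
    · ext i j
      fin_cases i <;> fin_cases j <;> simp [Matrix.mul_apply, h1, h2, hs, smul_smul,
        mul_comm, mul_left_comm, mul_assoc])

/-- The right derivative by `g₀`: it sends `g` to `δ`, and
`(ab)∂ = a (b∂) + (-1)^{|g₀||b|} (a∂) b`. -/
noncomputable def rightDeriv {n : ℕ} (g₀ : Gen n) : FibreAlg n →ₗ[ℝ] FibreAlg n :=
  (Matrix.entryLinearMap ℝ (FibreAlg n) 0 1).comp (rightDerivHom g₀).toLinearMap

/-- The elements of double degree `(k,l)` of the fibre algebra. -/
noncomputable def fibreBideg (n k l : ℕ) : Submodule ℝ (FibreAlg n) :=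
  Submodule.span ℝ {a | ∃ w : List (Gen n), (w.map Gen.bidegree).sum = (k, l) ∧
    a = (w.map gen).prod}

/-! ## Smooth functions on an open set of `ℝⁿ` -/

/-- The smooth real functions on an open set `U` of `ℝⁿ`. -/
def Smooth {n : ℕ} (U : TopologicalSpace.Opens (EuclideanSpace ℝ (Fin n))) :
    Subalgebra ℝ (U → ℝ) where
  carrier := {f | ∃ g : EuclideanSpace ℝ (Fin n) → ℝ, ContDiffOn ℝ ∞ g U ∧ ∀ x : U, f x = g x}
  mul_mem' := by
    rintro f f' ⟨g, hg, h⟩ ⟨g', hg', h'⟩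
    exact ⟨fun x => g x * g' x, hg.mul hg', fun x => by simp [h, h']⟩
  add_mem' := by
    rintro f f' ⟨g, hg, h⟩ ⟨g', hg', h'⟩
    exact ⟨fun x => g x + g' x, hg.add hg', fun x => by simp [h, h']⟩
  algebraMap_mem' := fun r => ⟨fun _ => r, contDiffOn_const, fun _ => rfl⟩

variable {n : ℕ} {U : TopologicalSpace.Opens (EuclideanSpace ℝ (Fin n))}

/-- The extension of a function on `U` by zero. -/
noncomputable def extendZero (f : U → ℝ) : EuclideanSpace ℝ (Fin n) → ℝ :=
  Function.extend Subtype.val f 0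

theorem extendZero_apply (f : U → ℝ) (x : U) : extendZero f x = f x :=
  Subtype.val_injective.extend_apply f 0 x

theorem contDiffOn_extendZero (f : Smooth U) : ContDiffOn ℝ ∞ (extendZero f.1) U := by
  obtain ⟨g, hg, h⟩ := f.2
  exact hg.congr fun x hx => (extendZero_apply f.1 ⟨x, hx⟩).trans (h ⟨x, hx⟩)

theorem differentiableAt_extendZero (f : Smooth U) (x : U) :
    DifferentiableAt ℝ (extendZero f.1) x :=
  ((contDiffOn_extendZero f).contDiffAt (U.isOpen.mem_nhds x.2)).differentiableAt (by simp)

theorem extendZero_add (f g : U → ℝ) : extendZero (f + g) = extendZero f + extendZero g := by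
  funext x
  by_cases hx : x ∈ U
  · rw [Pi.add_apply]
    exact (extendZero_apply (f + g) ⟨x, hx⟩).trans (congrArg₂ (· + ·)
      (extendZero_apply f ⟨x, hx⟩).symm (extendZero_apply g ⟨x, hx⟩).symm)
  · have : ¬ ∃ a : U, (a : EuclideanSpace ℝ (Fin n)) = x := by rintro ⟨a, rfl⟩; exact hx a.2
    simp [extendZero, Function.extend_apply' _ _ _ this]

theorem extendZero_smul (c : ℝ) (f : U → ℝ) : extendZero (c • f) = c • extendZero f := by
  funext x
  by_cases hx : x ∈ U
  · rw [Pi.smul_apply]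
    exact (extendZero_apply (c • f) ⟨x, hx⟩).trans (congrArg (c • ·)
      (extendZero_apply f ⟨x, hx⟩).symm)
  · have : ¬ ∃ a : U, (a : EuclideanSpace ℝ (Fin n)) = x := by rintro ⟨a, rfl⟩; exact hx a.2
    simp [extendZero, Function.extend_apply' _ _ _ this]

/-- The partial derivative `∂/∂x^i` on smooth functions on `U`. -/
noncomputable def partialX (U : TopologicalSpace.Opens (EuclideanSpace ℝ (Fin n))) (i : Fin n) :
    Smooth U →ₗ[ℝ] Smooth U where
  toFun f := ⟨fun x => fderiv ℝ (extendZero f.1) x (EuclideanSpace.single i 1),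
    fun x => fderiv ℝ (extendZero f.1) x (EuclideanSpace.single i 1),
    (((contDiffOn_extendZero f).fderiv_of_isOpen U.isOpen (m := ∞) (by simp)).clm_apply
      contDiffOn_const), fun _ => rfl⟩
  map_add' f g := by
    ext x
    change fderiv ℝ (extendZero (f.1 + g.1)) x _ = _
    rw [extendZero_add, fderiv_add (differentiableAt_extendZero f x)
      (differentiableAt_extendZero g x)]
    rfl
  map_smul' c f := by
    ext x
    change fderiv ℝ (extendZero (c • f.1)) x _ = _
    rw [extendZero_smul, fderiv_const_smul (differentiableAt_extendZero f x)]
    rfl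

/-- The coordinate function `x^i`. -/
def coordX (U : TopologicalSpace.Opens (EuclideanSpace ℝ (Fin n))) (i : Fin n) : Smooth U :=
  ⟨fun x => x.1 i, fun x => x i, (EuclideanSpace.proj (𝕜 := ℝ) i).contDiff.contDiffOn,
    fun _ => rfl⟩

/-! ## Functions on `T*ΠTU`, polynomial in the fibre coordinates -/

/-- Functions on `T*ΠTU`: polynomials in `ξ`, `θ`, `p` with smooth coefficients. -/
abbrev LocalFn (U : TopologicalSpace.Opens (EuclideanSpace ℝ (Fin n))) : Type :=
  Smooth U ⊗[ℝ] FibreAlg n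

namespace LocalFn

/-- The coordinate function `x^i` on `T*ΠTU`. -/
noncomputable def x (i : Fin n) : LocalFn U := coordX U i ⊗ₜ[ℝ] 1
/-- The coordinate function `ξ^i` on `T*ΠTU`. -/
noncomputable def xi (i : Fin n) : LocalFn U := 1 ⊗ₜ[ℝ] gen (Gen.xi i)
/-- The coordinate function `θ_i` on `T*ΠTU`. -/
noncomputable def theta (i : Fin n) : LocalFn U := 1 ⊗ₜ[ℝ] gen (Gen.theta i)
/-- The coordinate function `p_i` on `T*ΠTU`. -/
noncomputable def p (i : Fin n) : LocalFn U := 1 ⊗ₜ[ℝ] gen (Gen.p i)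

/-- The partial derivative by `x^i`. -/
noncomputable def dx (i : Fin n) : LocalFn U →ₗ[ℝ] LocalFn U :=
  LinearMap.rTensor (FibreAlg n) (partialX U i)
/-- The left derivative by a fibre coordinate. -/
noncomputable def dl (g : Gen n) : LocalFn U →ₗ[ℝ] LocalFn U :=
  LinearMap.lTensor (Smooth U) (leftDeriv g)
/-- The right derivative by a fibre coordinate. -/
noncomputable def dr (g : Gen n) : LocalFn U →ₗ[ℝ] LocalFn U :=
  LinearMap.lTensor (Smooth U) (rightDeriv g)

/-- The canonical even Poisson bracket on `T*ΠTU`, with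
`{p_i, x^j} = {θ_i, ξ^j} = {ξ^j, θ_i} = δ_i^j`. -/
noncomputable def poisson (F G : LocalFn U) : LocalFn U :=
  ∑ i : Fin n, (dl (Gen.p i) F * dx i G - dx i F * dl (Gen.p i) G
    + dr (Gen.xi i) F * dl (Gen.theta i) G + dr (Gen.theta i) F * dl (Gen.xi i) G)

/-- The functions of double degree `(k,l)`. The functions of double degree `(k,0)` are the
`k`-vector fields on `U`, and those of double degree `(0,l)` are the `l`-forms. -/
noncomputable def bideg (U : TopologicalSpace.Opens (EuclideanSpace ℝ (Fin n))) (k l : ℕ) :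
    Submodule ℝ (LocalFn U) :=
  Submodule.span ℝ {F | ∃ f : Smooth U, ∃ a ∈ fibreBideg n k l, F = f ⊗ₜ[ℝ] a}

/-- The value at a point `x` of `U`, a polynomial in the fibre coordinates. -/
noncomputable def evalAt (x : U) : LocalFn U →ₗ[ℝ] FibreAlg n :=
  TensorProduct.lift ((LinearMap.lsmul ℝ (FibreAlg n)).comp
    ((LinearMap.proj x).comp (Smooth U).val.toLinearMap))

/-- The de Rham vector field `d = ξ^i ∂/∂x^i` on `ΠTU`. -/
noncomputable def deRham (F : LocalFn U) : LocalFn U := ∑ i : Fin n, xi i * dx i F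

/-- The Schouten bracket of multivector fields on `U`, regarded as functions of `x` and `θ`:
the biderivation of degree `-1` which extends the Lie bracket of vector fields, with
`[X, f] = X f`. -/
noncomputable def schouten (P Q : LocalFn U) : LocalFn U :=
  ∑ i : Fin n, (dr (Gen.theta i) P * dx i Q - dx i P * dl (Gen.theta i) Q)

/-- The linear hamiltonian `h_v` on `T*ΠTU` of a vector field
`v = v(x^i) ∂/∂x^i + v(ξ^i) ∂/∂ξ^i` on `ΠTU`. -/
noncomputable def ham (v : LocalFn U → LocalFn U) : LocalFn U :=
  ∑ i : Fin n, (v (x i) * p i + v (xi i) * theta i)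

/-- The linear hamiltonian `h_v` on `T*ΠT*U = T*ΠTU` of a vector field
`v = v(x^i) ∂/∂x^i + v(θ_i) ∂/∂θ_i` on `ΠT*U`. -/
noncomputable def hamDual (v : LocalFn U → LocalFn U) : LocalFn U :=
  ∑ i : Fin n, (v (x i) * p i + v (theta i) * xi i)

end LocalFn

/-! ## Change of coordinates on `T*ΠTM` -/

/-- The coefficients of a fibre coordinate change: `K = ∂x/∂x'`, `J = ∂x'/∂x`,
`H i j k = ∂²x'^i/∂x^j∂x^k`. The unprimed fibre coordinates are expressed by the primed ones:
`ξ^i = K^i_j ξ'^j`, `θ_j = J^i_j θ'_i`, `p_k = J^i_k p'_i + H^i_{jk} ξ^j θ'_i`. -/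
noncomputable def changeGen (K J : Fin n → Fin n → ℝ) (H : Fin n → Fin n → Fin n → ℝ) :
    Gen n → FibreAlg n
  | Gen.xi i => ∑ j, K i j • gen (Gen.xi j)
  | Gen.theta j => ∑ i, J i j • gen (Gen.theta i)
  | Gen.p k => ∑ i, J i k • gen (Gen.p i) +
      ∑ i, ∑ j, H i j k • ((∑ l, K j l • gen (Gen.xi l)) * gen (Gen.theta i))

theorem sum_scomm {ι A : Type*} [Ring A] [Algebra ℝ A] (s : Finset ι) (c : ℝ) (a : ι → A) (b : A)
    (h : ∀ i ∈ s, a i * b = c • (b * a i)) : (∑ i ∈ s, a i) * b = c • (b * ∑ i ∈ s, a i) := by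
  rw [Finset.sum_mul, Finset.mul_sum, Finset.smul_sum]
  exact Finset.sum_congr rfl h

theorem scomm_symm {A : Type*} [Ring A] [Algebra ℝ A] {c : ℝ} (hc : c * c = 1) {a b : A}
    (h : a * b = c • (b * a)) : b * a = c • (a * b) := by
  rw [h, smul_smul, hc, one_smul]

theorem smul_scomm {A : Type*} [Ring A] [Algebra ℝ A] {c : ℝ} (r : ℝ) {a b : A}
    (h : a * b = c • (b * a)) : (r • a) * b = c • (b * (r • a)) := by
  rw [smul_mul_assoc, h, mul_smul_comm, smul_comm]

/-- The image of a coordinate `g` supercommutes with everything with which all coordinates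
supercommute in the way `g` does. -/
theorem changeGen_scomm (K J : Fin n → Fin n → ℝ) (H : Fin n → Fin n → Fin n → ℝ)
    (g : Gen n) (b : FibreAlg n) (odd : Bool)
    (hb : ∀ h : Gen n, gen h * b = (if h.odd && odd then (-1 : ℝ) else 1) • (b * gen h)) :
    changeGen K J H g * b = (if g.odd && odd then (-1 : ℝ) else 1) • (b * changeGen K J H g) := by
  have hx : ∀ j, (∑ l, K j l • gen (Gen.xi l)) * b =
      (if odd then (-1 : ℝ) else 1) • (b * ∑ l, K j l • gen (Gen.xi l)) := fun j =>
    sum_scomm _ _ _ _ fun l _ => smul_scomm _ (by simpa [Gen.odd] using hb (Gen.xi l))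
  have ht : ∀ i, gen (Gen.theta i) * b =
      (if odd then (-1 : ℝ) else 1) • (b * gen (Gen.theta i)) := fun i => by
    simpa [Gen.odd] using hb (Gen.theta i)
  cases g with
  | xi i => simpa [Gen.odd, changeGen] using hx i
  | theta j =>
    simp only [Gen.odd, changeGen, Bool.true_and]
    exact sum_scomm _ _ _ _ fun l _ => smul_scomm _ (ht l)
  | p k =>
    have h1 : (∑ i, J i k • gen (Gen.p i)) * b = (1 : ℝ) • (b * ∑ i, J i k • gen (Gen.p i)) :=
      sum_scomm _ _ _ _ fun l _ => smul_scomm _ (by simpa [Gen.odd] using hb (Gen.p l))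
    have h2 : (∑ i, ∑ j, H i j k • ((∑ l, K j l • gen (Gen.xi l)) * gen (Gen.theta i))) * b =
        (1 : ℝ) • (b * ∑ i, ∑ j, H i j k •
          ((∑ l, K j l • gen (Gen.xi l)) * gen (Gen.theta i))) :=
      sum_scomm _ _ _ _ fun i _ => sum_scomm _ _ _ _ fun j _ => smul_scomm _ (by
        rw [mul_assoc, ht i, mul_smul_comm, ← mul_assoc, hx j, smul_mul_assoc, smul_smul,
          mul_assoc]
        cases odd <;> simp)
    simp only [Gen.odd, changeGen, Bool.false_and, Bool.false_eq_true, if_false]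
    rw [add_mul, h1, h2, mul_add, smul_add]

/-- The algebra homomorphism of a fibre coordinate change. -/
noncomputable def changeHom (K J : Fin n → Fin n → ℝ) (H : Fin n → Fin n → Fin n → ℝ) :
    FibreAlg n →ₐ[ℝ] FibreAlg n :=
  liftGen (changeGen K J H) (by
    intro g h
    refine changeGen_scomm K J H g _ h.odd fun g' => ?_
    have := changeGen_scomm K J H h (gen g') g'.odd fun h' => gen_swap h' g'
    rw [Bool.and_comm] at this
    exact scomm_symm (by split_ifs <;> norm_num) this)

variable (n) in
/-- A chart of the atlas of `M`. -/
abbrev Chart (M : Type*) [TopologicalSpace M] [ChartedSpace (EuclideanSpace ℝ (Fin n)) M] :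
    Type _ := atlas (EuclideanSpace ℝ (Fin n)) M

section Manifold

variable {M : Type*} [TopologicalSpace M] [ChartedSpace (EuclideanSpace ℝ (Fin n)) M]

/-- The image of a chart. -/
def Chart.image (φ : Chart n M) : TopologicalSpace.Opens (EuclideanSpace ℝ (Fin n)) :=
  ⟨φ.1.target, φ.1.open_target⟩

/-- The point with coordinates `x` in the chart `φ`. -/
def Chart.at (φ : Chart n M) (m : M) (hm : m ∈ φ.1.source) : φ.image :=
  ⟨φ.1 m, φ.1.map_source hm⟩

/-- The change of coordinates `x' = x'(x)` from `φ` to `ψ`. -/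
def Chart.change (φ ψ : Chart n M) (y : EuclideanSpace ℝ (Fin n)) : EuclideanSpace ℝ (Fin n) :=
  ψ.1 (φ.1.symm y)

/-- The Jacobian `∂x'^i/∂x^j`, where `x'` are the coordinates of `ψ` and `x` those of `φ`. -/
noncomputable def Chart.jac (φ ψ : Chart n M) (y : EuclideanSpace ℝ (Fin n)) (i j : Fin n) : ℝ :=
  fderiv ℝ (φ.change ψ) y (EuclideanSpace.single j 1) i

/-- The second derivatives `∂²x'^i/∂x^j∂x^k`. -/
noncomputable def Chart.hess (φ ψ : Chart n M) (y : EuclideanSpace ℝ (Fin n))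
    (i j k : Fin n) : ℝ :=
  fderiv ℝ (fun z => φ.jac ψ z i j) y (EuclideanSpace.single k 1)

/-- The change of the fibre coordinates on `T*ΠTM` over the point `m`, from `φ` to `ψ`. -/
noncomputable def Chart.transition (φ ψ : Chart n M) (m : M) : FibreAlg n →ₐ[ℝ] FibreAlg n :=
  changeHom (ψ.jac φ (ψ.1 m)) (φ.jac ψ (φ.1 m)) (φ.hess ψ (φ.1 m))

variable (n M) in
/-- Families of functions on `T*ΠTU`, one for each chart `U` of `M`. -/
abbrev ChartFn : Type _ := ∀ φ : Chart n M, LocalFn φ.image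

namespace ChartFn

/-- The family is a function on `T*ΠTM`: its members agree on overlaps of charts. -/
def IsGlobal (F : ChartFn n M) : Prop :=
  ∀ (φ ψ : Chart n M) (m : M) (hφ : m ∈ φ.1.source) (hψ : m ∈ ψ.1.source),
    LocalFn.evalAt (ψ.at m hψ) (F ψ) = φ.transition ψ m (LocalFn.evalAt (φ.at m hφ) (F φ))

/-- `F` has double degree `(k,l)`. -/
def HasBideg (F : ChartFn n M) (k l : ℕ) : Prop :=
  ∀ φ, F φ ∈ LocalFn.bideg φ.image k l

/-- The canonical Poisson bracket. -/
noncomputable def poisson (F G : ChartFn n M) : ChartFn n M :=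
  fun φ => LocalFn.poisson (F φ) (G φ)

/-- The Schouten bracket of multivector fields. -/
noncomputable def schouten (P Q : ChartFn n M) : ChartFn n M :=
  fun φ => LocalFn.schouten (P φ) (Q φ)

variable (n M) in
/-- The hamiltonian `h_d` of the de Rham vector field on `ΠTM`. -/
noncomputable def hamDeRham : ChartFn n M := fun _ => LocalFn.ham LocalFn.deRham

/-- The hamiltonian `h_{[P,·]}` of the vector field `[P,·]` on `ΠT*M`. -/
noncomputable def hamSchouten (P : ChartFn n M) : ChartFn n M :=
  fun φ => LocalFn.hamDual (LocalFn.schouten (P φ))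

/-- The twist `F_P^* Θ = exp(X_P) Θ` with `X_P = {P,·}`. The sum is finite if `P` has double
degree `(2,0)`, since `X_P` lowers the second degree. -/
noncomputable def twist (P Θ : ChartFn n M) : ChartFn n M :=
  fun φ => ∑ᶠ k : ℕ, ((k.factorial : ℝ)⁻¹) • (LocalFn.poisson (P φ))^[k] (Θ φ)

end ChartFn

open ChartFn

/-- `(μ, γ, ψ)` is a quasi-Lie bialgebroid structure on `(T*M, TM)`. -/
structure IsQuasiLieBialgebroidDual (μ γ ψ : ChartFn n M) : Prop where
  global_mu : μ.IsGlobal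
  global_gamma : γ.IsGlobal
  global_psi : ψ.IsGlobal
  bideg_mu : μ.HasBideg 1 2
  bideg_gamma : γ.HasBideg 2 1
  bideg_psi : ψ.HasBideg 3 0
  gamma_gamma : (1 / 2 : ℝ) • poisson γ γ + poisson μ ψ = 0
  mu_mu : poisson μ μ = 0
  mu_gamma : poisson μ γ = 0
  gamma_psi : poisson γ ψ = 0

/-- `μ` makes `TM` a Lie algebroid: `d_μ = {μ,·}` is a homological vector field on `ΠTM`. -/
structure IsLieAlgebroid (μ : ChartFn n M) : Prop where
  isGlobal : μ.IsGlobal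
  hasBideg : μ.HasBideg 1 2
  d_sq : ∀ (φ : Chart n M) (k : ℕ), ∀ α ∈ LocalFn.bideg φ.image 0 k,
    LocalFn.poisson (μ φ) (LocalFn.poisson (μ φ) α) = 0

/-- `γ` makes `T*M` a Lie algebroid: `d_γ = {γ,·}` is a homological vector field on `ΠT*M`. -/
structure IsLieAlgebroidDual (γ : ChartFn n M) : Prop where
  isGlobal : γ.IsGlobal
  hasBideg : γ.HasBideg 2 1
  d_sq : ∀ (φ : Chart n M) (k : ℕ), ∀ X ∈ LocalFn.bideg φ.image k 0,
    LocalFn.poisson (γ φ) (LocalFn.poisson (γ φ) X) = 0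

/-- The derived bracket `[X,Y]_Θ = {{X,Θ},Y}`. -/
noncomputable def derived {U : TopologicalSpace.Opens (EuclideanSpace ℝ (Fin n))}
    (Θ X Y : LocalFn U) : LocalFn U :=
  LocalFn.poisson (LocalFn.poisson X Θ) Y

/-- `(μ, γ)` is a Lie bialgebroid structure on `(TM, T*M)`: both are Lie algebroids, and `d_μ` is
a derivation of the Schouten bracket `[·,·]_γ` of `T*M`. -/
structure IsLieBialgebroid (μ γ : ChartFn n M) : Prop where
  lie : IsLieAlgebroid μ
  lie_dual : IsLieAlgebroidDual γ
  compat : ∀ (φ : Chart n M) (k l : ℕ), ∀ α ∈ LocalFn.bideg φ.image 0 k,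
    ∀ β ∈ LocalFn.bideg φ.image 0 l,
    LocalFn.poisson (μ φ) (derived (γ φ) α β) =
      derived (γ φ) (LocalFn.poisson (μ φ) α) β
        + (-1 : ℝ) ^ (k + 1) • derived (γ φ) α (LocalFn.poisson (μ φ) β)

/-- `(μ, γ)` is a Lie bialgebroid structure on `(T*M, TM)`: both are Lie algebroids, and `d_γ` is
a derivation of the Schouten bracket `[·,·]_μ` of `TM`. -/
structure IsLieBialgebroidDual (μ γ : ChartFn n M) : Prop where
  lie : IsLieAlgebroid μ
  lie_dual : IsLieAlgebroidDual γ
  compat : ∀ (φ : Chart n M) (k l : ℕ), ∀ X ∈ LocalFn.bideg φ.image k 0,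
    ∀ Y ∈ LocalFn.bideg φ.image l 0,
    LocalFn.poisson (γ φ) (derived (μ φ) X Y) =
      derived (μ φ) (LocalFn.poisson (γ φ) X) Y
        + (-1 : ℝ) ^ (k + 1) • derived (μ φ) X (LocalFn.poisson (γ φ) Y)

/-! ## Bivector fields -/

/-- The coordinate covector `dx^i` at `m` of the chart `φ`. -/
noncomputable def Chart.coordCovector (φ : Chart n M) (i : Fin n) (m : M) :
    TangentSpace (𝓡 n) m →L[ℝ] ℝ :=
  (EuclideanSpace.proj (𝕜 := ℝ) i).comp (mfderiv (𝓡 n) (𝓡 n) φ.1 m)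

variable (n M) in
/-- A smooth bivector field on `M`: an alternating bilinear form on each cotangent space, with
smooth components `π^{ij} = π(dx^i, dx^j)` in each chart. -/
structure BivectorField where
  toFun : ∀ m : M, (TangentSpace (𝓡 n) m →L[ℝ] ℝ) [⋀^Fin 2]→ₗ[ℝ] ℝ
  smooth : ∀ (φ : Chart n M) (i j : Fin n), ContDiffOn ℝ ∞
    (fun x => toFun (φ.1.symm x)
      ![φ.coordCovector i (φ.1.symm x), φ.coordCovector j (φ.1.symm x)]) φ.1.target

namespace BivectorField

/-- The component `π^{ij}` in the chart `φ`. -/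
noncomputable def component (π : BivectorField n M) (φ : Chart n M) (i j : Fin n) :
    Smooth φ.image :=
  ⟨fun x => π.toFun (φ.1.symm x)
      ![φ.coordCovector i (φ.1.symm x), φ.coordCovector j (φ.1.symm x)],
    _, π.smooth φ i j, fun _ => rfl⟩

/-- The function `½ π^{ij} θ_i θ_j` of double degree `(2,0)` on `T*ΠTM`. -/
noncomputable def toFn (π : BivectorField n M) : ChartFn n M := fun φ =>
  (1 / 2 : ℝ) • ∑ i : Fin n, ∑ j : Fin n,
    π.component φ i j ⊗ₜ[ℝ] (gen (Gen.theta i) * gen (Gen.theta j))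

end BivectorField

end Manifold

end SuperCotangent

namespace SuperCotangent

/-! ## The fibre algebra -/

/-! Write `B` for the function of a bivector field in one chart, `d_i` for the derivative by `x^i`
and `t_i` for the left derivative by `θ_i`. Everything is governed by two expressions in `B`: the
odd derivation `ham B = -(t_i B d_i + d_i B t_i)`, which is `[B,·]`, and the odd function `sq B =
t_i B d_i B`, which is `-½[B,B]`.

The hamiltonian `h_d = ξ^i p_i` acts by `ξ^i d_i + p_i t_i`, a derivation of square zero on all
functions (`koszul_sq`). Direct computation gives `{B, h_d} = h_{[B,·]}`, then `{B, h_{[B,·]}} = 2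
sq B`, and `{B, sq B} = 0` because functions of `x` and `θ` alone commute. So the exponential series
ends after three terms, with the stated components. Their uniqueness follows by scaling `θ` and `p`
by `s`: the four components acquire different powers of `s`.

With `γ = h_{[B,·]}` the structure equations are `{h_d,γ} = 0`, since `γ = -{h_d,B}`; `{γ,γ} =
-2{h_d, sq B}` (`poisson_hamDual_self`); `{γ, sq B} = 0`, which is `[B,[B,B]] = 0` (`ham_sq_self`);
and `{sq B, sq B} = 0`. The general Jacobi identity of the Poisson bracket is nowhere needed. The
engine is that `ham B` sends its own coefficients `t_j B`, `d_j B` to `t_j (sq B)`, `-d_j (sq B)`.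

The derivation property of `d_γ` is the Jacobi identity for `[B,·]` (`ham_bracket`) and holds for
every `B`, so only `d_γ² = ½[[B,B],·]` (`ham_ham`) carries a condition. Applied to `x^j`, or read
off from `{γ,γ} = 0` as the coefficient of `p_j`, the condition gives `t_j (sq B) = 0` for all `j`,
and Euler's identity `θ_j t_j = 3` in degree `(3,0)` yields `sq B = 0`.

That the components are functions on the whole of `T*ΠTM` is a pointwise computation in the fibre
algebra (`changeHom_xi_p`, `BivectorChange.ham_eq`, `BivectorChange.sq_eq`): the second derivatives
of the coordinate change enter through factors symmetric in two indices and cancel against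
anticommuting ones. -/

theorem two_smul_cancel {V : Type*} [AddCommGroup V] [Module ℝ V] {a b : V}
    (h : a + a = b + b) : a = b := by
  have : (2 : ℝ) • a = (2 : ℝ) • b := by rw [two_smul, two_smul, h]
  exact smul_right_injective V (two_ne_zero (α := ℝ)) this

section Fibre

variable {n : ℕ}

theorem FibreAlg.mk_surjective (n : ℕ) : Function.Surjective (FibreAlg.mk n) :=
  RingQuot.mkAlgHom_surjective ℝ (Rel n)

theorem FibreAlg.induction {C : FibreAlg n → Prop} (hr : ∀ r : ℝ, C (algebraMap ℝ _ r))
    (hg : ∀ g, C (gen g)) (hmul : ∀ a b, C a → C b → C (a * b))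
    (hadd : ∀ a b, C a → C b → C (a + b)) (a : FibreAlg n) : C a := by
  obtain ⟨a, rfl⟩ := FibreAlg.mk_surjective n a
  induction a using FreeAlgebra.induction with
  | grade0 r => simpa using hr r
  | grade1 g => exact hg g
  | mul a b ha hb => simpa using hmul _ _ ha hb
  | add a b ha hb => simpa using hadd _ _ ha hb

theorem liftGen_gen {A : Type*} [Ring A] [Algebra ℝ A] (f : Gen n → A)
    (hf : ∀ g h, f g * f h = koszul g h • (f h * f g)) (g : Gen n) :
    liftGen f hf (gen g) = f g := by
  have : RingQuot.liftAlgHom ℝ ⟨FreeAlgebra.lift ℝ f, by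
    rintro _ _ ⟨g, h⟩
    simpa using hf g h⟩ (RingQuot.mkAlgHom ℝ (Rel n) (FreeAlgebra.ι ℝ g)) = f g := by
    rw [RingQuot.liftAlgHom_mkAlgHom_apply, FreeAlgebra.lift_ι_apply]
  exact this

theorem FibreAlg.algHom_ext {A : Type*} [Semiring A] [Algebra ℝ A] {f f' : FibreAlg n →ₐ[ℝ] A}
    (h : ∀ g, f (gen g) = f' (gen g)) : f = f' := by
  refine AlgHom.ext fun a => ?_
  induction a using FibreAlg.induction with
  | hr r => simp
  | hg g => exact h g
  | hmul a b ha hb => simp [ha, hb]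
  | hadd a b ha hb => simp [ha, hb]

/-- The products of coordinates span the fibre algebra. -/
theorem FibreAlg.span_prod : Submodule.span ℝ
    (Set.range fun w : List (Gen n) => (w.map gen).prod) = ⊤ := by
  refine eq_top_iff.2 fun a _ => ?_
  induction a using FibreAlg.induction with
  | hr r =>
    rw [Algebra.algebraMap_eq_smul_one]
    exact Submodule.smul_mem _ _ (Submodule.subset_span ⟨[], by simp⟩)
  | hg g => exact Submodule.subset_span ⟨[g], by simp⟩
  | hmul a b ha hb =>
    have := Submodule.mul_mem_mul (ha trivial) (hb trivial)
    rw [Submodule.span_mul_span] at this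
    refine Submodule.span_mono ?_ this
    rintro _ ⟨_, ⟨v, rfl⟩, _, ⟨w, rfl⟩, rfl⟩
    exact ⟨v ++ w, by simp⟩
  | hadd a b ha hb => exact Submodule.add_mem _ (ha trivial) (hb trivial)

/-- The rescaling of the coordinates. -/
noncomputable def rescale (c : Gen n → ℝ) : FibreAlg n →ₐ[ℝ] FibreAlg n :=
  liftGen (fun g => c g • gen g) fun g h => by
    rw [smul_mul_smul_comm, smul_mul_smul_comm, gen_swap g h, smul_smul, smul_smul]
    congr 1; ring

theorem rescale_gen (c : Gen n → ℝ) (g : Gen n) : rescale c (gen g) = c g • gen g :=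
  liftGen_gen _ _ g

/-- The rescaling by the sign which occurs in the Leibniz rule for the left derivative by `g`. -/
noncomputable def koszulSign (g : Gen n) : FibreAlg n →ₐ[ℝ] FibreAlg n := rescale (koszul g)

/-- The parity involution `a ↦ (-1)^{|a|} a`. -/
noncomputable def fibreParity (n : ℕ) : FibreAlg n →ₐ[ℝ] FibreAlg n :=
  rescale fun g => if g.odd then -1 else 1

theorem koszulSign_of_odd {g : Gen n} (hg : g.odd = true) : koszulSign g = fibreParity n := by
  refine FibreAlg.algHom_ext fun h => ?_
  simp [koszulSign, fibreParity, rescale_gen, koszul, hg]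

theorem koszulSign_of_even {g : Gen n} (hg : g.odd = false) : koszulSign g = AlgHom.id ℝ _ := by
  refine FibreAlg.algHom_ext fun h => ?_
  simp [koszulSign, rescale_gen, koszul, hg]

theorem fibreParity_gen (g : Gen n) :
    fibreParity n (gen g) = (if g.odd then (-1 : ℝ) else 1) • gen g := rescale_gen _ g

theorem leftDerivHom_gen (g h : Gen n) : leftDerivHom g (gen h) =
    !![koszul g h • gen h, if g = h then 1 else 0; 0, gen h] := liftGen_gen _ _ h

/-- The image is upper triangular with diagonal entries `koszulSign g a` and `a`, so the
off-diagonal entry of a product is exactly the signed Leibniz rule. The diagonal is multiplicative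
and can be checked on coordinates. -/
theorem leftDerivHom_eq (g : Gen n) (a : FibreAlg n) :
    leftDerivHom g a = !![koszulSign g a, leftDeriv g a; 0, a] := by
  have h : leftDerivHom g a 0 0 = koszulSign g a ∧ leftDerivHom g a 1 0 = 0 ∧
      leftDerivHom g a 1 1 = a := by
    induction a using FibreAlg.induction with
    | hr r => simp [Matrix.algebraMap_matrix_apply]
    | hg h => simp [leftDerivHom_gen, koszulSign, rescale_gen]
    | hmul a b ha hb => simp [Matrix.mul_apply, ha, hb]
    | hadd a b ha hb => simp [ha, hb]
  ext i j
  fin_cases i <;> fin_cases j <;> (simp [h]; try rfl)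

theorem leftDeriv_mul (g : Gen n) (a b : FibreAlg n) :
    leftDeriv g (a * b) = leftDeriv g a * b + koszulSign g a * leftDeriv g b := by
  have h : leftDeriv g (a * b) = leftDerivHom g (a * b) 0 1 := rfl
  rw [h, map_mul, leftDerivHom_eq, leftDerivHom_eq]
  simp [Matrix.mul_apply, add_comm]

theorem leftDeriv_gen (g h : Gen n) : leftDeriv g (gen h) = if g = h then 1 else 0 := by
  have e : leftDeriv g (gen h) = leftDerivHom g (gen h) 0 1 := rfl
  rw [e, leftDerivHom_gen]; rfl

theorem leftDeriv_one (g : Gen n) : leftDeriv g (1 : FibreAlg n) = 0 := by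
  have := leftDeriv_mul g 1 1
  simpa using this

theorem leftDeriv_algebraMap (g : Gen n) (r : ℝ) :
    leftDeriv g (algebraMap ℝ (FibreAlg n) r) = 0 := by
  rw [Algebra.algebraMap_eq_smul_one, map_smul, leftDeriv_one, smul_zero]

theorem rightDerivHom_gen (g h : Gen n) : rightDerivHom g (gen h) =
    !![gen h, if g = h then 1 else 0; 0, koszul g h • gen h] := liftGen_gen _ _ h

theorem rightDerivHom_eq (g : Gen n) (a : FibreAlg n) :
    rightDerivHom g a = !![a, rightDeriv g a; 0, koszulSign g a] := by
  have h : rightDerivHom g a 0 0 = a ∧ rightDerivHom g a 1 0 = 0 ∧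
      rightDerivHom g a 1 1 = koszulSign g a := by
    induction a using FibreAlg.induction with
    | hr r => simp [Matrix.algebraMap_matrix_apply]
    | hg h => simp [rightDerivHom_gen, koszulSign, rescale_gen]
    | hmul a b ha hb => simp [Matrix.mul_apply, ha, hb]
    | hadd a b ha hb => simp [ha, hb]
  ext i j
  fin_cases i <;> fin_cases j <;> (simp [h]; try rfl)

theorem rightDeriv_mul (g : Gen n) (a b : FibreAlg n) :
    rightDeriv g (a * b) = a * rightDeriv g b + rightDeriv g a * koszulSign g b := by
  have h : rightDeriv g (a * b) = rightDerivHom g (a * b) 0 1 := rfl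
  rw [h, map_mul, rightDerivHom_eq, rightDerivHom_eq]
  simp [Matrix.mul_apply]

theorem rightDeriv_gen (g h : Gen n) : rightDeriv g (gen h) = if g = h then 1 else 0 := by
  have e : rightDeriv g (gen h) = rightDerivHom g (gen h) 0 1 := rfl
  rw [e, rightDerivHom_gen]; rfl

theorem rightDeriv_one (g : Gen n) : rightDeriv g (1 : FibreAlg n) = 0 := by
  have := rightDeriv_mul g 1 1
  simpa using this

theorem fibreParity_fibreParity (a : FibreAlg n) : fibreParity n (fibreParity n a) = a := by
  have : (fibreParity n).comp (fibreParity n) = AlgHom.id ℝ _ := by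
    refine FibreAlg.algHom_ext fun g => ?_
    simp only [AlgHom.comp_apply, fibreParity_gen, map_smul, AlgHom.id_apply]
    split_ifs <;> simp
  exact DFunLike.congr_fun this a

/-- A product of coordinates is either even and central, or odd and commuting with `b` up to the
parity of `b`. The dichotomy is proved by moving one coordinate at a time past `b`; it replaces a
decomposition of the algebra into even and odd parts. -/
theorem fibreParity_prod (w : List (Gen n)) :
    (fibreParity n (w.map gen).prod = (w.map gen).prod ∧
      ∀ b, (w.map gen).prod * b = b * (w.map gen).prod) ∨
    (fibreParity n (w.map gen).prod = -(w.map gen).prod ∧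
      ∀ b, (w.map gen).prod * b = fibreParity n b * (w.map gen).prod) := by
  have hgen : ∀ (g : Gen n) (b : FibreAlg n),
      gen g * b = (if g.odd then fibreParity n b else b) * gen g := by
    intro g b
    induction b using FibreAlg.induction with
    | hr r => cases h : g.odd <;> simp [Algebra.commutes]
    | hg h =>
      rw [gen_swap g h, fibreParity_gen, koszul]
      cases g.odd <;> cases h.odd <;> simp
    | hmul a b ha hb =>
      rw [← mul_assoc, ha, mul_assoc, hb, ← mul_assoc]
      cases g.odd <;> simp
    | hadd a b ha hb =>
      rw [mul_add, ha, hb, ← add_mul]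
      cases g.odd <;> simp
  induction w with
  | nil => simp
  | cons g w ih =>
    simp only [List.map_cons, List.prod_cons, map_mul, fibreParity_gen]
    rcases ih with ⟨h, hc⟩ | ⟨h, hc⟩ <;> cases hg : g.odd
    · exact .inl ⟨by simp [h], fun b => by
        rw [mul_assoc, hc, ← mul_assoc, hgen]; simp [hg, mul_assoc]⟩
    · exact .inr ⟨by simp [h], fun b => by
        rw [mul_assoc, hc, ← mul_assoc, hgen]; simp [hg, mul_assoc]⟩
    · exact .inr ⟨by simp [h], fun b => by
        rw [mul_assoc, hc, ← mul_assoc, hgen]; simp [hg, mul_assoc]⟩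
    · exact .inl ⟨by simp [h], fun b => by
        rw [mul_assoc, hc, ← mul_assoc, hgen]
        simp [hg, mul_assoc, fibreParity_fibreParity]⟩

/-- `a + fibreParity n a` is twice the even part of `a`. The claim is linear in `a`, and on an odd
product of coordinates the sum is zero. In the same way `a - fibreParity n a` below is twice the odd
part. -/
theorem add_fibreParity_mul (a b : FibreAlg n) :
    (a + fibreParity n a) * b = b * (a + fibreParity n a) := by
  have ha : a ∈ Submodule.span ℝ (Set.range fun w : List (Gen n) => (w.map gen).prod) := by
    rw [FibreAlg.span_prod]; trivial
  induction ha using Submodule.span_induction with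
  | mem a h =>
    obtain ⟨w, rfl⟩ := h
    rcases fibreParity_prod w with ⟨h, hc⟩ | ⟨h, hc⟩
    · simp only [h, add_mul, mul_add, hc]
    · simp [h]
  | zero => simp
  | add x y _ _ hx hy =>
    rw [map_add, add_add_add_comm, add_mul (x + _), hx, hy, mul_add b (x + _)]
  | smul r x _ hx =>
    rw [map_smul, ← smul_add, smul_mul_assoc, hx, mul_smul_comm]

theorem sub_fibreParity_mul (a b : FibreAlg n) :
    (a - fibreParity n a) * b = fibreParity n b * (a - fibreParity n a) := by
  have ha : a ∈ Submodule.span ℝ (Set.range fun w : List (Gen n) => (w.map gen).prod) := by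
    rw [FibreAlg.span_prod]; trivial
  induction ha using Submodule.span_induction with
  | mem a h =>
    obtain ⟨w, rfl⟩ := h
    rcases fibreParity_prod w with ⟨h, hc⟩ | ⟨h, hc⟩
    · simp [h]
    · simp only [h, sub_neg_eq_add, add_mul, mul_add, hc]
  | zero => simp
  | add x y _ _ hx hy =>
    rw [map_add, add_sub_add_comm, add_mul (x - _), hx, hy, mul_add _ (x - _)]
  | smul r x _ hx =>
    rw [map_smul, ← smul_sub, smul_mul_assoc, hx, mul_smul_comm]

/-- `koszulSign g` multiplies the coordinate `h` by `koszul g h`, and the derivative by `h` removes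
one such factor; the factor is `±1`, hence its own inverse. -/
theorem koszulSign_leftDeriv (g h : Gen n) (a : FibreAlg n) :
    koszulSign g (leftDeriv h a) = koszul g h • leftDeriv h (koszulSign g a) := by
  induction a using FibreAlg.induction with
  | hr r => simp [leftDeriv_algebraMap]
  | hg k =>
    rw [leftDeriv_gen, koszulSign, rescale_gen, map_smul, leftDeriv_gen]
    split_ifs with e
    · subst e; simp [smul_smul, koszul_self_mul]
    · simp
  | hmul a b ha hb =>
    have hc : koszulSign g (koszulSign h a) = koszulSign h (koszulSign g a) := by
      have : (koszulSign g).comp (koszulSign h) = (koszulSign h).comp (koszulSign g) :=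
        FibreAlg.algHom_ext fun k => by
          simp [koszulSign, rescale_gen, smul_smul, mul_comm]
      exact DFunLike.congr_fun this a
    simp only [leftDeriv_mul, map_add, map_mul, ha, hb, hc, smul_add, smul_mul_assoc,
      mul_smul_comm]
  | hadd a b ha hb => simp [ha, hb]

theorem leftDeriv_comm (g h : Gen n) (a : FibreAlg n) :
    leftDeriv g (leftDeriv h a) = koszul g h • leftDeriv h (leftDeriv g a) := by
  induction a using FibreAlg.induction with
  | hr r => simp [leftDeriv_algebraMap]
  | hg k =>
    simp only [leftDeriv_gen]
    split_ifs <;> simp [leftDeriv_one]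
  | hmul a b ha hb =>
    have hc : koszulSign g (koszulSign h a) = koszulSign h (koszulSign g a) := by
      have : (koszulSign g).comp (koszulSign h) = (koszulSign h).comp (koszulSign g) :=
        FibreAlg.algHom_ext fun k => by
          simp [koszulSign, rescale_gen, smul_smul, mul_comm]
      exact DFunLike.congr_fun this a
    have h2 : leftDeriv g (koszulSign h a) = koszul g h • koszulSign h (leftDeriv g a) := by
      rw [koszulSign_leftDeriv, koszul_symm h g, smul_smul, koszul_self_mul, one_smul]
    simp only [leftDeriv_mul, map_add, ha, hb, hc, h2, koszulSign_leftDeriv g h, smul_add,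
      smul_mul_assoc, mul_smul_comm]
    abel
  | hadd a b ha hb => simp [ha, hb]

theorem fibreParity_leftDeriv {g : Gen n} (hg : g.odd = true) (a : FibreAlg n) :
    fibreParity n (leftDeriv g a) = -leftDeriv g (fibreParity n a) := by
  have := koszulSign_leftDeriv g g a
  rw [koszulSign_of_odd hg] at this
  simpa [koszul, hg] using this

/-- Moving an odd derivative from left to right costs `(-1)^{|a|-1}`, which is the parity of the
derivative of `a`. This removes right derivatives from the Poisson and Schouten brackets. -/
theorem rightDeriv_of_odd {g : Gen n} (hg : g.odd = true) (a : FibreAlg n) :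
    rightDeriv g a = fibreParity n (leftDeriv g a) := by
  induction a using FibreAlg.induction with
  | hr r =>
    rw [leftDeriv_algebraMap, Algebra.algebraMap_eq_smul_one, map_smul, rightDeriv_one]; simp
  | hg k => rw [rightDeriv_gen, leftDeriv_gen]; split_ifs <;> simp
  | hmul a b ha hb =>
    rw [rightDeriv_mul, leftDeriv_mul, ha, hb, koszulSign_of_odd hg, map_add, map_mul, map_mul,
      fibreParity_fibreParity, add_comm]
  | hadd a b ha hb => simp [ha, hb]

/-! ### The double degree -/

theorem fibreBideg_mul {k l k' l' : ℕ} {a b : FibreAlg n} (ha : a ∈ fibreBideg n k l)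
    (hb : b ∈ fibreBideg n k' l') : a * b ∈ fibreBideg n (k + k') (l + l') := by
  have := Submodule.mul_mem_mul ha hb
  rw [fibreBideg, fibreBideg, Submodule.span_mul_span] at this
  refine Submodule.span_mono ?_ this
  rintro _ ⟨_, ⟨v, hv, rfl⟩, _, ⟨w, hw, rfl⟩, rfl⟩
  exact ⟨v ++ w, by simp [hv, hw], by simp⟩

theorem gen_mem_fibreBideg (g : Gen n) : gen g ∈ fibreBideg n g.bidegree.1 g.bidegree.2 :=
  Submodule.subset_span ⟨[g], by simp, by simp⟩

theorem one_mem_fibreBideg : (1 : FibreAlg n) ∈ fibreBideg n 0 0 :=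
  Submodule.subset_span ⟨[], rfl, by simp⟩

theorem rescale_pow_of_mem_fibreBideg {k l : ℕ} {a : FibreAlg n} (ha : a ∈ fibreBideg n k l)
    (s t : ℝ) : rescale (fun g => s ^ g.bidegree.1 * t ^ g.bidegree.2) a = (s ^ k * t ^ l) • a := by
  induction ha using Submodule.span_induction with
  | mem a h =>
    obtain ⟨w, hw, rfl⟩ := h
    induction w generalizing k l with
    | nil =>
      obtain ⟨rfl, rfl⟩ : 0 = k ∧ 0 = l := Prod.ext_iff.1 hw
      simp
    | cons g w ih =>
      obtain ⟨rfl, rfl⟩ : g.bidegree.1 + (w.map Gen.bidegree).sum.1 = k ∧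
          g.bidegree.2 + (w.map Gen.bidegree).sum.2 = l := Prod.ext_iff.1 hw
      rw [List.map_cons, List.prod_cons, map_mul, rescale_gen, ih rfl, smul_mul_smul_comm]
      rw [pow_add, pow_add, mul_mul_mul_comm]
      rfl
  | zero => simp
  | add x y _ _ hx hy => rw [map_add, hx, hy, smul_add]
  | smul r x _ hx => rw [map_smul, hx, smul_comm]

/-- The parity involution is the rescaling by double degree with `s = t = -1`: it gives `-1` on `ξ`
and `θ`, and `(-1)(-1) = 1` on `p`. -/
theorem fibreParity_of_mem_fibreBideg {k l : ℕ} {a : FibreAlg n} (ha : a ∈ fibreBideg n k l) :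
    fibreParity n a = (-1 : ℝ) ^ (k + l) • a := by
  rw [pow_add, ← rescale_pow_of_mem_fibreBideg ha]
  refine DFunLike.congr_fun (FibreAlg.algHom_ext fun g => ?_) a
  rw [fibreParity_gen, rescale_gen]
  cases g <;> simp [Gen.odd, Gen.bidegree]

theorem leftDeriv_prod_eq_zero {g : Gen n} {w : List (Gen n)} (hg : g ∉ w) :
    leftDeriv g (w.map gen).prod = 0 := by
  induction w with
  | nil => simp [leftDeriv_one]
  | cons h w ih =>
    rw [List.mem_cons, not_or] at hg
    rw [List.map_cons, List.prod_cons, leftDeriv_mul, leftDeriv_gen, ih hg.2, if_neg hg.1]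
    simp

theorem Gen.bidegree_le_sum {g : Gen n} {w : List (Gen n)} (hg : g ∈ w) :
    g.bidegree ≤ (w.map Gen.bidegree).sum :=
  List.single_le_sum (by simp) _ (List.mem_map_of_mem hg)

theorem leftDeriv_eq_zero_of_mem {g : Gen n} {k l : ℕ} {a : FibreAlg n}
    (ha : a ∈ fibreBideg n k l) (hg : ¬ g.bidegree ≤ (k, l)) : leftDeriv g a = 0 := by
  induction ha using Submodule.span_induction with
  | mem a h =>
    obtain ⟨w, hw, rfl⟩ := h
    exact leftDeriv_prod_eq_zero fun h => hg (hw ▸ Gen.bidegree_le_sum h)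
  | zero => simp
  | add x y _ _ hx hy => rw [map_add, hx, hy, add_zero]
  | smul r x _ hx => rw [map_smul, hx, smul_zero]

theorem leftDeriv_mem_fibreBideg (g : Gen n) {k l k' l' : ℕ} {a : FibreAlg n}
    (ha : a ∈ fibreBideg n k l) (h : (k, l) = g.bidegree + (k', l')) :
    leftDeriv g a ∈ fibreBideg n k' l' := by
  induction ha using Submodule.span_induction with
  | mem a ha =>
    obtain ⟨w, hw, rfl⟩ := ha
    rw [h] at hw
    clear h
    induction w generalizing k' l' with
    | nil => simp [leftDeriv_one]
    | cons f w ih =>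
      rw [List.map_cons, List.prod_cons, leftDeriv_mul, leftDeriv_gen]
      refine Submodule.add_mem _ ?_ ?_
      · split_ifs with e
        · subst e
          rw [List.map_cons, List.sum_cons] at hw
          rw [one_mul]
          exact Submodule.subset_span ⟨w, add_left_cancel hw, rfl⟩
        · simp
      -- If `g` occurs in `w`, its double degree can be subtracted from that of `w` and the
      -- induction hypothesis applies; otherwise the derivative of the remaining product vanishes.
      · by_cases hgw : g ∈ w
        · obtain ⟨d, hd⟩ := exists_add_of_le (Gen.bidegree_le_sum hgw)
          rw [List.map_cons, List.sum_cons, hd, add_left_comm] at hw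
          have hw := add_left_cancel hw
          rw [koszulSign, rescale_gen, smul_mul_assoc]
          obtain ⟨h1, h2⟩ := Prod.ext_iff.1 hw
          simp only [Prod.fst_add, Prod.snd_add] at h1 h2
          subst h1 h2
          exact Submodule.smul_mem _ _ (fibreBideg_mul (gen_mem_fibreBideg f)
            (ih (k' := d.1) (l' := d.2) hd))
        · rw [leftDeriv_prod_eq_zero hgw, mul_zero]
          exact Submodule.zero_mem _
  | zero => simp
  | add x y _ _ hx hy => rw [map_add]; exact Submodule.add_mem _ hx hy
  | smul r x _ hx => rw [map_smul]; exact Submodule.smul_mem _ _ hx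

/-- Euler's identity for multivectors. -/
theorem sum_theta_mul_leftDeriv {k : ℕ} {a : FibreAlg n} (ha : a ∈ fibreBideg n k 0) :
    ∑ i, gen (Gen.theta i) * leftDeriv (Gen.theta i) a = (k : ℝ) • a := by
  induction ha using Submodule.span_induction with
  | mem a ha =>
    obtain ⟨w, hw, rfl⟩ := ha
    induction w generalizing k with
    | nil =>
      obtain rfl : 0 = k := congrArg Prod.fst hw
      simp [leftDeriv_one]
    | cons f w ih =>
      have hf : f.bidegree.2 + (w.map Gen.bidegree).sum.2 = 0 := 
        congrArg Prod.snd hw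
      have hk : f.bidegree.1 + (w.map Gen.bidegree).sum.1 = k := 
        congrArg Prod.fst hw
      cases f with
      | xi j => simp [Gen.bidegree] at hf
      | p j => simp [Gen.bidegree] at hf
      | theta j =>
        have hw' : (w.map Gen.bidegree).sum = ((w.map Gen.bidegree).sum.1, 0) := by
          ext
          · rfl
          · simpa [Gen.bidegree] using hf
        -- `θ_j` passes both `θ_i` and the derivative by `θ_i`; the two signs cancel, and the
        -- derivative of `θ_j` itself contributes one extra copy of the product.
        have h1 : ∀ i, gen (Gen.theta i) * leftDeriv (Gen.theta i)
            (gen (Gen.theta j) * (w.map gen).prod) =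
            (if i = j then gen (Gen.theta j) * (w.map gen).prod else 0) +
            gen (Gen.theta j) * (gen (Gen.theta i) *
              leftDeriv (Gen.theta i) (w.map gen).prod) := by
          intro i
          have := gen_swap (Gen.theta i) (Gen.theta j)
          rw [leftDeriv_mul, leftDeriv_gen, mul_add, koszulSign, rescale_gen, smul_mul_assoc,
            mul_smul_comm, ← mul_assoc, ← mul_assoc, this]
          by_cases e : i = j
          · subst e; simp [koszul, Gen.odd, mul_assoc]
          · simp [e, koszul, Gen.odd, mul_assoc]
        rw [List.map_cons, List.prod_cons, Finset.sum_congr rfl fun i _ => h1 i,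
          Finset.sum_add_distrib, ← Finset.mul_sum, ih hw', ← hk]
        simp [Gen.bidegree, add_smul]
  | zero => simp
  | add x y _ _ hx hy => simp only [map_add, mul_add, Finset.sum_add_distrib, hx, hy, smul_add]
  | smul r x _ hx =>
    simp only [map_smul, mul_smul_comm, ← Finset.smul_sum, hx, smul_comm r]

end Fibre

end SuperCotangent

namespace SuperCotangent

/-! ## Partial derivatives of smooth functions -/

section Smooth

variable {n : ℕ} {U : TopologicalSpace.Opens (EuclideanSpace ℝ (Fin n))}

theorem partialX_apply (i : Fin n) (f : Smooth U) (x : U) :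
    (partialX U i f).1 x = fderiv ℝ (extendZero f.1) x (EuclideanSpace.single i 1) := rfl

/-- The derivative may be computed with any function which agrees with `f` on `U`. -/
theorem partialX_apply_of_eq (i : Fin n) (f : Smooth U) {g : EuclideanSpace ℝ (Fin n) → ℝ}
    (h : ∀ x : U, f.1 x = g x) (x : U) :
    (partialX U i f).1 x = fderiv ℝ g x (EuclideanSpace.single i 1) := by
  rw [partialX_apply]
  have : extendZero f.1 =ᶠ[nhds (x : EuclideanSpace ℝ (Fin n))] g := by
    filter_upwards [U.isOpen.mem_nhds x.2] with y hy
    exact (extendZero_apply f.1 ⟨y, hy⟩).trans (h ⟨y, hy⟩)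
  rw [this.fderiv_eq]

theorem partialX_mul (i : Fin n) (f g : Smooth U) :
    partialX U i (f * g) = partialX U i f * g + f * partialX U i g := by
  ext x
  rw [partialX_apply_of_eq i (f * g) (g := fun y => extendZero f.1 y * extendZero g.1 y)
    (fun y => by rw [extendZero_apply, extendZero_apply]; rfl)]
  change _ = (partialX U i f).1 x * g.1 x + f.1 x * (partialX U i g).1 x
  rw [fderiv_fun_mul (differentiableAt_extendZero f x) (differentiableAt_extendZero g x),
    partialX_apply, partialX_apply, extendZero_apply, extendZero_apply]
  simp
  ring

theorem partialX_one (i : Fin n) : partialX U i 1 = 0 := by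
  have := partialX_mul i (1 : Smooth U) 1
  simpa using this

theorem partialX_comm (i j : Fin n) (f : Smooth U) :
    partialX U i (partialX U j f) = partialX U j (partialX U i f) := by
  ext x
  have hc : ContDiffAt ℝ ∞ (extendZero f.1) x :=
    (contDiffOn_extendZero f).contDiffAt (U.isOpen.mem_nhds x.2)
  have hd : DifferentiableAt ℝ (fderiv ℝ (extendZero f.1)) x :=
    (hc.fderiv_right (m := ∞) (by simp)).differentiableAt (by simp)
  have key : ∀ i j : Fin n, (partialX U i (partialX U j f)).1 x =
      fderiv ℝ (fderiv ℝ (extendZero f.1)) x (EuclideanSpace.single i 1)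
        (EuclideanSpace.single j 1) := by
    intro i j
    rw [partialX_apply_of_eq i _
      (g := fun y => fderiv ℝ (extendZero f.1) y (EuclideanSpace.single j 1)) (fun y => rfl),
      fderiv_clm_apply hd (differentiableAt_const _)]
    simp
  change (partialX U i (partialX U j f)).1 x = (partialX U j (partialX U i f)).1 x
  rw [key, key]
  exact (hc.isSymmSndFDerivAt (by
    rw [minSmoothness_of_isRCLikeNormedField]
    exact WithTop.coe_le_coe.2 (le_top : (2 : ℕ∞) ≤ ⊤))).eq _ _

theorem partialX_coordX (i j : Fin n) :
    partialX U i (coordX U j) = if i = j then 1 else 0 := by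
  ext x
  rw [partialX_apply_of_eq i _ (g := fun y => EuclideanSpace.proj (𝕜 := ℝ) j y) (fun y => rfl),
    ContinuousLinearMap.fderiv]
  split_ifs with h
  · subst h; simp
  · simp [Ne.symm h]

end Smooth

/-! ## Functions on `T*ΠTU` -/

namespace LocalFn

variable {n : ℕ} {U : TopologicalSpace.Opens (EuclideanSpace ℝ (Fin n))}

noncomputable instance : Ring (LocalFn U) := Algebra.TensorProduct.instRing

/-- The parity involution `F ↦ (-1)^{|F|} F`. -/
noncomputable def parity : LocalFn U →ₐ[ℝ] LocalFn U :=
  Algebra.TensorProduct.map (AlgHom.id ℝ _) (fibreParity n)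

/-- The rescaling of the fibre coordinates. -/
noncomputable def scale (c : Gen n → ℝ) : LocalFn U →ₐ[ℝ] LocalFn U :=
  Algebra.TensorProduct.map (AlgHom.id ℝ _) (rescale c)

theorem parity_tmul (f : Smooth U) (a : FibreAlg n) :
    parity (f ⊗ₜ[ℝ] a) = f ⊗ₜ[ℝ] fibreParity n a := rfl

theorem dx_tmul (i : Fin n) (f : Smooth U) (a : FibreAlg n) :
    dx i (f ⊗ₜ[ℝ] a) = partialX U i f ⊗ₜ[ℝ] a := rfl

theorem dl_tmul (g : Gen n) (f : Smooth U) (a : FibreAlg n) :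
    dl g (f ⊗ₜ[ℝ] a) = f ⊗ₜ[ℝ] leftDeriv g a := rfl

theorem dr_tmul (g : Gen n) (f : Smooth U) (a : FibreAlg n) :
    dr g (f ⊗ₜ[ℝ] a) = f ⊗ₜ[ℝ] rightDeriv g a := rfl

theorem parity_parity (F : LocalFn U) : parity (parity F) = F := by
  induction F using TensorProduct.induction_on with
  | zero => simp
  | tmul f a => rw [parity_tmul, parity_tmul, fibreParity_fibreParity]
  | add F G hF hG => simp [hF, hG]

theorem parity_dx (i : Fin n) (F : LocalFn U) : parity (dx i F) = dx i (parity F) := by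
  induction F using TensorProduct.induction_on with
  | zero => simp
  | tmul f a => rfl
  | add F G hF hG => simp [hF, hG]

theorem parity_dl {g : Gen n} (hg : g.odd = true) (F : LocalFn U) :
    parity (dl g F) = -dl g (parity F) := by
  induction F using TensorProduct.induction_on with
  | zero => simp
  | tmul f a =>
    rw [dl_tmul, parity_tmul, parity_tmul, dl_tmul, fibreParity_leftDeriv hg,
      TensorProduct.tmul_neg]
  | add F G hF hG => simp [hF, hG, add_comm]

theorem dr_eq {g : Gen n} (hg : g.odd = true) (F : LocalFn U) : dr g F = parity (dl g F) := by
  induction F using TensorProduct.induction_on with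
  | zero => simp
  | tmul f a => rw [dr_tmul, dl_tmul, parity_tmul, rightDeriv_of_odd hg]
  | add F G hF hG => simp [hF, hG]

theorem dx_mul (i : Fin n) (F G : LocalFn U) : dx i (F * G) = dx i F * G + F * dx i G := by
  induction F using TensorProduct.induction_on with
  | zero => simp
  | tmul f a =>
    induction G using TensorProduct.induction_on with
    | zero => simp
    | tmul g b =>
      simp only [Algebra.TensorProduct.tmul_mul_tmul, dx_tmul, partialX_mul,
        TensorProduct.add_tmul]
    | add F G hF hG => simp only [mul_add, map_add, hF, hG]; abel
  | add F F' hF hG => simp only [add_mul, map_add, hF, hG]; abel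

theorem dl_mul_of_odd {g : Gen n} (hg : g.odd = true) (F G : LocalFn U) :
    dl g (F * G) = dl g F * G + parity F * dl g G := by
  induction F using TensorProduct.induction_on with
  | zero => simp
  | tmul f a =>
    induction G using TensorProduct.induction_on with
    | zero => simp
    | tmul f' b =>
      simp only [Algebra.TensorProduct.tmul_mul_tmul, dl_tmul, leftDeriv_mul, parity_tmul,
        koszulSign_of_odd hg, TensorProduct.tmul_add]
    | add F G hF hG => simp only [mul_add, map_add, hF, hG]; abel
  | add F F' hF hG => simp only [add_mul, map_add, hF, hG]; abel

theorem dl_mul_of_even {g : Gen n} (hg : g.odd = false) (F G : LocalFn U) :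
    dl g (F * G) = dl g F * G + F * dl g G := by
  induction F using TensorProduct.induction_on with
  | zero => simp
  | tmul f a =>
    induction G using TensorProduct.induction_on with
    | zero => simp
    | tmul f' b =>
      simp only [Algebra.TensorProduct.tmul_mul_tmul, dl_tmul, leftDeriv_mul,
        koszulSign_of_even hg, TensorProduct.tmul_add, AlgHom.id_apply]
    | add F G hF hG => simp only [mul_add, map_add, hF, hG]; abel
  | add F F' hF hG => simp only [add_mul, map_add, hF, hG]; abel

theorem dl_theta_mul (i : Fin n) (F G : LocalFn U) :
    dl (Gen.theta i) (F * G) = dl (Gen.theta i) F * G + parity F * dl (Gen.theta i) G :=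
  dl_mul_of_odd rfl F G

theorem dl_xi_mul (i : Fin n) (F G : LocalFn U) :
    dl (Gen.xi i) (F * G) = dl (Gen.xi i) F * G + parity F * dl (Gen.xi i) G :=
  dl_mul_of_odd rfl F G

theorem dl_p_mul (i : Fin n) (F G : LocalFn U) :
    dl (Gen.p i) (F * G) = dl (Gen.p i) F * G + F * dl (Gen.p i) G :=
  dl_mul_of_even rfl F G

theorem dx_dx (i j : Fin n) (F : LocalFn U) : dx i (dx j F) = dx j (dx i F) := by
  induction F using TensorProduct.induction_on with
  | zero => simp
  | tmul f a => rw [dx_tmul, dx_tmul, dx_tmul, dx_tmul, partialX_comm]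
  | add F G hF hG => simp only [map_add, hF, hG]

theorem dl_dx (g : Gen n) (i : Fin n) (F : LocalFn U) : dl g (dx i F) = dx i (dl g F) := by
  induction F using TensorProduct.induction_on with
  | zero => simp
  | tmul f a => rfl
  | add F G hF hG => simp only [map_add, hF, hG]

theorem dl_dl (g h : Gen n) (F : LocalFn U) :
    dl g (dl h F) = koszul g h • dl h (dl g F) := by
  induction F using TensorProduct.induction_on with
  | zero => simp
  | tmul f a =>
    rw [dl_tmul, dl_tmul, dl_tmul, dl_tmul, leftDeriv_comm, TensorProduct.tmul_smul]
  | add F G hF hG => simp only [map_add, hF, hG, smul_add]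

theorem dl_theta_dl_theta (i j : Fin n) (F : LocalFn U) :
    dl (Gen.theta i) (dl (Gen.theta j) F) = -dl (Gen.theta j) (dl (Gen.theta i) F) := by
  have := dl_dl (Gen.theta i) (Gen.theta j) F
  rwa [show koszul (Gen.theta i) (Gen.theta j) = -1 by simp [koszul, Gen.odd], neg_smul,
    one_smul] at this

theorem add_parity_mul (F G : LocalFn U) : (F + parity F) * G = G * (F + parity F) := by
  induction F using TensorProduct.induction_on with
  | zero => simp
  | tmul f a =>
    induction G using TensorProduct.induction_on with
    | zero => simp
    | tmul f' b =>
      rw [parity_tmul, ← TensorProduct.tmul_add]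
      simp only [Algebra.TensorProduct.tmul_mul_tmul, add_fibreParity_mul a b, mul_comm f f']
    | add F G hF hG => rw [mul_add, hF, hG, add_mul]
  | add F F' hF hG =>
    rw [map_add, add_add_add_comm, add_mul (F + _), hF, hG, mul_add G (F + _)]

theorem sub_parity_mul (F G : LocalFn U) :
    (F - parity F) * G = parity G * (F - parity F) := by
  induction F using TensorProduct.induction_on with
  | zero => simp
  | tmul f a =>
    induction G using TensorProduct.induction_on with
    | zero => simp
    | tmul f' b =>
      rw [parity_tmul, parity_tmul, ← TensorProduct.tmul_sub]
      simp only [Algebra.TensorProduct.tmul_mul_tmul, sub_fibreParity_mul a b, mul_comm f f']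
    | add F G hF hG => rw [mul_add, hF, hG, map_add, add_mul]
  | add F F' hF hG =>
    rw [map_add, add_sub_add_comm, add_mul (F - _), hF, hG, mul_add _ (F - _)]

/-- Even functions are central. -/
theorem mul_comm_of_even {F : LocalFn U} (hF : parity F = F) (G : LocalFn U) :
    F * G = G * F := by
  have := add_parity_mul F G
  rw [hF, add_mul, mul_add] at this
  exact two_smul_cancel this

theorem mul_comm_of_odd {F : LocalFn U} (hF : parity F = -F) (G : LocalFn U) :
    F * G = parity G * F := by
  have := sub_parity_mul F G
  rw [hF, sub_neg_eq_add, add_mul, mul_add] at this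
  exact two_smul_cancel this

/-! ### The double degree -/

theorem bideg_mul {k l k' l' : ℕ} {F G : LocalFn U} (hF : F ∈ bideg U k l)
    (hG : G ∈ bideg U k' l') : F * G ∈ bideg U (k + k') (l + l') := by
  have := Submodule.mul_mem_mul hF hG
  rw [bideg, bideg, Submodule.span_mul_span] at this
  refine Submodule.span_mono ?_ this
  rintro _ ⟨_, ⟨f, a, ha, rfl⟩, _, ⟨f', b, hb, rfl⟩, rfl⟩
  exact ⟨f * f', a * b, fibreBideg_mul ha hb, by simp⟩

theorem tmul_mem_bideg {k l : ℕ} (f : Smooth U) {a : FibreAlg n} (ha : a ∈ fibreBideg n k l) :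
    f ⊗ₜ[ℝ] a ∈ bideg U k l := Submodule.subset_span ⟨f, a, ha, rfl⟩

theorem x_mem_bideg (i : Fin n) : (x i : LocalFn U) ∈ bideg U 0 0 :=
  tmul_mem_bideg _ one_mem_fibreBideg

theorem xi_mem_bideg (i : Fin n) : (xi i : LocalFn U) ∈ bideg U 0 1 :=
  tmul_mem_bideg _ (gen_mem_fibreBideg (Gen.xi i))

theorem p_mem_bideg (i : Fin n) : (p i : LocalFn U) ∈ bideg U 1 1 :=
  tmul_mem_bideg _ (gen_mem_fibreBideg (Gen.p i))

/-- Linear maps into a module may be compared on functions of given double degree by means of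
pure tensors. -/
theorem bideg_induction {k l : ℕ} {C : LocalFn U → Prop}
    (ht : ∀ f : Smooth U, ∀ a ∈ fibreBideg n k l, C (f ⊗ₜ[ℝ] a)) (h0 : C 0)
    (hadd : ∀ F G, C F → C G → C (F + G)) (hsmul : ∀ (r : ℝ) F, C F → C (r • F))
    {F : LocalFn U} (hF : F ∈ bideg U k l) : C F := by
  induction hF using Submodule.span_induction with
  | mem F h => obtain ⟨f, a, ha, rfl⟩ := h; exact ht f a ha
  | zero => exact h0
  | add F G _ _ hF hG => exact hadd F G hF hG
  | smul r F _ hF => exact hsmul r F hF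

theorem parity_of_mem {k l : ℕ} {F : LocalFn U} (hF : F ∈ bideg U k l) :
    parity F = (-1 : ℝ) ^ (k + l) • F :=
  bideg_induction (C := fun F => parity F = (-1 : ℝ) ^ (k + l) • F)
    (fun f a ha => by rw [parity_tmul, fibreParity_of_mem_fibreBideg ha, TensorProduct.tmul_smul])
    (by simp) (fun F G hF hG => by simp only [map_add, hF, hG, smul_add])
    (fun r F hF => by simp only [map_smul, hF, smul_comm r]) hF

theorem scale_of_mem {k l : ℕ} {F : LocalFn U} (hF : F ∈ bideg U k l) (s t : ℝ) :
    scale (fun g => s ^ g.bidegree.1 * t ^ g.bidegree.2) F = (s ^ k * t ^ l) • F :=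
  bideg_induction (C := fun F =>
      scale (fun g => s ^ g.bidegree.1 * t ^ g.bidegree.2) F = (s ^ k * t ^ l) • F)
    (fun f a ha => by
      change f ⊗ₜ[ℝ] rescale _ a = _
      rw [rescale_pow_of_mem_fibreBideg ha, TensorProduct.tmul_smul])
    (by simp) (fun F G hF hG => by simp only [map_add, hF, hG, smul_add])
    (fun r F hF => by simp only [map_smul, hF, smul_comm r]) hF

theorem dl_eq_zero_of_mem {g : Gen n} {k l : ℕ} {F : LocalFn U} (hF : F ∈ bideg U k l)
    (hg : ¬ g.bidegree ≤ (k, l)) : dl g F = 0 :=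
  bideg_induction (C := fun F => dl g F = 0)
    (fun f a ha => by rw [dl_tmul, leftDeriv_eq_zero_of_mem ha hg, TensorProduct.tmul_zero])
    (by simp) (fun F G hF hG => by simp only [map_add, hF, hG, add_zero])
    (fun r F hF => by simp only [map_smul, hF, smul_zero]) hF

theorem dl_p_of_mem {k : ℕ} {F : LocalFn U} (hF : F ∈ bideg U k 0) (i : Fin n) :
    dl (Gen.p i) F = 0 := dl_eq_zero_of_mem hF (by simp [Gen.bidegree, Prod.le_def])

theorem dl_xi_of_mem {k : ℕ} {F : LocalFn U} (hF : F ∈ bideg U k 0) (i : Fin n) :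
    dl (Gen.xi i) F = 0 := dl_eq_zero_of_mem hF (by simp [Gen.bidegree, Prod.le_def])

theorem dl_theta_mem {k l : ℕ} {F : LocalFn U} (hF : F ∈ bideg U (k + 1) l) (i : Fin n) :
    dl (Gen.theta i) F ∈ bideg U k l :=
  bideg_induction (C := fun F => dl (Gen.theta i) F ∈ bideg U k l)
    (fun f a ha => tmul_mem_bideg f (leftDeriv_mem_fibreBideg _ ha (by
      simp [Gen.bidegree, add_comm])))
    (by simp) (fun F G hF hG => by rw [map_add]; exact Submodule.add_mem _ hF hG)
    (fun r F hF => by rw [map_smul]; exact Submodule.smul_mem _ _ hF) hF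

theorem dx_mem {k l : ℕ} {F : LocalFn U} (hF : F ∈ bideg U k l) (i : Fin n) :
    dx i F ∈ bideg U k l :=
  bideg_induction (C := fun F => dx i F ∈ bideg U k l)
    (fun f a ha => tmul_mem_bideg _ ha)
    (by simp) (fun F G hF hG => by rw [map_add]; exact Submodule.add_mem _ hF hG)
    (fun r F hF => by rw [map_smul]; exact Submodule.smul_mem _ _ hF) hF

/-- Euler's identity for multivector fields. -/
theorem sum_theta_mul_dl {k : ℕ} {F : LocalFn U} (hF : F ∈ bideg U k 0) :
    ∑ i, theta i * dl (Gen.theta i) F = (k : ℝ) • F :=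
  bideg_induction (C := fun F => ∑ i, theta i * dl (Gen.theta i) F = (k : ℝ) • F)
    (fun f a ha => by
      simp only [dl_tmul, theta, Algebra.TensorProduct.tmul_mul_tmul, one_mul]
      rw [← TensorProduct.tmul_sum, sum_theta_mul_leftDeriv ha, TensorProduct.tmul_smul])
    (by simp)
    (fun F G hF hG => by
      simp only [map_add, mul_add, Finset.sum_add_distrib, hF, hG, smul_add])
    (fun r F hF => by simp only [map_smul, mul_smul_comm, ← Finset.smul_sum, hF, smul_comm r]) hF

/-! ### Derivatives of the coordinates -/

theorem dx_one_tmul (i : Fin n) (a : FibreAlg n) : dx i ((1 : Smooth U) ⊗ₜ[ℝ] a) = 0 := by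
  rw [dx_tmul, partialX_one, TensorProduct.zero_tmul]

theorem dx_xi (i j : Fin n) : dx i (xi j : LocalFn U) = 0 := dx_one_tmul _ _

theorem dx_theta (i j : Fin n) : dx i (theta j : LocalFn U) = 0 := dx_one_tmul _ _

theorem dx_p (i j : Fin n) : dx i (p j : LocalFn U) = 0 := dx_one_tmul _ _

theorem dx_x (i j : Fin n) : dx i (x j : LocalFn U) = if i = j then 1 else 0 := by
  rw [x, dx_tmul, partialX_coordX]
  split_ifs
  · rfl
  · exact TensorProduct.zero_tmul _ _

theorem dl_x (g : Gen n) (i : Fin n) : dl g (x i : LocalFn U) = 0 := by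
  rw [x, dl_tmul, leftDeriv_one, TensorProduct.tmul_zero]

theorem dl_one_tmul_gen (g h : Gen n) :
    dl g ((1 : Smooth U) ⊗ₜ[ℝ] gen h) = if g = h then 1 else 0 := by
  rw [dl_tmul, leftDeriv_gen]
  split_ifs
  · rfl
  · exact TensorProduct.tmul_zero _ _

theorem dl_xi (g : Gen n) (i : Fin n) :
    dl g (xi i : LocalFn U) = if g = Gen.xi i then 1 else 0 := dl_one_tmul_gen _ _

theorem dl_theta (g : Gen n) (i : Fin n) :
    dl g (theta i : LocalFn U) = if g = Gen.theta i then 1 else 0 := dl_one_tmul_gen _ _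

theorem dl_p (g : Gen n) (i : Fin n) :
    dl g (p i : LocalFn U) = if g = Gen.p i then 1 else 0 := dl_one_tmul_gen _ _

theorem parity_xi (i : Fin n) : parity (xi i : LocalFn U) = -xi i := by
  rw [xi, parity_tmul, fibreParity_gen]; simp [Gen.odd, TensorProduct.tmul_neg]

theorem parity_p (i : Fin n) : parity (p i : LocalFn U) = p i := by
  rw [p, parity_tmul, fibreParity_gen]; simp [Gen.odd]

end LocalFn

end SuperCotangent

namespace SuperCotangent

/-! ## Calculus with commuting even and anticommuting odd derivations -/

theorem sum_sum_eq_zero {ι V : Type*} [Fintype ι] [AddCommGroup V] [Module ℝ V] {f : ι → ι → V}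
    (h : ∀ i j, f i j + f j i = 0) : ∑ i, ∑ j, f i j = 0 := by
  apply two_smul_cancel
  nth_rw 2 [Finset.sum_comm]
  simp only [← Finset.sum_add_distrib, h, Finset.sum_const_zero, add_zero]

/-- A supercommutative algebra with parity involution `σ`, commuting even derivations `d i` and
anticommuting odd derivations `t i`. -/
structure IsSuperCalculus {ι R : Type*} [Ring R] [Algebra ℝ R] (σ : R →ₐ[ℝ] R)
    (d t : ι → R →ₗ[ℝ] R) : Prop where
  sig_sig : ∀ F, σ (σ F) = F
  sig_d : ∀ i F, σ (d i F) = d i (σ F)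
  sig_t : ∀ i F, σ (t i F) = -t i (σ F)
  d_mul : ∀ i F G, d i (F * G) = d i F * G + F * d i G
  t_mul : ∀ i F G, t i (F * G) = t i F * G + σ F * t i G
  d_d : ∀ i j F, d i (d j F) = d j (d i F)
  t_d : ∀ i j F, t i (d j F) = d j (t i F)
  t_t : ∀ i j F, t i (t j F) = -t j (t i F)
  even_mul : ∀ F, σ F = F → ∀ G, F * G = G * F
  odd_mul : ∀ F, σ F = -F → ∀ G, F * G = σ G * F

namespace IsSuperCalculus

variable {ι R : Type*} [Ring R] [Algebra ℝ R] {σ : R →ₐ[ℝ] R} {d t : ι → R →ₗ[ℝ] R}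

section

variable (h : IsSuperCalculus σ d t) {B : R} (hB : σ B = B)
include h hB

theorem sig_t_of_even (i : ι) : σ (t i B) = -t i B := by rw [h.sig_t, hB]

theorem sig_d_of_even (i : ι) : σ (d i B) = d i B := by rw [h.sig_d, hB]

end

variable [Fintype ι]

/-- The square of the odd derivation `ξ_i d_i + p_i t_i` vanishes. -/
theorem koszul_sq (h : IsSuperCalculus σ d t) {xi p : ι → R} (hxi : ∀ i, σ (xi i) = -xi i)
    (hp : ∀ i, σ (p i) = p i) (dxi : ∀ i j, d i (xi j) = 0) (dp : ∀ i j, d i (p j) = 0)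
    (txi : ∀ i j, t i (xi j) = 0) (tp : ∀ i j, t i (p j) = 0) (F : R) :
    ∑ i, (xi i * d i (∑ j, (xi j * d j F + p j * t j F)) +
      p i * t i (∑ j, (xi j * d j F + p j * t j F))) = 0 := by
  simp only [map_sum, map_add, h.d_mul, h.t_mul, hxi, hp, dxi, dp, txi, tp, zero_mul, zero_add,
    Finset.mul_sum, ← Finset.sum_add_distrib]
  -- Under exchange of `i` and `j`, `ξ_i ξ_j` is antisymmetric against `d_i d_j`, `p_i p_j` is
  -- symmetric against the antisymmetric `t_i t_j`, and the two mixed terms cancel since `t_i` picks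
  -- up a sign in passing `ξ_j`.
  refine sum_sum_eq_zero fun i j => ?_
  have e1 : xi j * xi i = -(xi i * xi j) := by
    rw [h.odd_mul _ (hxi j), hxi i, neg_mul]
  have e2 := h.even_mul _ (hp i) (xi j)
  have e3 := h.even_mul _ (hp j) (xi i)
  have e4 := h.even_mul _ (hp i) (p j)
  simp only [mul_add, ← mul_assoc, mul_neg, neg_mul, e1, e2, e3, e4, h.d_d j i, h.t_t j i,
    h.t_d]
  abel

/-- The derivation `-(t_i B) d_i - (d_i B) t_i`, the hamiltonian vector field of an even `B`. -/
def ham (d t : ι → R →ₗ[ℝ] R) (B F : R) : R := -∑ i, (t i B * d i F + d i B * t i F)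

/-- The odd function `(t_i B) (d_i B)`. -/
def sq (d t : ι → R →ₗ[ℝ] R) (B : R) : R := ∑ i, t i B * d i B

/-- The Schouten bracket. -/
def bracket (σ : R →ₐ[ℝ] R) (d t : ι → R →ₗ[ℝ] R) (X Y : R) : R :=
  ∑ i, (σ (t i X) * d i Y - d i X * t i Y)

theorem ham_add (B F G : R) : ham d t B (F + G) = ham d t B F + ham d t B G := by
  simp only [ham, map_add, mul_add, Finset.sum_add_distrib]; abel

theorem ham_neg (B F : R) : ham d t B (-F) = -ham d t B F := by
  simp only [ham, map_neg, mul_neg, Finset.sum_add_distrib, Finset.sum_neg_distrib]; abel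

theorem ham_sub (B F G : R) : ham d t B (F - G) = ham d t B F - ham d t B G := by
  rw [sub_eq_add_neg, ham_add, ham_neg, sub_eq_add_neg]

/-- As all `d_j` and `t_j` commute with `d_i`, the commutator differentiates only the coefficients
of `ham`. The companion `ham_t` is an anticommutator, because `ham` and `t_i` are both odd. -/
theorem ham_d (h : IsSuperCalculus σ d t) (B : R) (i : ι) (F : R) : ham d t B (d i F) - d i (ham d t B F) =
    ∑ j, (d i (t j B) * d j F + d i (d j B) * t j F) := by
  simp only [ham, map_neg, map_sum, map_add, h.d_mul, sub_neg_eq_add, neg_add_eq_sub,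
    ← Finset.sum_sub_distrib]
  refine Finset.sum_congr rfl fun j _ => ?_
  rw [h.d_d j i, h.t_d]
  abel

theorem ham_zero (B : R) : ham d t B 0 = 0 := by simp [ham]

theorem ham_sum {κ : Type*} (B : R) (s : Finset κ) (F : κ → R) :
    ham d t B (∑ k ∈ s, F k) = ∑ k ∈ s, ham d t B (F k) := by
  classical
  induction s using Finset.induction_on with
  | empty => simp [ham_zero]
  | insert a s ha ih => rw [Finset.sum_insert ha, Finset.sum_insert ha, ham_add, ih]

section

variable (h : IsSuperCalculus σ d t) {B : R} (hB : σ B = B)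
include h hB

theorem sig_sq : σ (sq d t B) = -sq d t B := by
  simp [sq, map_sum, h.sig_t, h.sig_d, hB]

theorem sig_ham (F : R) : σ (ham d t B F) = -ham d t B (σ F) := by
  simp only [ham, map_neg, map_sum, map_add, map_mul, h.sig_t, h.sig_d, hB, mul_neg, neg_mul,
    Finset.sum_add_distrib, Finset.sum_neg_distrib]
  abel

theorem ham_mul (F G : R) : ham d t B (F * G) = ham d t B F * G + σ F * ham d t B G := by
  simp only [ham, neg_mul, mul_neg, Finset.sum_mul, Finset.mul_sum, ← neg_add,
    ← Finset.sum_add_distrib]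
  congr 1
  refine Finset.sum_congr rfl fun i _ => ?_
  have e1 : σ F * (t i B * d i G) = t i B * (F * d i G) := by
    rw [← mul_assoc, ← mul_assoc, h.odd_mul _ (h.sig_t_of_even hB i)]
  have e2 : σ F * (d i B * t i G) = d i B * (σ F * t i G) := by
    rw [← mul_assoc, ← mul_assoc, h.even_mul _ (h.sig_d_of_even hB i)]
  rw [h.d_mul, h.t_mul, mul_add (σ F), e1, e2]
  simp only [mul_add, add_mul, ← mul_assoc]
  abel

theorem ham_t (i : ι) (F : R) : ham d t B (t i F) + t i (ham d t B F) =
    -∑ j, (t i (t j B) * d j F + d j (t i B) * t j F) := by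
  simp only [ham, map_neg, map_sum, map_add, h.t_mul, ← neg_add, ← Finset.sum_add_distrib]
  congr 1
  refine Finset.sum_congr rfl fun j _ => ?_
  rw [h.sig_t_of_even hB, h.sig_d_of_even hB, h.t_t i j F, h.t_d, h.t_d]
  simp only [mul_neg, neg_mul]
  abel

/-- Differentiating `t_i B * d_i B` by `t_j` and using that the derivations commute or anticommute
reproduces the terms of `ham` applied to `t_j B`. With `ham_d_self` this computes `ham` on its own
coefficients, from which its square and the value on `sq` follow. -/
theorem ham_t_self (j : ι) : ham d t B (t j B) = t j (sq d t B) := by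
  rw [ham, sq, map_sum, ← Finset.sum_neg_distrib]
  refine Finset.sum_congr rfl fun i _ => ?_
  rw [h.t_mul, h.sig_t_of_even hB, h.t_d, h.t_t i j, h.even_mul _ (h.sig_d_of_even hB i)]
  simp only [neg_mul]
  abel

theorem ham_d_self (j : ι) : ham d t B (d j B) = -d j (sq d t B) := by
  rw [ham, sq, map_sum]
  congr 1
  refine Finset.sum_congr rfl fun i _ => ?_
  rw [h.d_mul, h.t_d, h.even_mul _ (h.sig_d_of_even hB i), h.d_d i j]
  abel

/-- The Jacobi identity `[B,[B,B]] = 0`. -/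
theorem ham_sq_self : ham d t B (sq d t B) = 0 := by
  have h1 : ham d t B (sq d t B) =
      ∑ i, (t i (sq d t B) * d i B + t i B * d i (sq d t B)) := by
    conv_lhs => rw [sq]
    rw [ham_sum]
    refine Finset.sum_congr rfl fun i _ => ?_
    rw [h.ham_mul hB, h.ham_t_self hB, h.ham_d_self hB, h.sig_t_of_even hB, neg_mul_neg]
  -- The value on `sq` is now expanded by the definition of `ham` instead of the Leibniz rule. The
  -- two expansions are negatives of each other, so twice the value is zero.
  have h2 : ham d t B (sq d t B) =
      -∑ i, (t i (sq d t B) * d i B + t i B * d i (sq d t B)) := by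
    rw [ham]
    congr 1
    refine Finset.sum_congr rfl fun i _ => ?_
    rw [h.even_mul _ (h.sig_d_of_even hB i), add_comm]
  rw [← h1] at h2
  exact two_smul_cancel (by rw [add_zero]; nth_rw 1 [h2]; exact neg_add_cancel _)

/-- The square of the hamiltonian vector field `[B,·]` is `½[[B,B],·]`. -/
theorem ham_ham (F : R) : ham d t B (ham d t B F) =
    -∑ j, (t j (sq d t B) * d j F - d j (sq d t B) * t j F) := by
  -- These are the terms in which the outer `ham` hits `d_j F` and `t_j F`. They involve second
  -- derivatives of `F` and cancel, or first derivatives of `F` are never reached by `ham` on the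
  -- coefficients; only the action on the coefficients remains, given by `ham_t_self` and
  -- `ham_d_self`.
  have h0 : ∑ j, (d j B * ham d t B (t j F) - t j B * ham d t B (d j F)) = 0 := by
    simp only [ham, mul_neg, Finset.mul_sum, sub_neg_eq_add, neg_add_eq_sub,
      ← Finset.sum_sub_distrib]
    refine sum_sum_eq_zero fun i j => ?_
    have e1 : t j B * t i B = -(t i B * t j B) := by
      rw [h.odd_mul _ (h.sig_t_of_even hB j), h.sig_t_of_even hB, neg_mul]
    have e2 := h.even_mul _ (h.sig_d_of_even hB i)
    have e3 := e2 (d j B)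
    have e4 := e2 (t j B)
    have e5 := h.even_mul _ (h.sig_d_of_even hB j) (t i B)
    simp only [mul_add, ← mul_assoc, e1, e3, e4, e5, h.d_d j i, h.t_t j i, h.t_d, mul_neg,
      neg_mul]
    abel
  conv_lhs => rw [ham.eq_def d t B F]
  rw [ham_neg, ham_sum]
  congr 1
  rw [← sub_zero (∑ j, _), ← sub_zero (∑ j, (t j (sq d t B) * d j F - _))]
  nth_rw 1 [← h0]
  rw [sub_zero, ← Finset.sum_sub_distrib]
  refine Finset.sum_congr rfl fun i _ => ?_
  rw [ham_add, h.ham_mul hB, h.ham_mul hB, h.ham_t_self hB, h.ham_d_self hB,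
    h.sig_t_of_even hB, h.sig_d_of_even hB, neg_mul, neg_mul]
  abel

/-- The Jacobi identity `[B,[X,Y]] = [[B,X],Y] - (-1)^{|X|} [X,[B,Y]]`. -/
theorem ham_bracket (X Y : R) : ham d t B (bracket σ d t X Y) =
    bracket σ d t (ham d t B X) Y - bracket σ d t (σ X) (ham d t B Y) := by
  rw [← sub_eq_zero]
  -- Since `ham` is an odd derivation, its failure to be a derivation of the bracket is made up only
  -- of its commutators with `d_i` and anticommutators with `t_i`.
  have key : ham d t B (bracket σ d t X Y) - (bracket σ d t (ham d t B X) Y -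
      bracket σ d t (σ X) (ham d t B Y)) =
      ∑ i, (-σ (ham d t B (t i X) + t i (ham d t B X)) * d i Y +
        t i X * (ham d t B (d i Y) - d i (ham d t B Y)) -
        (ham d t B (d i X) - d i (ham d t B X)) * t i Y -
        σ (d i X) * (ham d t B (t i Y) + t i (ham d t B Y))) := by
    simp only [bracket, ham_sum, ← Finset.sum_sub_distrib]
    refine Finset.sum_congr rfl fun i _ => ?_
    rw [ham_sub, h.ham_mul hB, h.ham_mul hB, h.sig_sig, h.sig_t i (σ X), h.sig_sig, map_add,
      h.sig_ham hB, h.sig_d]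
    simp only [mul_add, add_mul, mul_sub, sub_mul, neg_mul, neg_add]
    abel
  rw [key]
  simp only [h.ham_d B, h.ham_t hB, map_neg, map_sum, map_add, map_mul, neg_neg,
    Finset.mul_sum, Finset.sum_mul, mul_neg, sub_neg_eq_add, ← Finset.sum_add_distrib,
    ← Finset.sum_sub_distrib]
  -- Only second derivatives of `B` are left as coefficients. They are moved to the front, and the
  -- terms cancel in pairs under exchange of `i` and `j`.
  refine sum_sum_eq_zero fun i j => ?_
  have ett : ∀ i j, σ (t i (t j B)) = t i (t j B) := fun i j => by
    rw [h.sig_t, h.sig_t, hB, map_neg, neg_neg]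
  have edt : ∀ i j, σ (d i (t j B)) = -d i (t j B) := fun i j => by
    rw [h.sig_d, h.sig_t, hB, map_neg]
  have edd : ∀ i j, σ (d i (d j B)) = d i (d j B) := fun i j => by
    rw [h.sig_d, h.sig_d, hB]
  have c1 : ∀ i j G, G * t i (t j B) = t i (t j B) * G := fun i j G =>
    (h.even_mul _ (ett i j) G).symm
  have c2 : ∀ i j G, σ G * d i (t j B) = d i (t j B) * G := fun i j G =>
    (h.odd_mul _ (edt i j) G).symm
  have c3 : ∀ i j G, G * d i (d j B) = d i (d j B) * G := fun i j G =>
    (h.even_mul _ (edd i j) G).symm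
  have c2' : ∀ i j G, G * d i (t j B) = d i (t j B) * σ G := fun i j G => by
    rw [← c2, h.sig_sig]
  simp only [ett, edt, mul_add, add_mul, ← mul_assoc, c1, c2', c3, h.sig_sig, neg_mul, mul_neg,
    map_neg, h.t_t j i, h.d_d j i B]
  abel

end

end IsSuperCalculus

end SuperCotangent

namespace SuperCotangent

/-! ## The canonical Poisson bracket -/

/-- An algebra of functions with even coordinates `x`, `p` and odd coordinates `ξ`, `θ`, the
derivatives by these coordinates, and a double grading: the structure of the functions on `T*ΠTU`
on which the calculus of the canonical Poisson bracket depends. -/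
structure DarbouxAlgebra (n : ℕ) (R : Type*) [Ring R] [Algebra ℝ R] where
  parity : R →ₐ[ℝ] R
  dx : Fin n → R →ₗ[ℝ] R
  dl : Gen n → R →ₗ[ℝ] R
  x : Fin n → R
  xi : Fin n → R
  theta : Fin n → R
  p : Fin n → R
  bideg : ℕ → ℕ → Submodule ℝ R
  scale : ℝ → R →ₗ[ℝ] R
  isSuperCalculus : IsSuperCalculus parity dx fun i => dl (Gen.theta i)
  parity_dl : ∀ {g : Gen n}, g.odd = true → ∀ F, parity (dl g F) = -dl g (parity F)
  parity_dl_p : ∀ i F, parity (dl (Gen.p i) F) = dl (Gen.p i) (parity F)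
  dl_xi_mul : ∀ i F G,
    dl (Gen.xi i) (F * G) = dl (Gen.xi i) F * G + parity F * dl (Gen.xi i) G
  dl_p_mul : ∀ i F G, dl (Gen.p i) (F * G) = dl (Gen.p i) F * G + F * dl (Gen.p i) G
  dl_one : ∀ g, dl g 1 = 0
  dl_dx : ∀ g i F, dl g (dx i F) = dx i (dl g F)
  dl_dl : ∀ g h F, dl g (dl h F) = koszul g h • dl h (dl g F)
  dx_x : ∀ i j, dx i (x j) = if i = j then 1 else 0
  dx_xi : ∀ i j, dx i (xi j) = 0
  dx_theta : ∀ i j, dx i (theta j) = 0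
  dx_p : ∀ i j, dx i (p j) = 0
  dl_x : ∀ g i, dl g (x i) = 0
  dl_xi : ∀ g i, dl g (xi i) = if g = Gen.xi i then 1 else 0
  dl_theta : ∀ g i, dl g (theta i) = if g = Gen.theta i then 1 else 0
  dl_p : ∀ g i, dl g (p i) = if g = Gen.p i then 1 else 0
  parity_xi : ∀ i, parity (xi i) = -xi i
  parity_p : ∀ i, parity (p i) = p i
  bideg_mul : ∀ {k l k' l' F G}, F ∈ bideg k l → G ∈ bideg k' l' →
    F * G ∈ bideg (k + k') (l + l')
  x_mem_bideg : ∀ i, x i ∈ bideg 0 0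
  xi_mem_bideg : ∀ i, xi i ∈ bideg 0 1
  p_mem_bideg : ∀ i, p i ∈ bideg 1 1
  parity_of_mem : ∀ {k l F}, F ∈ bideg k l → parity F = (-1 : ℝ) ^ (k + l) • F
  scale_of_mem : ∀ {s k l F}, F ∈ bideg k l → scale s F = s ^ k • F
  dl_p_of_mem : ∀ {k F}, F ∈ bideg k 0 → ∀ i, dl (Gen.p i) F = 0
  dl_xi_of_mem : ∀ {k F}, F ∈ bideg k 0 → ∀ i, dl (Gen.xi i) F = 0
  dl_theta_mem : ∀ {k l F}, F ∈ bideg (k + 1) l → ∀ i, dl (Gen.theta i) F ∈ bideg k l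
  dx_mem : ∀ {k l F}, F ∈ bideg k l → ∀ i, dx i F ∈ bideg k l
  sum_theta_mul_dl : ∀ {k F}, F ∈ bideg k 0 → ∑ i, theta i * dl (Gen.theta i) F = (k : ℝ) • F

namespace DarbouxAlgebra

variable {n : ℕ} {R : Type*} [Ring R] [Algebra ℝ R] (A : DarbouxAlgebra n R)

/-- The left derivatives by `θ_i`. -/
abbrev dtheta (i : Fin n) : R →ₗ[ℝ] R := A.dl (Gen.theta i)

/-- The canonical even Poisson bracket. -/
def poisson (F G : R) : R :=
  ∑ i, (A.dl (Gen.p i) F * A.dx i G - A.dx i F * A.dl (Gen.p i) G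
    + A.parity (A.dl (Gen.xi i) F) * A.dtheta i G + A.parity (A.dtheta i F) * A.dl (Gen.xi i) G)

/-- The de Rham vector field. -/
def deRham (F : R) : R := ∑ i, A.xi i * A.dx i F

/-- The Schouten bracket. -/
def schouten (P Q : R) : R :=
  ∑ i, (A.parity (A.dtheta i P) * A.dx i Q - A.dx i P * A.dtheta i Q)

/-- The linear hamiltonian of a vector field in the coordinates `x` and `ξ`. -/
def ham (v : R → R) : R := ∑ i, (v (A.x i) * A.p i + v (A.xi i) * A.theta i)

/-- The linear hamiltonian of a vector field in the coordinates `x` and `θ`. -/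
def hamDual (v : R → R) : R := ∑ i, (v (A.x i) * A.p i + v (A.theta i) * A.xi i)

/-- The derived bracket. -/
def derived (Θ X Y : R) : R := A.poisson (A.poisson X Θ) Y

theorem poisson_eq (F G : R) : A.poisson F G =
    ∑ i, (A.dl (Gen.p i) F * A.dx i G - A.dx i F * A.dl (Gen.p i) G
      + A.parity (A.dl (Gen.xi i) F) * A.dtheta i G
      + A.parity (A.dtheta i F) * A.dl (Gen.xi i) G) := rfl

theorem schouten_eq (P Q : R) :
    A.schouten P Q = IsSuperCalculus.bracket A.parity A.dx A.dtheta P Q := rfl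

theorem parity_parity (F : R) : A.parity (A.parity F) = F := A.isSuperCalculus.sig_sig F

theorem parity_dx (i : Fin n) (F : R) : A.parity (A.dx i F) = A.dx i (A.parity F) :=
  A.isSuperCalculus.sig_d i F

theorem dx_mul (i : Fin n) (F G : R) : A.dx i (F * G) = A.dx i F * G + F * A.dx i G :=
  A.isSuperCalculus.d_mul i F G

theorem dl_theta_mul (i : Fin n) (F G : R) :
    A.dtheta i (F * G) = A.dtheta i F * G + A.parity F * A.dtheta i G :=
  A.isSuperCalculus.t_mul i F G

theorem mul_comm_of_even {F : R} (hF : A.parity F = F) (G : R) : F * G = G * F :=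
  A.isSuperCalculus.even_mul F hF G

theorem mul_anticomm {F G : R} (hF : A.parity F = -F) (hG : A.parity G = -G) :
    F * G = -(G * F) := by
  rw [A.isSuperCalculus.odd_mul F hF, hG, neg_mul]

theorem poisson_add_left (F F' G : R) :
    A.poisson (F + F') G = A.poisson F G + A.poisson F' G := by
  rw [poisson, poisson, poisson, ← Finset.sum_add_distrib]
  refine Finset.sum_congr rfl fun i _ => ?_
  simp only [map_add, add_mul]
  abel

theorem poisson_add_right (F G G' : R) :
    A.poisson F (G + G') = A.poisson F G + A.poisson F G' := by
  rw [poisson, poisson, poisson, ← Finset.sum_add_distrib]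
  refine Finset.sum_congr rfl fun i _ => ?_
  simp only [map_add, mul_add]
  abel

theorem poisson_zero_left (G : R) : A.poisson 0 G = 0 := by
  simp [poisson]

theorem poisson_zero_right (F : R) : A.poisson F 0 = 0 := by
  simp [poisson]

/-- The Poisson bracket of odd functions is symmetric. -/
theorem poisson_comm_of_odd {F G : R} (hF : A.parity F = -F) (hG : A.parity G = -G) :
    A.poisson F G = A.poisson G F := by
  rw [A.poisson_eq, A.poisson_eq]
  refine Finset.sum_congr rfl fun i _ => ?_
  have hp : ∀ {H : R}, A.parity H = -H → A.parity (A.dl (Gen.p i) H) = -A.dl (Gen.p i) H := by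
    intro H h
    rw [A.parity_dl_p, h, map_neg]
  have hx : ∀ {H : R}, A.parity H = -H → A.parity (A.dx i H) = -A.dx i H := by
    intro H h
    rw [A.parity_dx, h, map_neg]
  have hd : ∀ {g : Gen n}, g.odd = true → ∀ {H : R}, A.parity H = -H →
      A.parity (A.dl g H) = A.dl g H := by
    intro g hg H h
    rw [A.parity_dl hg, h, map_neg, neg_neg]
  rw [hd rfl hF, hd rfl hF, hd rfl hG, hd rfl hG, A.mul_anticomm (hp hF) (hx hG),
    A.mul_anticomm (hx hF) (hp hG), A.mul_comm_of_even (hd (g := Gen.xi i) rfl hF),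
    A.mul_comm_of_even (hd (g := Gen.theta i) rfl hF)]
  abel

/-! ### The hamiltonian of the de Rham vector field -/

theorem ham_deRham : A.ham A.deRham = ∑ i : Fin n, (A.xi i * A.p i : R) := by
  have h1 : ∀ i, A.deRham (A.x i : R) = A.xi i := fun i => by
    simp [deRham, A.dx_x]
  have h2 : ∀ i, A.deRham (A.xi i : R) = 0 := fun i => by
    simp [deRham, A.dx_xi]
  simp [ham, h1, h2]

theorem ham_deRham_mem : A.ham A.deRham ∈ A.bideg 1 2 := by
  rw [A.ham_deRham]
  exact Submodule.sum_mem _ fun i _ => A.bideg_mul (A.xi_mem_bideg i) (A.p_mem_bideg i)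

theorem dx_ham_deRham (j : Fin n) : A.dx j (A.ham A.deRham : R) = 0 := by
  simp [A.ham_deRham, A.dx_mul, A.dx_xi, A.dx_p]

theorem dl_p_ham_deRham (j : Fin n) : A.dl (Gen.p j) (A.ham A.deRham : R) = A.xi j := by
  simp [A.ham_deRham, A.dl_p_mul, A.dl_xi, A.dl_p]

theorem dl_xi_ham_deRham (j : Fin n) : A.dl (Gen.xi j) (A.ham A.deRham : R) = A.p j := by
  simp [A.ham_deRham, A.dl_xi_mul, A.dl_xi, A.dl_p]

theorem dtheta_ham_deRham (j : Fin n) : A.dtheta j (A.ham A.deRham : R) = 0 := by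
  simp [A.ham_deRham, A.dl_theta_mul, A.dl_xi, A.dl_p]

theorem poisson_ham_deRham (F : R) :
    A.poisson (A.ham A.deRham) F = ∑ i, (A.xi i * A.dx i F + A.p i * A.dtheta i F) := by
  simp [A.poisson_eq, A.dx_ham_deRham, A.dl_p_ham_deRham, A.dl_xi_ham_deRham, A.dtheta_ham_deRham, A.parity_p]

theorem poisson_ham_deRham_self : A.poisson (A.ham A.deRham) (A.ham A.deRham : R) = 0 := by
  simp [A.poisson_ham_deRham, A.dx_ham_deRham, A.dtheta_ham_deRham]

/-- The explicit form `ξ_i d_i + p_i t_i` makes this an instance of `koszul_sq`, valid on every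
function and not only on forms. -/
theorem poisson_ham_deRham_sq (F : R) :
    A.poisson (A.ham A.deRham) (A.poisson (A.ham A.deRham) F) = 0 := by
  rw [A.poisson_ham_deRham, A.poisson_ham_deRham]
  exact A.isSuperCalculus.koszul_sq A.parity_xi A.parity_p A.dx_xi A.dx_p
    (fun i j => by simp [A.dl_xi]) (fun i j => by simp [A.dl_p]) F

/-! ### Multivector fields -/

/-- The functions of `x` and `θ` only. -/
noncomputable def multivectors : Subalgebra ℝ R where
  carrier := {P | ∀ i, A.dl (Gen.p i) P = 0 ∧ A.dl (Gen.xi i) P = 0}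
  mul_mem' := fun hP hQ i => by
    rw [A.dl_p_mul, A.dl_xi_mul, (hP i).1, (hP i).2, (hQ i).1, (hQ i).2]; simp
  add_mem' := fun hP hQ i => by
    rw [map_add, map_add, (hP i).1, (hP i).2, (hQ i).1, (hQ i).2]; simp
  algebraMap_mem' := fun r i => by
    have h : ∀ g : Gen n, A.dl g (algebraMap ℝ R r) = 0 := fun g => by
      rw [Algebra.algebraMap_eq_smul_one, map_smul, A.dl_one, smul_zero]
    exact ⟨h _, h _⟩

theorem mem_multivectors {k : ℕ} {P : R} (hP : P ∈ A.bideg k 0) :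
    P ∈ A.multivectors := fun i => ⟨A.dl_p_of_mem hP i, A.dl_xi_of_mem hP i⟩

theorem parity_mem_multivectors {P : R} (hP : P ∈ A.multivectors) :
    A.parity P ∈ A.multivectors := fun i => by
  rw [← A.parity_dl_p, (hP i).1, ← neg_eq_zero (a := A.dl (Gen.xi i) _), ← A.parity_dl rfl, (hP i).2]
  simp

theorem dx_mem_multivectors {P : R} (hP : P ∈ A.multivectors) (j : Fin n) :
    A.dx j P ∈ A.multivectors := fun i => by
  rw [A.dl_dx, A.dl_dx, (hP i).1, (hP i).2]; simp

theorem dtheta_mem_multivectors {P : R} (hP : P ∈ A.multivectors) (j : Fin n) :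
    A.dtheta j P ∈ A.multivectors := fun i => by
  rw [A.dl_dl, A.dl_dl (Gen.xi i), (hP i).1, (hP i).2]; simp

theorem poisson_ham_deRham_right {P : R} (hP : P ∈ A.multivectors) :
    A.poisson P (A.ham A.deRham) = ∑ i, (A.parity (A.dtheta i P) * A.p i - A.dx i P * A.xi i) := by
  rw [A.poisson_eq]
  refine Finset.sum_congr rfl fun i _ => ?_
  rw [(hP i).1, (hP i).2, A.dl_p_ham_deRham, A.dl_xi_ham_deRham, map_zero]
  simp only [zero_mul]
  abel

theorem dl_p_poisson_ham_deRham {P : R} (hP : P ∈ A.multivectors) (j : Fin n) :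
    A.dl (Gen.p j) (A.poisson P (A.ham A.deRham)) = A.parity (A.dtheta j P) := by
  have h1 : ∀ i, A.dl (Gen.p j) (A.parity (A.dtheta i P)) = 0 := fun i =>
    (A.parity_mem_multivectors (A.dtheta_mem_multivectors hP i) j).1
  have h2 : ∀ i, A.dl (Gen.p j) (A.dx i P) = 0 := fun i => (A.dx_mem_multivectors hP i j).1
  simp [A.poisson_ham_deRham_right hP, A.dl_p_mul, h1, h2, A.dl_p, A.dl_xi]

theorem dl_xi_poisson_ham_deRham {P : R} (hP : P ∈ A.multivectors) (j : Fin n) :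
    A.dl (Gen.xi j) (A.poisson P (A.ham A.deRham)) = -A.parity (A.dx j P) := by
  have h1 : ∀ i, A.dl (Gen.xi j) (A.parity (A.dtheta i P)) = 0 := fun i =>
    (A.parity_mem_multivectors (A.dtheta_mem_multivectors hP i) j).2
  have h2 : ∀ i, A.dl (Gen.xi j) (A.dx i P) = 0 := fun i => (A.dx_mem_multivectors hP i j).2
  simp [A.poisson_ham_deRham_right hP, A.dl_xi_mul, h1, h2, A.dl_p, A.dl_xi]

/-- The derived bracket of `h_d` is the Schouten bracket. -/
theorem poisson_poisson_ham_deRham {P Q : R} (hP : P ∈ A.multivectors)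
    (hQ : Q ∈ A.multivectors) : A.poisson (A.poisson P (A.ham A.deRham)) Q = A.schouten P Q := by
  rw [A.schouten_eq, A.poisson_eq, IsSuperCalculus.bracket]
  refine Finset.sum_congr rfl fun i _ => ?_
  rw [A.dl_p_poisson_ham_deRham hP, A.dl_xi_poisson_ham_deRham hP, (hQ i).1, (hQ i).2, map_neg,
    A.parity_parity]
  simp only [mul_zero, neg_mul]
  abel

/-- `{P, h_d}` is linear in `p` and `ξ`, and its coefficients are the values of `[P,·]` on `x_i` and
`θ_i`. This identifies the first-order term of the twist with a linear hamiltonian. -/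
theorem hamDual_schouten {P : R} (hP : P ∈ A.multivectors) :
    A.hamDual (A.schouten P) = A.poisson P (A.ham A.deRham) := by
  have h1 : ∀ i, A.schouten P (A.x i) = A.parity (A.dtheta i P) := fun i => by
    simp [A.schouten_eq, IsSuperCalculus.bracket, A.dx_x, A.dl_x]
  have h2 : ∀ i, A.schouten P (A.theta i) = -A.dx i P := fun i => by
    simp [A.schouten_eq, IsSuperCalculus.bracket, A.dx_theta, A.dl_theta]
  rw [hamDual, A.poisson_ham_deRham_right hP]
  refine Finset.sum_congr rfl fun i _ => ?_
  rw [h1, h2, neg_mul, sub_eq_add_neg]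

/-! ### Bivector fields -/

section Bivector

variable {B : R} (hB : B ∈ A.bideg 2 0)
include hB

theorem parity_of_bivector : A.parity B = B := by
  rw [A.parity_of_mem hB]; norm_num

theorem sq_mem : IsSuperCalculus.sq A.dx A.dtheta B ∈ A.bideg 3 0 :=
  Submodule.sum_mem _ fun i _ => A.bideg_mul (A.dl_theta_mem (k := 1) hB i) (A.dx_mem hB i)

theorem parity_sq : A.parity (IsSuperCalculus.sq A.dx A.dtheta B) = -IsSuperCalculus.sq A.dx A.dtheta B :=
  A.isSuperCalculus.sig_sq (A.parity_of_bivector hB)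

/-- For even `B` the derivative by `θ_i` is odd, and the resulting sign turns the difference in the
bracket into the sum in `ham`. -/
theorem schouten_eq_ham (Q : R) :
    A.schouten B Q = IsSuperCalculus.ham A.dx A.dtheta B Q := by
  rw [A.schouten_eq, IsSuperCalculus.bracket, IsSuperCalculus.ham, ← Finset.sum_neg_distrib]
  refine Finset.sum_congr rfl fun i _ => ?_
  rw [A.isSuperCalculus.sig_t_of_even (A.parity_of_bivector hB), neg_mul]
  abel

theorem schouten_self : A.schouten B B = -((2 : ℝ) • IsSuperCalculus.sq A.dx A.dtheta B) := by
  rw [A.schouten_eq_ham hB, IsSuperCalculus.ham, IsSuperCalculus.sq, Finset.smul_sum]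
  congr 1
  refine Finset.sum_congr rfl fun i _ => ?_
  rw [A.mul_comm_of_even (A.isSuperCalculus.sig_d_of_even (A.parity_of_bivector hB) i), two_smul]

/-- The two sums in `[B,B]` coincide because `d_i B` is even and hence central; this fixes both the
factor and the sign of `ψ_π`. -/
theorem neg_half_schouten_self :
    -((1 / 2 : ℝ) • A.schouten B B) = IsSuperCalculus.sq A.dx A.dtheta B := by
  rw [A.schouten_self hB, smul_neg, neg_neg, smul_smul]
  norm_num

theorem hamDual_schouten_eq : A.hamDual (A.schouten B) =
    -∑ i, (A.dx i B * A.xi i + A.dtheta i B * A.p i) := by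
  rw [A.hamDual_schouten (A.mem_multivectors hB), A.poisson_ham_deRham_right (A.mem_multivectors hB),
    ← Finset.sum_neg_distrib]
  refine Finset.sum_congr rfl fun i _ => ?_
  rw [A.isSuperCalculus.sig_t_of_even (A.parity_of_bivector hB), neg_mul]
  abel

theorem hamDual_schouten_mem : A.hamDual (A.schouten B) ∈ A.bideg 2 1 := by
  rw [A.hamDual_schouten_eq hB]
  exact Submodule.neg_mem _ (Submodule.sum_mem _ fun i _ => Submodule.add_mem _
    (A.bideg_mul (A.dx_mem hB i) (A.xi_mem_bideg i))
    (A.bideg_mul (A.dl_theta_mem (k := 1) hB i) (A.p_mem_bideg i)))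

theorem parity_hamDual_schouten : A.parity (A.hamDual (A.schouten B)) = -A.hamDual (A.schouten B) := by
  rw [A.parity_of_mem (A.hamDual_schouten_mem hB)]; norm_num

theorem dl_p_hamDual_schouten (j : Fin n) :
    A.dl (Gen.p j) (A.hamDual (A.schouten B)) = -A.dtheta j B := by
  rw [A.hamDual_schouten (A.mem_multivectors hB), A.dl_p_poisson_ham_deRham (A.mem_multivectors hB),
    A.isSuperCalculus.sig_t_of_even (A.parity_of_bivector hB)]

theorem dl_xi_hamDual_schouten (j : Fin n) :
    A.dl (Gen.xi j) (A.hamDual (A.schouten B)) = -A.dx j B := by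
  rw [A.hamDual_schouten (A.mem_multivectors hB), A.dl_xi_poisson_ham_deRham (A.mem_multivectors hB),
    A.isSuperCalculus.sig_d_of_even (A.parity_of_bivector hB)]

theorem poisson_hamDual_schouten {Q : R} (hQ : Q ∈ A.multivectors) :
    A.poisson (A.hamDual (A.schouten B)) Q = IsSuperCalculus.ham A.dx A.dtheta B Q := by
  rw [A.hamDual_schouten (A.mem_multivectors hB), A.poisson_poisson_ham_deRham (A.mem_multivectors hB) hQ,
    A.schouten_eq_ham hB]

theorem ham_mem_multivectors {Q : R} (hQ : Q ∈ A.multivectors) :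
    IsSuperCalculus.ham A.dx A.dtheta B Q ∈ A.multivectors :=
  Subalgebra.neg_mem _ (Subalgebra.sum_mem _ fun i _ => Subalgebra.add_mem _
    (Subalgebra.mul_mem _ (A.dtheta_mem_multivectors (A.mem_multivectors hB) i)
      (A.dx_mem_multivectors hQ i))
    (Subalgebra.mul_mem _ (A.dx_mem_multivectors (A.mem_multivectors hB) i)
      (A.dtheta_mem_multivectors hQ i)))

/-- The twist of `h_d` to first order. -/
theorem poisson_bivector_hamDual_schouten : A.poisson B (A.hamDual (A.schouten B)) =
    (2 : ℝ) • IsSuperCalculus.sq A.dx A.dtheta B := by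
  rw [A.poisson_eq, IsSuperCalculus.sq, Finset.smul_sum]
  refine Finset.sum_congr rfl fun i _ => ?_
  rw [A.dl_p_of_mem hB, A.dl_xi_of_mem hB, A.dl_p_hamDual_schouten hB, A.dl_xi_hamDual_schouten hB,
    A.isSuperCalculus.sig_t_of_even (A.parity_of_bivector hB), map_zero,
    mul_neg, A.mul_comm_of_even (A.isSuperCalculus.sig_d_of_even (A.parity_of_bivector hB) i), two_smul,
    neg_mul_neg]
  simp only [zero_mul]
  abel

/-- Each term of the Poisson bracket contains a derivative by `p` or `ξ`. This is what ends the
exponential series. -/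
theorem poisson_bivector_multivector {Q : R} (hQ : Q ∈ A.multivectors) :
    A.poisson B Q = 0 := by
  rw [A.poisson_eq]
  refine Finset.sum_eq_zero fun i _ => ?_
  rw [A.dl_p_of_mem hB, A.dl_xi_of_mem hB, (hQ i).1, (hQ i).2]
  simp

/-- By the explicit formulas `h_{[B,·]} = -{h_d, B}`, and `{h_d,·}` has square zero. -/
theorem poisson_ham_deRham_hamDual : A.poisson (A.ham A.deRham) (A.hamDual (A.schouten B)) = 0 := by
  have : A.hamDual (A.schouten B) = -A.poisson (A.ham A.deRham) B := by
    rw [A.hamDual_schouten_eq hB, A.poisson_ham_deRham]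
    congr 1
    refine Finset.sum_congr rfl fun i _ => ?_
    rw [A.mul_comm_of_even (A.isSuperCalculus.sig_d_of_even (A.parity_of_bivector hB) i),
      A.mul_comm_of_even (A.parity_p i)]
  have hz : A.poisson (A.ham A.deRham) (A.hamDual (A.schouten B) + A.poisson (A.ham A.deRham) B) = 0 := by
    rw [this, neg_add_cancel, A.poisson_zero_right]
  rwa [A.poisson_add_right, A.poisson_ham_deRham_sq, add_zero] at hz

theorem poisson_hamDual_self : A.poisson (A.hamDual (A.schouten B)) (A.hamDual (A.schouten B)) =
    -((2 : ℝ) • A.poisson (A.ham A.deRham) (IsSuperCalculus.sq A.dx A.dtheta B)) := by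
  have hb := A.parity_of_bivector hB
  -- The derivatives of `h_{[B,·]}` by `p_j` and `ξ_j` are the coefficients of `ham`. The bracket of
  -- this odd function with itself counts every term twice.
  have h1 : A.poisson (A.hamDual (A.schouten B)) (A.hamDual (A.schouten B)) =
      (2 : ℝ) • IsSuperCalculus.ham A.dx A.dtheta B (A.hamDual (A.schouten B)) := by
    rw [A.poisson_eq, IsSuperCalculus.ham, smul_neg, Finset.smul_sum, ← Finset.sum_neg_distrib]
    refine Finset.sum_congr rfl fun i _ => ?_
    have e1 : A.dx i (A.hamDual (A.schouten B)) * A.dtheta i B =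
        -(A.dtheta i B * A.dx i (A.hamDual (A.schouten B))) :=
      A.mul_anticomm (by rw [A.parity_dx, A.parity_hamDual_schouten hB, map_neg])
        (A.isSuperCalculus.sig_t_of_even hb i)
    have e2 : A.parity (A.dtheta i (A.hamDual (A.schouten B))) = A.dtheta i (A.hamDual (A.schouten B)) := by
      rw [A.parity_dl rfl, A.parity_hamDual_schouten hB, map_neg, neg_neg]
    rw [A.dl_p_hamDual_schouten hB, A.dl_xi_hamDual_schouten hB, map_neg, e2,
      A.isSuperCalculus.sig_d_of_even hb, mul_neg, mul_neg, neg_mul, neg_mul, e1,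
      A.mul_comm_of_even e2, two_smul]
    abel
  -- `ham` kills `ξ_i` and `p_i`, so it acts only on the coefficients `d_i B` and `t_i B`; their
  -- images are derivatives of `sq`, which assemble to `{h_d, sq}`.
  have h2 : IsSuperCalculus.ham A.dx A.dtheta B (A.hamDual (A.schouten B)) =
      -A.poisson (A.ham A.deRham) (IsSuperCalculus.sq A.dx A.dtheta B) := by
    rw [A.hamDual_schouten_eq hB, IsSuperCalculus.ham_neg, IsSuperCalculus.ham_sum,
      A.poisson_ham_deRham]
    congr 1
    refine Finset.sum_congr rfl fun i _ => ?_
    have e1 : IsSuperCalculus.ham A.dx A.dtheta B (A.xi i) = 0 := by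
      simp [IsSuperCalculus.ham, A.dx_xi, A.dl_xi]
    have e2 : IsSuperCalculus.ham A.dx A.dtheta B (A.p i) = 0 := by
      simp [IsSuperCalculus.ham, A.dx_p, A.dl_p]
    rw [IsSuperCalculus.ham_add, A.isSuperCalculus.ham_mul hb, A.isSuperCalculus.ham_mul hb, e1, e2,
      A.isSuperCalculus.ham_t_self hb, A.isSuperCalculus.ham_d_self hb, mul_zero, mul_zero, add_zero,
      add_zero, A.mul_comm_of_even (A.parity_p i), neg_mul,
      A.mul_anticomm (A.parity_xi i) (by rw [A.parity_dx, A.parity_sq hB, map_neg])]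
  rw [h1, h2, smul_neg]

theorem poisson_hamDual_sq :
    A.poisson (A.hamDual (A.schouten B)) (IsSuperCalculus.sq A.dx A.dtheta B) = 0 := by
  rw [A.poisson_hamDual_schouten hB (A.mem_multivectors (A.sq_mem hB)),
    A.isSuperCalculus.ham_sq_self (A.parity_of_bivector hB)]

theorem poisson_sq_sq : A.poisson (IsSuperCalculus.sq A.dx A.dtheta B)
    (IsSuperCalculus.sq A.dx A.dtheta B) = 0 := by
  rw [A.poisson_eq]
  refine Finset.sum_eq_zero fun i _ => ?_
  rw [A.dl_p_of_mem (A.sq_mem hB), A.dl_xi_of_mem (A.sq_mem hB)]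
  simp

/-- The twist of `h_d` satisfies the structure equation. -/
theorem poisson_twist_self :
    A.poisson (A.ham A.deRham + A.hamDual (A.schouten B) + IsSuperCalculus.sq A.dx A.dtheta B)
      (A.ham A.deRham + A.hamDual (A.schouten B) + IsSuperCalculus.sq A.dx A.dtheta B) = 0 := by
  have hh : A.parity (A.ham A.deRham : R) = -A.ham A.deRham := by
    rw [A.parity_of_mem A.ham_deRham_mem]; norm_num
  -- Of the nine brackets, `{γ,γ}` and the two equal brackets of `h_d` with `sq` cancel; the others
  -- vanish. The symmetry of the bracket on odd functions brings all of them to the computed order.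
  simp only [A.poisson_add_left, A.poisson_add_right, A.poisson_ham_deRham_self,
    A.poisson_ham_deRham_hamDual hB, A.poisson_hamDual_sq hB, A.poisson_sq_sq hB,
    A.poisson_hamDual_self hB, A.poisson_comm_of_odd (A.parity_hamDual_schouten hB) hh,
    A.poisson_comm_of_odd (A.parity_sq hB) hh,
    A.poisson_comm_of_odd (A.parity_sq hB) (A.parity_hamDual_schouten hB), two_smul]
  abel

/-- Euler's identity in degree `(3,0)` reads `3 sq = 0` when all derivatives by `θ` vanish. -/
theorem sq_eq_zero_of_dtheta (h : ∀ j, A.dtheta j (IsSuperCalculus.sq A.dx A.dtheta B) = 0) :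
    IsSuperCalculus.sq A.dx A.dtheta B = 0 := by
  have := A.sum_theta_mul_dl (A.sq_mem hB)
  rw [Finset.sum_eq_zero fun i _ => by rw [h i, mul_zero]] at this
  exact (smul_eq_zero.1 this.symm).resolve_left (by norm_num)

/-- The hypothesis says that `ξ_i d_i sq + p_i t_i sq` vanishes. As `sq` is free of `p`,
differentiation by `p_j` extracts `t_j sq`. -/
theorem sq_eq_zero_of_poisson_hamDual
    (h : A.poisson (A.hamDual (A.schouten B)) (A.hamDual (A.schouten B)) = 0) :
    IsSuperCalculus.sq A.dx A.dtheta B = 0 := by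
  rw [A.poisson_hamDual_self hB, neg_eq_zero, smul_eq_zero, or_iff_right two_ne_zero,
    A.poisson_ham_deRham] at h
  refine A.sq_eq_zero_of_dtheta hB fun j => ?_
  have hm := A.mem_multivectors (A.sq_mem hB)
  have h1 : ∀ i, A.dl (Gen.p j) (A.dx i (IsSuperCalculus.sq A.dx A.dtheta B)) = 0 := fun i =>
    (A.dx_mem_multivectors hm i j).1
  have h2 : ∀ i, A.dl (Gen.p j) (A.dtheta i (IsSuperCalculus.sq A.dx A.dtheta B)) = 0 := fun i =>
    (A.dtheta_mem_multivectors hm i j).1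
  have := congrArg (A.dl (Gen.p j)) h
  simpa [A.dl_p_mul, h1, h2, A.dl_xi, A.dl_p] using this

/-- By `ham_ham`, the square of `[B,·]` sends `x^j` to `-t_j sq`, so the coordinate functions
already detect `sq`. -/
theorem sq_eq_zero_of_poisson_poisson_x (h : ∀ j : Fin n,
    A.poisson (A.hamDual (A.schouten B)) (A.poisson (A.hamDual (A.schouten B)) (A.x j)) = 0) :
    IsSuperCalculus.sq A.dx A.dtheta B = 0 := by
  refine A.sq_eq_zero_of_dtheta hB fun j => ?_
  have hx : (A.x j : R) ∈ A.multivectors := A.mem_multivectors (A.x_mem_bideg j)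
  have := h j
  rw [A.poisson_hamDual_schouten hB hx,
    A.poisson_hamDual_schouten hB (A.ham_mem_multivectors hB hx),
    A.isSuperCalculus.ham_ham (A.parity_of_bivector hB)] at this
  simpa [A.dx_x, A.dl_x] using this

theorem poisson_hamDual_poisson_hamDual (h : IsSuperCalculus.sq A.dx A.dtheta B = 0)
    {Q : R} (hQ : Q ∈ A.multivectors) :
    A.poisson (A.hamDual (A.schouten B)) (A.poisson (A.hamDual (A.schouten B)) Q) = 0 := by
  rw [A.poisson_hamDual_schouten hB hQ,
    A.poisson_hamDual_schouten hB (A.ham_mem_multivectors hB hQ),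
    A.isSuperCalculus.ham_ham (A.parity_of_bivector hB), h]
  simp

/-- On multivectors `h_{[B,·]}` acts as `[B,·]`, so this is the Jacobi identity `ham_bracket` and
imposes nothing on `[B,B]`. The sign comes from `parity X = (-1)^k X`. -/
theorem poisson_hamDual_derived {k : ℕ} {X Y : R} (hX : X ∈ A.bideg k 0)
    (hY : Y ∈ A.multivectors) :
    A.poisson (A.hamDual (A.schouten B)) (A.derived (A.ham A.deRham) X Y) =
      A.derived (A.ham A.deRham) (A.poisson (A.hamDual (A.schouten B)) X) Y
        + (-1 : ℝ) ^ (k + 1) • A.derived (A.ham A.deRham) X (A.poisson (A.hamDual (A.schouten B)) Y) := by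
  have hX' := A.mem_multivectors hX
  have hXY : A.schouten X Y ∈ A.multivectors := by
    rw [A.schouten_eq]
    exact Subalgebra.sum_mem _ fun i _ => Subalgebra.sub_mem _
      (Subalgebra.mul_mem _ (A.parity_mem_multivectors (A.dtheta_mem_multivectors hX' i))
        (A.dx_mem_multivectors hY i))
      (Subalgebra.mul_mem _ (A.dx_mem_multivectors hX' i) (A.dtheta_mem_multivectors hY i))
  have hlin : ∀ (r : ℝ) (Z : R),
      IsSuperCalculus.bracket A.parity A.dx A.dtheta (r • X) Z =
        r • IsSuperCalculus.bracket A.parity A.dx A.dtheta X Z := fun r Z => by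
    simp only [IsSuperCalculus.bracket, map_smul, smul_mul_assoc, ← smul_sub, ← Finset.smul_sum]
  rw [derived, derived, derived, A.poisson_poisson_ham_deRham hX' hY,
    A.poisson_hamDual_schouten hB hXY, A.poisson_hamDual_schouten hB hX',
    A.poisson_hamDual_schouten hB hY,
    A.poisson_poisson_ham_deRham (A.ham_mem_multivectors hB hX') hY,
    A.poisson_poisson_ham_deRham hX' (A.ham_mem_multivectors hB hY), A.schouten_eq, A.schouten_eq,
    A.schouten_eq, A.isSuperCalculus.ham_bracket (A.parity_of_bivector hB), A.parity_of_mem hX, add_zero,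
    hlin, pow_succ, mul_neg_one, neg_smul, sub_eq_add_neg]

end Bivector

/-! ### Uniqueness of the decomposition -/

theorem bideg_decomposition {m g f q m' g' f' q' : R}
    (hm : m ∈ A.bideg 1 2) (hg : g ∈ A.bideg 2 1) (hf : f ∈ A.bideg 0 3) (hq : q ∈ A.bideg 3 0)
    (hm' : m' ∈ A.bideg 1 2) (hg' : g' ∈ A.bideg 2 1) (hf' : f' ∈ A.bideg 0 3)
    (hq' : q' ∈ A.bideg 3 0) (h : m + g + f + q = m' + g' + f' + q') :
    m = m' ∧ g = g' ∧ f = f' ∧ q = q' := by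
  have key : ∀ a b c e : R, a ∈ A.bideg 1 2 → b ∈ A.bideg 2 1 → c ∈ A.bideg 0 3 →
      e ∈ A.bideg 3 0 → a + b + c + e = 0 → a = 0 ∧ b = 0 ∧ c = 0 ∧ e = 0 := by
    intro a b c e ha hb hc he h0
    -- Weighting by the first degree separates the components `(1,2)`, `(2,1)`, `(0,3)`, `(3,0)`
    -- into powers `1`, `2`, `0`, `3` of `s`.
    have hs : ∀ s : ℝ, s • a + s ^ 2 • b + c + s ^ 3 • e = 0 := by
      intro s
      have := congrArg (A.scale s) h0
      rw [map_add, map_add, map_add, A.scale_of_mem ha, A.scale_of_mem hb, A.scale_of_mem hc,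
        A.scale_of_mem he, map_zero] at this
      simpa using this
    -- `s = 0` isolates `c`, the sum of `s = 1` and `s = -1` gives `2b`, and `s = 2` minus twice `s
    -- = 1` gives `6e`.
    have h1 := hs 0
    have h2 := hs 1
    have h3 := hs (-1)
    have h4 := hs 2
    have hc0 : c = 0 := by simpa using h1
    subst hc0
    have hb0 : b = 0 := by
      have : (2 : ℝ) • b = 0 := by linear_combination (norm := module) h2 + h3
      exact (smul_eq_zero.1 this).resolve_left two_ne_zero
    subst hb0
    have he0 : e = 0 := by
      have : (6 : ℝ) • e = 0 := by linear_combination (norm := module) h4 - (2 : ℝ) • h2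
      exact (smul_eq_zero.1 this).resolve_left (by norm_num)
    subst he0
    exact ⟨by simpa using h2, rfl, rfl, rfl⟩
  have := key (m - m') (g - g') (f - f') (q - q') (Submodule.sub_mem _ hm hm')
    (Submodule.sub_mem _ hg hg') (Submodule.sub_mem _ hf hf') (Submodule.sub_mem _ hq hq') (by
      rw [← sub_eq_zero.2 h]; abel)
  simpa only [sub_eq_zero] using this

end DarbouxAlgebra

end SuperCotangent

/-! ### Local functions as an instance of the abstract Darboux calculus -/

namespace SuperCotangent

namespace LocalFn

variable {n : ℕ} {U : TopologicalSpace.Opens (EuclideanSpace ℝ (Fin n))}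

theorem parity_dl_p (i : Fin n) (F : LocalFn U) :
    parity (dl (Gen.p i) F) = dl (Gen.p i) (parity F) := by
  induction F using TensorProduct.induction_on with
  | zero => simp
  | tmul f a =>
    have := koszulSign_leftDeriv (Gen.xi i) (Gen.p i) a
    rw [koszulSign_of_odd rfl] at this
    rw [dl_tmul, parity_tmul, parity_tmul, dl_tmul, this]
    simp [koszul, Gen.odd]
  | add F G hF hG => simp [hF, hG]

theorem isSuperCalculus :
    IsSuperCalculus (parity (U := U)) dx fun i => dl (Gen.theta i) where
  sig_sig := parity_parity
  sig_d := parity_dx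
  sig_t _ := parity_dl rfl
  d_mul := dx_mul
  t_mul := dl_theta_mul
  d_d := dx_dx
  t_d _ := dl_dx _
  t_t := dl_theta_dl_theta
  even_mul _ h := mul_comm_of_even h
  odd_mul _ h := mul_comm_of_odd h

variable (U) in
/-- The functions on `T*ΠTU` as an algebra with Darboux coordinates. -/
noncomputable def darboux : DarbouxAlgebra n (LocalFn U) where
  parity := parity
  dx := dx
  dl := dl
  x := x
  xi := xi
  theta := theta
  p := p
  bideg := bideg U
  scale s := (scale fun g => s ^ g.bidegree.1 * 1 ^ g.bidegree.2).toLinearMap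
  isSuperCalculus := isSuperCalculus
  parity_dl := parity_dl
  parity_dl_p := parity_dl_p
  dl_xi_mul := dl_xi_mul
  dl_p_mul := dl_p_mul
  dl_one g := by
    change dl g (1 ⊗ₜ[ℝ] 1) = 0
    rw [dl_tmul, leftDeriv_one, TensorProduct.tmul_zero]
  dl_dx := dl_dx
  dl_dl := dl_dl
  dx_x := dx_x
  dx_xi := dx_xi
  dx_theta := dx_theta
  dx_p := dx_p
  dl_x := dl_x
  dl_xi := dl_xi
  dl_theta := dl_theta
  dl_p := dl_p
  parity_xi := parity_xi
  parity_p := parity_p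
  bideg_mul := bideg_mul
  x_mem_bideg := x_mem_bideg
  xi_mem_bideg := xi_mem_bideg
  p_mem_bideg := p_mem_bideg
  parity_of_mem := parity_of_mem
  scale_of_mem {s k l F} hF := by
    have := scale_of_mem hF s 1
    rwa [one_pow, mul_one] at this
  dl_p_of_mem := dl_p_of_mem
  dl_xi_of_mem := dl_xi_of_mem
  dl_theta_mem := dl_theta_mem
  dx_mem := dx_mem
  sum_theta_mul_dl := sum_theta_mul_dl

theorem poisson_eq_darboux : poisson = (darboux U).poisson := by
  funext F G
  refine Finset.sum_congr rfl fun i _ => ?_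
  rw [dr_eq rfl, dr_eq rfl]
  rfl

theorem schouten_eq_darboux : schouten = (darboux U).schouten := by
  funext F G
  refine Finset.sum_congr rfl fun i _ => ?_
  rw [dr_eq rfl]
  rfl

theorem derived_eq_darboux : derived = (darboux U).derived := by
  funext Θ X Y
  rw [derived, poisson_eq_darboux]
  rfl

end LocalFn

end SuperCotangent

namespace SuperCotangent

/-! ## Invariance of the fibre expressions under a change of coordinates -/

section ChangeOfCoordinates

variable {n : ℕ}

theorem fibre_anticomm {a b : FibreAlg n} (ha : fibreParity n a = -a)
    (hb : fibreParity n b = -b) : a * b = -(b * a) := by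
  have := sub_fibreParity_mul a b
  rw [ha, hb, sub_neg_eq_add, add_mul, mul_add] at this
  rw [← neg_mul]
  exact two_smul_cancel this

theorem fibreParity_xi (i : Fin n) : fibreParity n (gen (Gen.xi i)) = -gen (Gen.xi i) := by
  simp [fibreParity_gen, Gen.odd]

theorem fibreParity_theta (i : Fin n) :
    fibreParity n (gen (Gen.theta i)) = -gen (Gen.theta i) := by
  simp [fibreParity_gen, Gen.odd]

theorem fibreParity_lincomb {ι : Type*} [Fintype ι] (c : ι → ℝ) {u : ι → FibreAlg n}
    (hu : ∀ i, fibreParity n (u i) = -u i) :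
    fibreParity n (∑ i, c i • u i) = -∑ i, c i • u i := by
  simp only [map_sum, map_smul, hu, smul_neg, Finset.sum_neg_distrib]

theorem sum_comm₄ {ι V : Type*} [Fintype ι] [AddCommMonoid V] (f : ι → ι → ι → ι → V) :
    ∑ a, ∑ b, ∑ i, ∑ j, f a b i j = ∑ i, ∑ j, ∑ a, ∑ b, f a b i j := by
  calc _ = ∑ a, ∑ i, ∑ b, ∑ j, f a b i j := Finset.sum_congr rfl fun a _ => Finset.sum_comm
    _ = ∑ i, ∑ a, ∑ b, ∑ j, f a b i j := Finset.sum_comm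
    _ = ∑ i, ∑ a, ∑ j, ∑ b, f a b i j :=
      Finset.sum_congr rfl fun i _ => Finset.sum_congr rfl fun a _ => Finset.sum_comm
    _ = _ := Finset.sum_congr rfl fun i _ => Finset.sum_comm

/-- The contraction `c^{ij} u_i` of a bivector with the coordinates `u`. -/
noncomputable def contract (c : Fin n → Fin n → ℝ) (u : Fin n → FibreAlg n) (j : Fin n) :
    FibreAlg n := ∑ i, c i j • u i

/-- The quadratic function `½ c^{ij} u_i u_j`. -/
noncomputable def quad (c : Fin n → Fin n → ℝ) (u : Fin n → FibreAlg n) : FibreAlg n :=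
  (1 / 2 : ℝ) • ∑ i, ∑ j, c i j • (u i * u j)

/-- The data of a change of coordinates at a point, with the components of a bivector field and
their first derivatives in both charts. -/
structure BivectorChange (K J : Fin n → Fin n → ℝ) (H : Fin n → Fin n → Fin n → ℝ)
    (c c' : Fin n → Fin n → ℝ) (dc dc' : Fin n → Fin n → Fin n → ℝ) : Prop where
  mul_inv : ∀ i j, ∑ k, J i k * K k j = if i = j then 1 else 0
  hess_symm : ∀ a i k, H a i k = H a k i
  skew : ∀ i j, c i j = -c j i
  comp : ∀ a b, c' a b = ∑ i, ∑ j, J a i * J b j * c i j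
  deriv_comp : ∀ k a b, ∑ d, J d k * dc' d a b =
    ∑ i, ∑ j, (H a i k * J b j * c i j + J a i * H b j k * c i j + J a i * J b j * dc k i j)

variable {K J : Fin n → Fin n → ℝ} {H : Fin n → Fin n → Fin n → ℝ}

theorem changeHom_gen (g : Gen n) : changeHom K J H (gen g) = changeGen K J H g :=
  liftGen_gen _ _ g

theorem fibreParity_changeGen_xi (i : Fin n) :
    fibreParity n (changeGen K J H (Gen.xi i)) = -changeGen K J H (Gen.xi i) :=
  fibreParity_lincomb _ fibreParity_xi

theorem fibreParity_changeGen_theta (i : Fin n) :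
    fibreParity n (changeGen K J H (Gen.theta i)) = -changeGen K J H (Gen.theta i) :=
  fibreParity_lincomb _ fibreParity_theta

/-- The contraction of the second derivatives with the new coordinates `θ`. -/
noncomputable def hessTheta (H : Fin n → Fin n → Fin n → ℝ) (i k : Fin n) : FibreAlg n :=
  ∑ a, H a i k • gen (Gen.theta a)

theorem fibreParity_hessTheta (i k : Fin n) :
    fibreParity n (hessTheta H i k) = -hessTheta H i k :=
  fibreParity_lincomb _ fibreParity_theta

/-- The second derivatives are gathered into the odd elements `hessTheta H j k`, symmetric in `j`
and `k`; the cancellations below use only this symmetry and oddness. -/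
theorem changeGen_p (k : Fin n) : changeGen K J H (Gen.p k) =
    ∑ i, J i k • gen (Gen.p i) + ∑ j, changeGen K J H (Gen.xi j) * hessTheta H j k := by
  rw [changeGen]
  congr 1
  rw [Finset.sum_comm]
  refine Finset.sum_congr rfl fun j _ => ?_
  rw [hessTheta, Finset.mul_sum]
  exact Finset.sum_congr rfl fun i _ => (mul_smul_comm _ _ _).symm

theorem sum_jac_smul_changeGen_xi (h : ∀ i j, ∑ k, J i k * K k j = if i = j then 1 else 0)
    (i : Fin n) : ∑ k, J i k • changeGen K J H (Gen.xi k) = gen (Gen.xi i) := by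
  simp only [changeGen, Finset.smul_sum, smul_smul]
  rw [Finset.sum_comm]
  simp only [← Finset.sum_smul, h, ite_smul, one_smul, zero_smul, Finset.sum_ite_eq,
    Finset.mem_univ, if_true]

/-- The inhomogeneous part of `p` contributes `ξ_k ξ_j` contracted with the symmetric `hessTheta H j
k`, hence zero; the rest is the pairing of a vector with a covector. -/
theorem changeHom_xi_p (h : ∀ i j, ∑ k, J i k * K k j = if i = j then 1 else 0)
    (hH : ∀ a i k, H a i k = H a k i) :
    changeHom K J H (∑ i, gen (Gen.xi i) * gen (Gen.p i)) =
      ∑ i, gen (Gen.xi i) * gen (Gen.p i) := by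
  simp only [map_sum, map_mul, changeHom_gen, changeGen_p, mul_add, Finset.sum_add_distrib,
    Finset.mul_sum]
  have hz : ∑ k, ∑ j, changeGen K J H (Gen.xi k) *
      (changeGen K J H (Gen.xi j) * hessTheta H j k) = 0 := by
    refine sum_sum_eq_zero fun k j => ?_
    rw [← mul_assoc, ← mul_assoc, fibre_anticomm (fibreParity_changeGen_xi k)
      (fibreParity_changeGen_xi j), show hessTheta H k j = hessTheta H j k by
        simp only [hessTheta, hH _ k j], neg_mul, neg_add_cancel]
  rw [hz, add_zero, Finset.sum_comm]
  refine Finset.sum_congr rfl fun i _ => ?_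
  rw [← sum_jac_smul_changeGen_xi (H := H) h i, Finset.sum_mul]
  exact Finset.sum_congr rfl fun k _ => by rw [mul_smul_comm, smul_mul_assoc]

theorem fibreParity_contract (c : Fin n → Fin n → ℝ) (j : Fin n) :
    fibreParity n (contract c (fun i => changeGen K J H (Gen.theta i)) j) =
      -contract c (fun i => changeGen K J H (Gen.theta i)) j :=
  fibreParity_lincomb _ fibreParity_changeGen_theta

section

variable {c c' : Fin n → Fin n → ℝ} {dc dc' : Fin n → Fin n → Fin n → ℝ}
  (h : BivectorChange K J H c c' dc dc')
include h

/-- The contraction has one free upper index, so it transforms as a vector: the other Jacobian is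
absorbed in `θ_i = J^a_i θ'_a`. -/
theorem BivectorChange.contract_theta (b : Fin n) :
    contract c' (fun i => gen (Gen.theta i)) b =
      ∑ j, J b j • contract c (fun i => changeGen K J H (Gen.theta i)) j := by
  simp only [contract, changeGen, h.comp, Finset.smul_sum, Finset.sum_smul, smul_smul]
  calc _ = ∑ a, ∑ j, ∑ i, (J a i * J b j * c i j) • gen (Gen.theta a) :=
        Finset.sum_congr rfl fun a _ => Finset.sum_comm
    _ = ∑ j, ∑ a, ∑ i, (J a i * J b j * c i j) • gen (Gen.theta a) := Finset.sum_comm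
    _ = ∑ j, ∑ i, ∑ a, (J a i * J b j * c i j) • gen (Gen.theta a) :=
        Finset.sum_congr rfl fun j _ => Finset.sum_comm
    _ = _ := Finset.sum_congr rfl fun j _ => Finset.sum_congr rfl fun i _ =>
        Finset.sum_congr rfl fun a _ => by congr 1; ring

/-- The `x`-derivative of the bivector, with `θ` held fixed, is not a covector, since `θ` itself
depends on the chart through the Jacobian. The correction is the term with `hessTheta`; the two
indices of the bivector contribute equally to it and cancel the factor one half. -/
theorem BivectorChange.quad_theta (k : Fin n) :
    ∑ d, J d k • quad (dc' d) (fun i => gen (Gen.theta i)) =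
      quad (dc k) (fun i => changeGen K J H (Gen.theta i)) -
        ∑ i, hessTheta H i k * contract c (fun i => changeGen K J H (Gen.theta i)) i := by
  have h1 : ∑ d, J d k • quad (dc' d) (fun i => gen (Gen.theta i)) = (1 / 2 : ℝ) •
      ∑ i, ∑ j, (c i j • (hessTheta H i k * changeGen K J H (Gen.theta j)) +
        c i j • (changeGen K J H (Gen.theta i) * hessTheta H j k) +
        dc k i j • (changeGen K J H (Gen.theta i) * changeGen K J H (Gen.theta j))) := by
    have e : ∑ d, J d k • quad (dc' d) (fun i => gen (Gen.theta i)) = (1 / 2 : ℝ) •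
        ∑ a, ∑ b, (∑ d, J d k * dc' d a b) • (gen (Gen.theta a) * gen (Gen.theta b)) := by
      simp only [quad, smul_comm _ (1 / 2 : ℝ), ← Finset.smul_sum]
      congr 1
      simp only [Finset.smul_sum, Finset.sum_smul, smul_smul]
      rw [Finset.sum_comm]
      exact Finset.sum_congr rfl fun a _ => Finset.sum_comm
    rw [e]
    congr 1
    simp only [h.deriv_comp, Finset.sum_smul]
    rw [sum_comm₄]
    refine Finset.sum_congr rfl fun i _ => Finset.sum_congr rfl fun j _ => ?_
    simp only [hessTheta, changeGen, Finset.sum_mul_sum, smul_mul_smul_comm, Finset.smul_sum,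
      smul_smul, ← Finset.sum_add_distrib, ← add_smul]
    refine Finset.sum_congr rfl fun a _ => Finset.sum_congr rfl fun b _ => ?_
    congr 1
    ring
  have h2 : ∑ i, ∑ j, c i j • (hessTheta H i k * changeGen K J H (Gen.theta j)) =
      -∑ i, hessTheta H i k * contract c (fun i => changeGen K J H (Gen.theta i)) i := by
    rw [← Finset.sum_neg_distrib]
    refine Finset.sum_congr rfl fun i _ => ?_
    rw [contract, Finset.mul_sum, ← Finset.sum_neg_distrib]
    refine Finset.sum_congr rfl fun j _ => ?_
    rw [h.skew i j, neg_smul, mul_smul_comm]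
  have h3 : ∑ i, ∑ j, c i j • (changeGen K J H (Gen.theta i) * hessTheta H j k) =
      -∑ i, hessTheta H i k * contract c (fun i => changeGen K J H (Gen.theta i)) i := by
    rw [Finset.sum_comm, ← Finset.sum_neg_distrib]
    refine Finset.sum_congr rfl fun j _ => ?_
    rw [fibre_anticomm (fibreParity_hessTheta j k) (fibreParity_contract _ j), neg_neg, contract,
      Finset.sum_mul]
    exact Finset.sum_congr rfl fun i _ => (smul_mul_assoc _ _ _).symm
  rw [h1]
  simp only [Finset.sum_add_distrib]
  rw [h2, h3, quad, smul_add, ← two_smul ℝ (-∑ i, _), smul_smul]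
  norm_num
  abel

/-- The correction to the derivative of the bivector equals the one contributed by the inhomogeneous
part of `p`: after reordering odd factors they agree by the symmetry of `hessTheta`. -/
theorem BivectorChange.ham_eq :
    ∑ j, (contract c' (fun i => gen (Gen.theta i)) j * gen (Gen.p j) -
        quad (dc' j) (fun i => gen (Gen.theta i)) * gen (Gen.xi j)) =
      ∑ j, (contract c (fun i => changeGen K J H (Gen.theta i)) j * changeGen K J H (Gen.p j) -
        quad (dc j) (fun i => changeGen K J H (Gen.theta i)) * changeGen K J H (Gen.xi j)) := by
  set A := contract c (fun i => changeGen K J H (Gen.theta i))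
  have h1 : ∑ b, contract c' (fun i => gen (Gen.theta i)) b * gen (Gen.p b) =
      ∑ j, A j * ∑ i, J i j • gen (Gen.p i) := by
    simp only [h.contract_theta, Finset.sum_mul, Finset.mul_sum, smul_mul_assoc, mul_smul_comm]
    exact Finset.sum_comm
  have h2 : ∑ d, quad (dc' d) (fun i => gen (Gen.theta i)) * gen (Gen.xi d) =
      ∑ k, (quad (dc k) (fun i => changeGen K J H (Gen.theta i)) -
        ∑ i, hessTheta H i k * A i) * changeGen K J H (Gen.xi k) := by
    simp only [A, ← h.quad_theta, ← sum_jac_smul_changeGen_xi (H := H) h.mul_inv, Finset.sum_mul,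
      Finset.mul_sum, smul_mul_assoc, mul_smul_comm]
    exact Finset.sum_comm
  have h3 : ∑ j, A j * ∑ i, changeGen K J H (Gen.xi i) * hessTheta H i j =
      ∑ k, (∑ i, hessTheta H i k * A i) * changeGen K J H (Gen.xi k) := by
    simp only [Finset.sum_mul, Finset.mul_sum]
    rw [Finset.sum_comm]
    refine Finset.sum_congr rfl fun k _ => Finset.sum_congr rfl fun i _ => ?_
    have e : hessTheta H k i = hessTheta H i k := by simp only [hessTheta, h.hess_symm _ k i]
    rw [e, fibre_anticomm (fibreParity_hessTheta i k) (fibreParity_contract c i), neg_mul,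
      mul_assoc (A i), fibre_anticomm (fibreParity_hessTheta i k) (fibreParity_changeGen_xi k),
      mul_neg, neg_neg]
  rw [Finset.sum_sub_distrib, Finset.sum_sub_distrib, h1, h2]
  simp only [changeGen_p, mul_add, Finset.sum_add_distrib, sub_mul, Finset.sum_sub_distrib]
  rw [h3]
  abel

/-- The correction is `A_k h_{ik} A_i` with `h` symmetric and all three factors odd, so exchanging
`i` and `k` changes its sign. -/
theorem BivectorChange.sq_eq :
    ∑ j, contract c' (fun i => gen (Gen.theta i)) j * quad (dc' j) (fun i => gen (Gen.theta i)) =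
      ∑ j, contract c (fun i => changeGen K J H (Gen.theta i)) j *
        quad (dc j) (fun i => changeGen K J H (Gen.theta i)) := by
  set A := contract c (fun i => changeGen K J H (Gen.theta i))
  have h1 : ∑ d, contract c' (fun i => gen (Gen.theta i)) d *
      quad (dc' d) (fun i => gen (Gen.theta i)) =
      ∑ k, A k * (quad (dc k) (fun i => changeGen K J H (Gen.theta i)) -
        ∑ i, hessTheta H i k * A i) := by
    simp only [A, ← h.quad_theta, h.contract_theta, Finset.sum_mul, Finset.mul_sum, smul_mul_assoc,
      mul_smul_comm]
    exact Finset.sum_comm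
  have h2 : ∑ k, ∑ i, A k * (hessTheta H i k * A i) = 0 := by
    refine sum_sum_eq_zero fun k i => ?_
    have e : hessTheta H k i = hessTheta H i k := by simp only [hessTheta, h.hess_symm _ k i]
    have a1 := fibre_anticomm (fibreParity_hessTheta (H := H) i k)
      (fibreParity_contract (K := K) (J := J) (H := H) c k)
    have a2 := fibre_anticomm (fibreParity_hessTheta (H := H) i k)
      (fibreParity_contract (K := K) (J := J) (H := H) c i)
    have a3 := fibre_anticomm (fibreParity_contract (K := K) (J := J) (H := H) c k)
      (fibreParity_contract (K := K) (J := J) (H := H) c i)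
    rw [e, a1, a2, mul_neg, mul_neg, ← mul_assoc, ← mul_assoc, a3, neg_mul, neg_neg,
      add_neg_cancel]
  rw [h1]
  simp only [mul_sub, Finset.sum_sub_distrib, Finset.mul_sum]
  rw [h2, sub_zero]

end

end ChangeOfCoordinates

end SuperCotangent

namespace SuperCotangent

/-! ## Changes of charts -/

section Charts

variable {n : ℕ} {M : Type*} [TopologicalSpace M] [ChartedSpace (EuclideanSpace ℝ (Fin n)) M]

theorem Chart.change_apply (φ ψ : Chart n M) {m : M} (hφ : m ∈ φ.1.source) :
    φ.change ψ (φ.1 m) = ψ.1 m := by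
  rw [Chart.change, φ.1.left_inv hφ]

/-- The points of the domain of `φ.change ψ` form a neighbourhood of `φ m`. -/
theorem Chart.eventually_mem (φ ψ : Chart n M) {m : M} (hφ : m ∈ φ.1.source) (hψ : m ∈ ψ.1.source) : ∀ᶠ z in nhds (φ.1 m), z ∈ φ.1.target ∧ φ.1.symm z ∈ ψ.1.source := by
  have := (φ.1.symm.trans ψ.1).open_source.mem_nhds (x := φ.1 m) (by simp [hφ, hψ])
  filter_upwards [this] with z hz
  simpa using hz

theorem Chart.contDiffAt_change [IsManifold (𝓡 n) ∞ M] (φ ψ : Chart n M) {m : M}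
    (hφ : m ∈ φ.1.source) (hψ : m ∈ ψ.1.source) : ContDiffAt ℝ ∞ (φ.change ψ) (φ.1 m) := by
  have h := contMDiffOn_of_mem_contDiffGroupoid (I := 𝓡 n) (n := ∞)
    (HasGroupoid.compatible (G := contDiffGroupoid ∞ (𝓡 n)) φ.2 ψ.2)
  rw [contMDiffOn_iff_contDiffOn] at h
  exact h.contDiffAt ((φ.1.symm.trans ψ.1).open_source.mem_nhds (by simp [hφ, hψ]))

theorem Chart.differentiableAt_change [IsManifold (𝓡 n) ∞ M] (φ ψ : Chart n M) {m : M}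
    (hφ : m ∈ φ.1.source) (hψ : m ∈ ψ.1.source) : DifferentiableAt ℝ (φ.change ψ) (φ.1 m) :=
  (φ.contDiffAt_change ψ hφ hψ).differentiableAt (by simp)

theorem euclidean_eq_sum_single (v : EuclideanSpace ℝ (Fin n)) :
    v = ∑ i, v i • EuclideanSpace.single i (1 : ℝ) := by
  ext j
  simp [Finset.sum_apply, Pi.single_apply]

theorem Chart.fderiv_change_apply (φ ψ : Chart n M) (y v : EuclideanSpace ℝ (Fin n)) (i : Fin n) :
    fderiv ℝ (φ.change ψ) y v i = ∑ j, φ.jac ψ y i j * v j := by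
  conv_lhs => rw [euclidean_eq_sum_single v]
  simp [Chart.jac, mul_comm]

theorem Chart.jac_mul_jac [IsManifold (𝓡 n) ∞ M] (φ ψ : Chart n M) {m : M}
    (hφ : m ∈ φ.1.source) (hψ : m ∈ ψ.1.source) (i j : Fin n) :
    ∑ k, φ.jac ψ (φ.1 m) i k * ψ.jac φ (ψ.1 m) k j = if i = j then 1 else 0 := by
  have hd : DifferentiableAt ℝ (φ.change ψ) (ψ.change φ (ψ.1 m)) := by
    rw [ψ.change_apply φ hψ]; exact φ.differentiableAt_change ψ hφ hψ
  have h := fderiv_comp (ψ.1 m) hd (ψ.differentiableAt_change φ hψ hφ)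
  have he : φ.change ψ ∘ ψ.change φ =ᶠ[nhds (ψ.1 m)] id := by
    filter_upwards [ψ.eventually_mem φ hψ hφ] with z hz
    rw [Function.comp_apply, Chart.change, Chart.change, φ.1.left_inv hz.2, ψ.1.right_inv hz.1, id]
  rw [he.fderiv_eq, fderiv_id, ψ.change_apply φ hψ] at h
  have h' := congrArg (fun L => L (EuclideanSpace.single j 1) i) h
  rw [ContinuousLinearMap.comp_apply, φ.fderiv_change_apply ψ] at h'
  refine h'.symm.trans ?_
  simp

theorem Chart.differentiableAt_jac [IsManifold (𝓡 n) ∞ M] (φ ψ : Chart n M) {m : M}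
    (hφ : m ∈ φ.1.source) (hψ : m ∈ ψ.1.source) (i j : Fin n) :
    DifferentiableAt ℝ (fun z => φ.jac ψ z i j) (φ.1 m) := by
  have hd : DifferentiableAt ℝ (fderiv ℝ (φ.change ψ)) (φ.1 m) :=
    ((φ.contDiffAt_change ψ hφ hψ).fderiv_right (m := ∞) (by simp)).differentiableAt (by simp)
  exact (EuclideanSpace.proj (𝕜 := ℝ) i).differentiableAt.comp (φ.1 m)
    (hd.clm_apply (differentiableAt_const _))

theorem Chart.hess_symm [IsManifold (𝓡 n) ∞ M] (φ ψ : Chart n M) {m : M}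
    (hφ : m ∈ φ.1.source) (hψ : m ∈ ψ.1.source) (i j k : Fin n) :
    φ.hess ψ (φ.1 m) i j k = φ.hess ψ (φ.1 m) i k j := by
  have hc := φ.contDiffAt_change ψ hφ hψ
  have hd : DifferentiableAt ℝ (fderiv ℝ (φ.change ψ)) (φ.1 m) :=
    (hc.fderiv_right (m := ∞) (by simp)).differentiableAt (by simp)
  have key : ∀ j k, φ.hess ψ (φ.1 m) i j k = fderiv ℝ (fderiv ℝ (φ.change ψ)) (φ.1 m)
      (EuclideanSpace.single k 1) (EuclideanSpace.single j 1) i := by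
    intro j k
    have h1 : DifferentiableAt ℝ (fun z => fderiv ℝ (φ.change ψ) z (EuclideanSpace.single j 1))
        (φ.1 m) := hd.clm_apply (differentiableAt_const _)
    have h2 := ((EuclideanSpace.proj (𝕜 := ℝ) i).hasFDerivAt.comp (φ.1 m)
      h1.hasFDerivAt).fderiv
    change fderiv ℝ (EuclideanSpace.proj (𝕜 := ℝ) i ∘
      fun z => fderiv ℝ (φ.change ψ) z (EuclideanSpace.single j 1)) (φ.1 m)
      (EuclideanSpace.single k 1) = _
    rw [h2, fderiv_clm_apply hd (differentiableAt_const _)]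
    simp
  rw [key, key]
  have hs := (hc.isSymmSndFDerivAt (by
    rw [minSmoothness_of_isRCLikeNormedField]
    exact WithTop.coe_le_coe.2 (le_top : (2 : ℕ∞) ≤ ⊤))).eq
    (EuclideanSpace.single k 1) (EuclideanSpace.single j 1)
  rw [hs]

theorem Chart.coordCovector_eq [IsManifold (𝓡 n) ∞ M] (φ ψ : Chart n M) {m : M}
    (hφ : m ∈ φ.1.source) (hψ : m ∈ ψ.1.source) (a : Fin n) :
    ψ.coordCovector a m = ∑ i, φ.jac ψ (φ.1 m) a i • φ.coordCovector i m := by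
  have hf : MDifferentiableAt (𝓡 n) (𝓡 n) φ.1 m := mdifferentiableAt_atlas φ.2 hφ
  have hg : MDifferentiableAt (𝓡 n) (𝓡 n) (φ.change ψ) (φ.1 m) :=
    (φ.differentiableAt_change ψ hφ hψ).mdifferentiableAt
  have he : ψ.1 =ᶠ[nhds m] φ.change ψ ∘ φ.1 := by
    filter_upwards [φ.1.open_source.mem_nhds hφ] with z hz
    exact (φ.change_apply ψ hz).symm
  have hd : mfderiv (𝓡 n) (𝓡 n) ψ.1 m =
      (fderiv ℝ (φ.change ψ) (φ.1 m)).comp (mfderiv (𝓡 n) (𝓡 n) φ.1 m) := by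
    rw [he.mfderiv_eq, mfderiv_comp m hg hf, mfderiv_eq_fderiv]
    rfl
  refine ContinuousLinearMap.ext fun v => ?_
  have h1 : ψ.coordCovector a m v =
      fderiv ℝ (φ.change ψ) (φ.1 m) (mfderiv (𝓡 n) (𝓡 n) φ.1 m v) a := by
    rw [Chart.coordCovector, hd]; rfl
  refine h1.trans ((φ.fderiv_change_apply ψ (φ.1 m) _ a).trans ?_)
  rw [sum_apply]
  rfl

theorem alternating_map_sum {V : Type*} [AddCommGroup V] [Module ℝ V] (g : V [⋀^Fin 2]→ₗ[ℝ] ℝ)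
    (a b : Fin n → ℝ) (u : Fin n → V) :
    g ![∑ i, a i • u i, ∑ j, b j • u j] = ∑ i, ∑ j, a i * b j * g ![u i, u j] := by
  have hswap : ∀ v w, g ![v, w] = -g ![w, v] := by
    intro v w
    have := g.map_swap ![w, v] (i := 0) (j := 1) (by simp)
    rw [← this]
    congr 1
    ext i
    fin_cases i <;> simp
  have hsum : ∀ (a : Fin n → ℝ) (v : V),
      g ![∑ i, a i • u i, v] = ∑ i, a i * g ![u i, v] := by
    intro a v
    let L : V →ₗ[ℝ] ℝ :=
      { toFun := fun w => g ![w, v]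
        map_add' := fun x y => g.map_vecCons_add _ x y
        map_smul' := fun c x => g.map_vecCons_smul _ c x }
    change L (∑ i, a i • u i) = ∑ i, a i * L (u i)
    simp
  rw [hsum]
  refine Finset.sum_congr rfl fun i _ => ?_
  rw [hswap, hsum, ← Finset.sum_neg_distrib, Finset.mul_sum]
  refine Finset.sum_congr rfl fun j _ => ?_
  rw [hswap (u j)]
  ring

namespace BivectorField

variable (π : BivectorField n M)

/-- The component `π^{ij}` in the chart `φ` as a function on `ℝⁿ`. -/
noncomputable def rawComponent (φ : Chart n M) (i j : Fin n) (x : EuclideanSpace ℝ (Fin n)) : ℝ :=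
  π.toFun (φ.1.symm x) ![φ.coordCovector i (φ.1.symm x), φ.coordCovector j (φ.1.symm x)]

theorem rawComponent_apply (φ : Chart n M) {m : M} (hφ : m ∈ φ.1.source) (i j : Fin n) :
    π.rawComponent φ i j (φ.1 m) = π.toFun m ![φ.coordCovector i m, φ.coordCovector j m] := by
  rw [rawComponent, φ.1.left_inv hφ]

theorem rawComponent_skew (φ : Chart n M) (i j : Fin n) (x : EuclideanSpace ℝ (Fin n)) :
    π.rawComponent φ i j x = -π.rawComponent φ j i x := by
  rw [rawComponent, rawComponent, ← (π.toFun (φ.1.symm x)).map_swap _ (i := 0) (j := 1) (by simp)]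
  congr 1
  ext i : 1
  fin_cases i <;> simp

theorem component_skew (φ : Chart n M) (i j : Fin n) :
    π.component φ i j = -π.component φ j i :=
  Subtype.ext (funext fun x => π.rawComponent_skew φ i j x)

theorem partialX_component_at (φ : Chart n M) {m : M} (hφ : m ∈ φ.1.source) (k i j : Fin n) :
    (partialX φ.image k (π.component φ i j)).1 (φ.at m hφ) =
      fderiv ℝ (π.rawComponent φ i j) (φ.1 m) (EuclideanSpace.single k 1) :=
  partialX_apply_of_eq k _ (fun _ => rfl) _

theorem differentiableAt_rawComponent (φ : Chart n M) {m : M} (hφ : m ∈ φ.1.source)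
    (i j : Fin n) : DifferentiableAt ℝ (π.rawComponent φ i j) (φ.1 m) :=
  ((π.smooth φ i j).contDiffAt (φ.1.open_target.mem_nhds (φ.1.map_source hφ))).differentiableAt
    (by simp)

theorem rawComponent_change [IsManifold (𝓡 n) ∞ M] (φ ψ : Chart n M) {m : M}
    (hφ : m ∈ φ.1.source) (hψ : m ∈ ψ.1.source) (a b : Fin n) : π.rawComponent ψ a b (ψ.1 m) =
      ∑ i, ∑ j, φ.jac ψ (φ.1 m) a i * φ.jac ψ (φ.1 m) b j * π.rawComponent φ i j (φ.1 m) := by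
  rw [π.rawComponent_apply ψ hψ, φ.coordCovector_eq ψ hφ hψ, φ.coordCovector_eq ψ hφ hψ,
    alternating_map_sum]
  simp only [π.rawComponent_apply φ hφ]

/-- This is the derivative by `x^k` of the law `rawComponent_change`: the chain rule on the left,
the product rule on the right, where differentiated Jacobians become second derivatives of the
coordinate change. -/
theorem fderiv_rawComponent_change [IsManifold (𝓡 n) ∞ M] (φ ψ : Chart n M) {m : M}
    (hφ : m ∈ φ.1.source) (hψ : m ∈ ψ.1.source) (k a b : Fin n) :
    ∑ d, φ.jac ψ (φ.1 m) d k *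
        fderiv ℝ (π.rawComponent ψ a b) (ψ.1 m) (EuclideanSpace.single d 1) =
      ∑ i, ∑ j, (φ.hess ψ (φ.1 m) a i k * φ.jac ψ (φ.1 m) b j * π.rawComponent φ i j (φ.1 m) +
        φ.jac ψ (φ.1 m) a i * φ.hess ψ (φ.1 m) b j k * π.rawComponent φ i j (φ.1 m) +
        φ.jac ψ (φ.1 m) a i * φ.jac ψ (φ.1 m) b j *
          fderiv ℝ (π.rawComponent φ i j) (φ.1 m) (EuclideanSpace.single k 1)) := by
  -- The law holds at every point near `m`, not only at `m`, and may therefore be differentiated.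
  have he : π.rawComponent ψ a b ∘ φ.change ψ =ᶠ[nhds (φ.1 m)] fun z =>
      ∑ i, ∑ j, φ.jac ψ z a i * φ.jac ψ z b j * π.rawComponent φ i j z := by
    filter_upwards [φ.eventually_mem ψ hφ hψ] with z hz
    have := π.rawComponent_change φ ψ (φ.1.map_target hz.1) hz.2 a b
    rwa [φ.1.right_inv hz.1] at this
  have hd := he.fderiv_eq (𝕜 := ℝ)
  have hψd : DifferentiableAt ℝ (π.rawComponent ψ a b) (φ.change ψ (φ.1 m)) := by
    rw [φ.change_apply ψ hφ]; exact π.differentiableAt_rawComponent ψ hψ a b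
  rw [fderiv_comp _ hψd (φ.differentiableAt_change ψ hφ hψ), φ.change_apply ψ hφ] at hd
  have hd' := congrArg
    (fun L : EuclideanSpace ℝ (Fin n) →L[ℝ] ℝ => L (EuclideanSpace.single k 1)) hd
  have hl : fderiv ℝ (π.rawComponent ψ a b) (ψ.1 m) (fderiv ℝ (φ.change ψ) (φ.1 m)
      (EuclideanSpace.single k 1)) = ∑ d, φ.jac ψ (φ.1 m) d k *
        fderiv ℝ (π.rawComponent ψ a b) (ψ.1 m) (EuclideanSpace.single d 1) := by
    rw [euclidean_eq_sum_single (fderiv ℝ (φ.change ψ) (φ.1 m) _),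
      map_sum]
    simp [Chart.jac]
  have hJ := fun a i => (φ.differentiableAt_jac ψ hφ hψ a i).hasFDerivAt
  have hc := fun i j => (π.differentiableAt_rawComponent φ hφ i j).hasFDerivAt
  have hij := fun i j => ((hJ a i).fun_mul (hJ b j)).fun_mul (hc i j)
  have hi := fun i => HasFDerivAt.fun_sum fun (j : Fin n) (_ : j ∈ Finset.univ) => hij i j
  have hr := (HasFDerivAt.fun_sum fun (i : Fin n) (_ : i ∈ Finset.univ) => hi i).fderiv
  rw [← hl]
  refine hd'.trans ?_
  simp only [hr, sum_apply]
  refine Finset.sum_congr rfl fun i _ => Finset.sum_congr rfl fun j _ => ?_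
  simp only [add_apply, smul_apply, smul_eq_mul,
    Chart.hess]
  ring

/-- The components of a bivector field transform as they should. -/
theorem bivectorChange [IsManifold (𝓡 n) ∞ M] (φ ψ : Chart n M) {m : M}
    (hφ : m ∈ φ.1.source) (hψ : m ∈ ψ.1.source) :
    BivectorChange (ψ.jac φ (ψ.1 m)) (φ.jac ψ (φ.1 m)) (φ.hess ψ (φ.1 m))
      (fun i j => (π.component φ i j).1 (φ.at m hφ))
      (fun i j => (π.component ψ i j).1 (ψ.at m hψ))
      (fun k i j => (partialX φ.image k (π.component φ i j)).1 (φ.at m hφ))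
      (fun k i j => (partialX ψ.image k (π.component ψ i j)).1 (ψ.at m hψ)) where
  mul_inv := φ.jac_mul_jac ψ hφ hψ
  hess_symm := φ.hess_symm ψ hφ hψ
  skew i j := π.rawComponent_skew φ i j _
  comp := π.rawComponent_change φ ψ hφ hψ
  deriv_comp k a b := by
    simp only [partialX_component_at]
    exact π.fderiv_rawComponent_change φ ψ hφ hψ k a b

end BivectorField

end Charts

end SuperCotangent

namespace SuperCotangent

/-! ## Values at a point -/

namespace LocalFn

variable {n : ℕ} {U : TopologicalSpace.Opens (EuclideanSpace ℝ (Fin n))}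

theorem evalAt_tmul (y : U) (f : Smooth U) (a : FibreAlg n) :
    evalAt y (f ⊗ₜ[ℝ] a) = f.1 y • a := rfl

theorem evalAt_mul (y : U) (F G : LocalFn U) :
    evalAt y (F * G) = evalAt y F * evalAt y G := by
  induction F using TensorProduct.induction_on with
  | zero => simp
  | tmul f a =>
    induction G using TensorProduct.induction_on with
    | zero => simp
    | tmul f' b =>
      rw [Algebra.TensorProduct.tmul_mul_tmul, evalAt_tmul, evalAt_tmul, evalAt_tmul,
        smul_mul_smul_comm]
      rfl
    | add F G hF hG => simp only [mul_add, map_add, hF, hG]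
  | add F F' hF hG => simp only [add_mul, map_add, hF, hG]

theorem evalAt_one_tmul (y : U) (a : FibreAlg n) : evalAt y ((1 : Smooth U) ⊗ₜ[ℝ] a) = a :=
  (evalAt_tmul _ _ _).trans (one_smul ℝ a)

theorem ham_deRham : ham deRham = ∑ i : Fin n, (xi i * p i : LocalFn U) :=
  (darboux U).ham_deRham

theorem evalAt_ham_deRham (y : U) :
    evalAt y (ham deRham) = ∑ i, gen (Gen.xi i) * gen (Gen.p i) := by
  rw [ham_deRham, map_sum]
  refine Finset.sum_congr rfl fun i _ => ?_
  rw [evalAt_mul, xi, p, evalAt_one_tmul, evalAt_one_tmul]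

/-- The function `½ c^{ij} θ_i θ_j`. -/
noncomputable def bivector (c : Fin n → Fin n → Smooth U) : LocalFn U :=
  (1 / 2 : ℝ) • ∑ i : Fin n, ∑ j : Fin n,
    c i j ⊗ₜ[ℝ] (gen (Gen.theta i) * gen (Gen.theta j))

section

variable (c : Fin n → Fin n → Smooth U)

theorem bivector_mem : bivector c ∈ bideg U 2 0 := by
  have h : ∀ i j, gen (Gen.theta i) * gen (Gen.theta j) ∈ fibreBideg n 2 0 := fun i j =>
    fibreBideg_mul (k := 1) (l := 0) (k' := 1) (l' := 0) (gen_mem_fibreBideg (Gen.theta i))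
      (gen_mem_fibreBideg (Gen.theta j))
  rw [bivector]
  refine Submodule.smul_mem _ _ ?_
  refine Submodule.sum_mem _ fun i _ => ?_
  refine Submodule.sum_mem _ fun j _ => ?_
  exact tmul_mem_bideg _ (h i j)

theorem evalAt_dx_bivector (y : U) (k : Fin n) : evalAt y (dx k (bivector c)) =
    quad (fun i j => (partialX U k (c i j)).1 y) fun i => gen (Gen.theta i) := by
  simp only [bivector, map_smul, map_sum, dx_tmul, evalAt_tmul, quad]

variable {c} in
-- By skew symmetry the two terms of the derivative agree and absorb the factor one half. The sign
-- arises because `contract` sums over the first index of `c`.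
theorem evalAt_dl_theta_bivector (hc : ∀ i j, c i j = -c j i) (y : U) (k : Fin n) :
    evalAt y (dl (Gen.theta k) (bivector c)) =
      -contract (fun i j => (c i j).1 y) (fun i => gen (Gen.theta i)) k := by
  have h1 : ∀ i j, leftDeriv (Gen.theta k) (gen (Gen.theta i) * gen (Gen.theta j)) =
      (if k = i then gen (Gen.theta j) else 0) - if k = j then gen (Gen.theta i) else 0 := by
    intro i j
    rw [leftDeriv_mul, leftDeriv_gen, leftDeriv_gen, koszulSign_of_odd rfl, fibreParity_theta]
    simp [sub_eq_add_neg]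
    split_ifs <;> simp
  have hc' : ∀ i j, (c i j).1 y = -(c j i).1 y := fun i j =>
    congrArg (fun f : Smooth U => f.1 y) (hc i j)
  simp only [bivector, map_smul, map_sum, dl_tmul, evalAt_tmul, contract, h1, smul_sub, smul_ite,
    smul_zero, Finset.sum_sub_distrib, Finset.sum_ite_eq, Finset.mem_univ, if_true]
  rw [Finset.sum_comm]
  simp only [Finset.sum_ite_eq, Finset.mem_univ, if_true, hc' k, neg_smul,
    Finset.sum_neg_distrib]
  module

end

theorem hamDual_schouten_eq {B : LocalFn U} (hB : B ∈ bideg U 2 0) : hamDual (schouten B) =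
    -∑ i, (dx i B * xi i + dl (Gen.theta i) B * p i) := by
  rw [schouten_eq_darboux]
  exact (darboux U).hamDual_schouten_eq hB

theorem neg_half_schouten_self {B : LocalFn U} (hB : B ∈ bideg U 2 0) :
    -((1 / 2 : ℝ) • schouten B B) = ∑ i, dl (Gen.theta i) B * dx i B := by
  rw [schouten_eq_darboux]
  exact (darboux U).neg_half_schouten_self hB

variable {c : Fin n → Fin n → Smooth U} (hc : ∀ i j, c i j = -c j i)
include hc

theorem evalAt_hamDual_schouten (y : U) : evalAt y (hamDual (schouten (bivector c))) =
    ∑ j, (contract (fun i j => (c i j).1 y) (fun i => gen (Gen.theta i)) j * gen (Gen.p j) -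
      quad (fun a b => (partialX U j (c a b)).1 y) (fun i => gen (Gen.theta i)) *
        gen (Gen.xi j)) := by
  rw [hamDual_schouten_eq (bivector_mem c), map_neg, map_sum, ← Finset.sum_neg_distrib]
  refine Finset.sum_congr rfl fun j _ => ?_
  rw [map_add, evalAt_mul, evalAt_mul, evalAt_dx_bivector, evalAt_dl_theta_bivector hc, xi, p,
    evalAt_one_tmul, evalAt_one_tmul, neg_mul]
  abel

theorem evalAt_neg_half_schouten (y : U) :
    evalAt y (-((1 / 2 : ℝ) • schouten (bivector c) (bivector c))) =
    -∑ j, contract (fun i j => (c i j).1 y) (fun i => gen (Gen.theta i)) j *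
      quad (fun a b => (partialX U j (c a b)).1 y) (fun i => gen (Gen.theta i)) := by
  rw [neg_half_schouten_self (bivector_mem c), map_sum, ← Finset.sum_neg_distrib]
  refine Finset.sum_congr rfl fun j _ => ?_
  rw [evalAt_mul, evalAt_dx_bivector, evalAt_dl_theta_bivector hc, neg_mul]

end LocalFn

/-! ## Global functions -/

section Global

variable {n : ℕ} {M : Type*} [TopologicalSpace M] [ChartedSpace (EuclideanSpace ℝ (Fin n)) M]

theorem isGlobal_zero : (0 : ChartFn n M).IsGlobal := fun φ ψ m hφ hψ => by
  change LocalFn.evalAt _ (0 : LocalFn ψ.image) = φ.transition ψ m (LocalFn.evalAt _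
    (0 : LocalFn φ.image))
  rw [map_zero, map_zero, map_zero]

theorem hasBideg_zero (k l : ℕ) : (0 : ChartFn n M).HasBideg k l := fun _ =>
  Submodule.zero_mem _

theorem BivectorField.toFn_apply (π : BivectorField n M) (φ : Chart n M) :
    π.toFn φ = LocalFn.bivector (π.component φ) := rfl

theorem BivectorField.toFn_mem (π : BivectorField n M) (φ : Chart n M) :
    π.toFn φ ∈ LocalFn.bideg φ.image 2 0 := LocalFn.bivector_mem _

variable [IsManifold (𝓡 n) ∞ M]

theorem isGlobal_hamDeRham : (ChartFn.hamDeRham n M).IsGlobal := fun φ ψ m hφ hψ => by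
  rw [ChartFn.hamDeRham, ChartFn.hamDeRham, LocalFn.evalAt_ham_deRham,
    LocalFn.evalAt_ham_deRham]
  exact (changeHom_xi_p (φ.jac_mul_jac ψ hφ hψ) (φ.hess_symm ψ hφ hψ)).symm

variable (π : BivectorField n M)

theorem BivectorField.isGlobal_hamSchouten : (ChartFn.hamSchouten π.toFn).IsGlobal :=
  fun φ ψ m hφ hψ => by
  rw [ChartFn.hamSchouten, ChartFn.hamSchouten, π.toFn_apply, π.toFn_apply,
    LocalFn.evalAt_hamDual_schouten (π.component_skew φ),
    LocalFn.evalAt_hamDual_schouten (π.component_skew ψ)]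
  refine (π.bivectorChange φ ψ hφ hψ).ham_eq.trans ?_
  simp only [Chart.transition, map_sum, map_sub, map_mul, map_smul, contract, quad, changeHom_gen]

theorem BivectorField.isGlobal_neg_half_schouten :
    (-((1 / 2 : ℝ) • ChartFn.schouten π.toFn π.toFn)).IsGlobal := fun φ ψ m hφ hψ => by
  change LocalFn.evalAt _ (-((1 / 2 : ℝ) • LocalFn.schouten (π.toFn ψ) (π.toFn ψ))) =
    φ.transition ψ m
      (LocalFn.evalAt _ (-((1 / 2 : ℝ) • LocalFn.schouten (π.toFn φ) (π.toFn φ))))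
  rw [π.toFn_apply, π.toFn_apply,
    LocalFn.evalAt_neg_half_schouten (π.component_skew φ),
    LocalFn.evalAt_neg_half_schouten (π.component_skew ψ), (π.bivectorChange φ ψ hφ hψ).sq_eq]
  simp only [Chart.transition, map_neg, map_sum, map_mul, map_smul, contract, quad, changeHom_gen]

end Global

end SuperCotangent

/-! ### The twist of `h_d` by a bivector and the resulting structures -/

namespace SuperCotangent

section Twist

variable {n : ℕ}

namespace LocalFn

variable {U : TopologicalSpace.Opens (EuclideanSpace ℝ (Fin n))}

theorem poisson_zero_left (G : LocalFn U) : poisson 0 G = 0 := by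
  rw [poisson_eq_darboux]; exact (darboux U).poisson_zero_left G

theorem poisson_zero_right (F : LocalFn U) : poisson F 0 = 0 := by
  rw [poisson_eq_darboux]; exact (darboux U).poisson_zero_right F

theorem ham_deRham_mem : ham deRham ∈ bideg U 1 2 := (darboux U).ham_deRham_mem

theorem poisson_ham_deRham_self : poisson (ham deRham) (ham deRham : LocalFn U) = 0 := by
  rw [poisson_eq_darboux]; exact (darboux U).poisson_ham_deRham_self

theorem poisson_ham_deRham_sq (F : LocalFn U) :
    poisson (ham deRham) (poisson (ham deRham) F) = 0 := by
  rw [poisson_eq_darboux]; exact (darboux U).poisson_ham_deRham_sq F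

theorem poisson_poisson_ham_deRham {k l : ℕ} {P Q : LocalFn U} (hP : P ∈ bideg U k 0)
    (hQ : Q ∈ bideg U l 0) : poisson (poisson P (ham deRham)) Q = schouten P Q := by
  rw [poisson_eq_darboux, schouten_eq_darboux]
  exact (darboux U).poisson_poisson_ham_deRham ((darboux U).mem_multivectors hP)
    ((darboux U).mem_multivectors hQ)

variable {B : LocalFn U} (hB : B ∈ bideg U 2 0)
include hB

theorem neg_half_schouten_self_eq_sq : -((1 / 2 : ℝ) • schouten B B) =
    IsSuperCalculus.sq (darboux U).dx (darboux U).dtheta B := by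
  rw [schouten_eq_darboux]; exact (darboux U).neg_half_schouten_self hB

theorem schouten_self_eq_zero_iff :
    schouten B B = 0 ↔ IsSuperCalculus.sq (darboux U).dx (darboux U).dtheta B = 0 := by
  rw [← neg_half_schouten_self_eq_sq hB, neg_eq_zero, smul_eq_zero, or_iff_right (by norm_num)]

theorem neg_half_schouten_self_mem : -((1 / 2 : ℝ) • schouten B B) ∈ bideg U 3 0 := by
  rw [neg_half_schouten_self_eq_sq hB]; exact (darboux U).sq_mem hB

theorem hamDual_schouten_mem : hamDual (schouten B) ∈ bideg U 2 1 := by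
  rw [schouten_eq_darboux]; exact (darboux U).hamDual_schouten_mem hB

theorem poisson_bivector_ham_deRham : poisson B (ham deRham) = hamDual (schouten B) := by
  rw [poisson_eq_darboux, schouten_eq_darboux]
  exact ((darboux U).hamDual_schouten ((darboux U).mem_multivectors hB)).symm

theorem poisson_bivector_hamDual_schouten :
    poisson B (hamDual (schouten B)) = (2 : ℝ) • -((1 / 2 : ℝ) • schouten B B) := by
  rw [neg_half_schouten_self_eq_sq hB, poisson_eq_darboux, schouten_eq_darboux]
  exact (darboux U).poisson_bivector_hamDual_schouten hB

theorem poisson_bivector_schouten : poisson B ((2 : ℝ) • -((1 / 2 : ℝ) • schouten B B)) = 0 := by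
  rw [poisson_eq_darboux]
  exact (darboux U).poisson_bivector_multivector hB ((darboux U).mem_multivectors
    (Submodule.smul_mem _ _ (neg_half_schouten_self_mem hB)))

theorem iterate_poisson_bivector {k : ℕ} (hk : 3 ≤ k) : (poisson B)^[k] (ham deRham) = 0 := by
  obtain ⟨j, rfl⟩ := Nat.exists_eq_add_of_le' hk
  have h3 : (poisson B)^[3] (ham deRham) = 0 := by
    change poisson B (poisson B (poisson B (ham deRham))) = 0
    rw [poisson_bivector_ham_deRham hB, poisson_bivector_hamDual_schouten hB,
      poisson_bivector_schouten hB]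
  rw [Function.iterate_add_apply, h3]
  exact Function.iterate_fixed (poisson_zero_right B) j

theorem finsum_twist : ∑ᶠ k : ℕ, ((k.factorial : ℝ)⁻¹) • (poisson B)^[k] (ham deRham) =
    ham deRham + hamDual (schouten B) + -((1 / 2 : ℝ) • schouten B B) := by
  -- Only the orders `0`, `1`, `2` survive; the factor `1/2!` cancels the `2` in the second iterate.
  rw [finsum_eq_sum_of_support_subset (s := Finset.range 3)]
  · rw [Finset.sum_range_succ, Finset.sum_range_succ, Finset.sum_range_one]
    change ((Nat.factorial 0 : ℝ)⁻¹) • ham deRham +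
      ((Nat.factorial 1 : ℝ)⁻¹) • poisson B (ham deRham) +
      ((Nat.factorial 2 : ℝ)⁻¹) • poisson B (poisson B (ham deRham)) = _
    rw [poisson_bivector_ham_deRham hB, poisson_bivector_hamDual_schouten hB, smul_smul]
    norm_num [Nat.factorial]
  · intro k hk
    rw [Finset.coe_range, Set.mem_Iio]
    by_contra h
    exact hk (by simp only [iterate_poisson_bivector hB (not_lt.1 h), smul_zero])

theorem poisson_twist_self :
    poisson (ham deRham + hamDual (schouten B) + -((1 / 2 : ℝ) • schouten B B))
      (ham deRham + hamDual (schouten B) + -((1 / 2 : ℝ) • schouten B B)) = 0 := by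
  rw [neg_half_schouten_self_eq_sq hB, poisson_eq_darboux, schouten_eq_darboux]
  exact (darboux U).poisson_twist_self hB

theorem half_poisson_hamDual_self :
    (1 / 2 : ℝ) • poisson (hamDual (schouten B)) (hamDual (schouten B)) =
      -poisson (ham deRham) (-((1 / 2 : ℝ) • schouten B B)) := by
  have h : poisson (hamDual (schouten B)) (hamDual (schouten B)) =
      -((2 : ℝ) • poisson (ham deRham) (-((1 / 2 : ℝ) • schouten B B))) := by
    rw [neg_half_schouten_self_eq_sq hB, poisson_eq_darboux, schouten_eq_darboux]
    exact (darboux U).poisson_hamDual_self hB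
  rw [h, smul_neg, smul_smul]
  norm_num

theorem poisson_ham_deRham_hamDual : poisson (ham deRham) (hamDual (schouten B)) = 0 := by
  rw [poisson_eq_darboux, schouten_eq_darboux]
  exact (darboux U).poisson_ham_deRham_hamDual hB

theorem poisson_hamDual_neg_half_schouten :
    poisson (hamDual (schouten B)) (-((1 / 2 : ℝ) • schouten B B)) = 0 := by
  rw [neg_half_schouten_self_eq_sq hB, poisson_eq_darboux, schouten_eq_darboux]
  exact (darboux U).poisson_hamDual_sq hB

theorem schouten_self_eq_zero_of_poisson_hamDual
    (h : poisson (hamDual (schouten B)) (hamDual (schouten B)) = 0) : schouten B B = 0 := by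
  rw [schouten_self_eq_zero_iff hB]
  rw [poisson_eq_darboux, schouten_eq_darboux] at h
  exact (darboux U).sq_eq_zero_of_poisson_hamDual hB h

theorem schouten_self_eq_zero_of_poisson_poisson_x (h : ∀ j : Fin n,
    poisson (hamDual (schouten B)) (poisson (hamDual (schouten B)) (x j)) = 0) :
    schouten B B = 0 := by
  rw [schouten_self_eq_zero_iff hB]
  rw [poisson_eq_darboux, schouten_eq_darboux] at h
  exact (darboux U).sq_eq_zero_of_poisson_poisson_x hB h

theorem poisson_hamDual_poisson_hamDual (h : schouten B B = 0) {k : ℕ} {Q : LocalFn U}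
    (hQ : Q ∈ bideg U k 0) :
    poisson (hamDual (schouten B)) (poisson (hamDual (schouten B)) Q) = 0 := by
  rw [schouten_self_eq_zero_iff hB] at h
  rw [poisson_eq_darboux, schouten_eq_darboux]
  exact (darboux U).poisson_hamDual_poisson_hamDual hB h ((darboux U).mem_multivectors hQ)

theorem poisson_hamDual_derived {k l : ℕ} {X Y : LocalFn U} (hX : X ∈ bideg U k 0)
    (hY : Y ∈ bideg U l 0) :
    poisson (hamDual (schouten B)) (derived (ham deRham) X Y) =
      derived (ham deRham) (poisson (hamDual (schouten B)) X) Y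
        + (-1 : ℝ) ^ (k + 1) • derived (ham deRham) X (poisson (hamDual (schouten B)) Y) := by
  rw [derived_eq_darboux, poisson_eq_darboux, schouten_eq_darboux]
  exact (darboux U).poisson_hamDual_derived hB hX ((darboux U).mem_multivectors hY)

end LocalFn

/-! ### Passage from charts to the manifold -/

section Manifold

variable {M : Type*} [TopologicalSpace M] [ChartedSpace (EuclideanSpace ℝ (Fin n)) M]

theorem ChartFn.iterate_poisson_apply (P Θ : ChartFn n M) (k : ℕ) (φ : Chart n M) :
    (ChartFn.poisson P)^[k] Θ φ = (LocalFn.poisson (P φ))^[k] (Θ φ) := by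
  induction k with
  | zero => rfl
  | succ k ih =>
    rw [Function.iterate_succ_apply', Function.iterate_succ_apply', ChartFn.poisson, ih]

variable (π : BivectorField n M)

theorem BivectorField.twist_hamDeRham (φ : Chart n M) :
    ChartFn.twist π.toFn (ChartFn.hamDeRham n M) φ =
      LocalFn.ham LocalFn.deRham + LocalFn.hamDual (LocalFn.schouten (π.toFn φ)) +
        -((1 / 2 : ℝ) • LocalFn.schouten (π.toFn φ) (π.toFn φ)) :=
  LocalFn.finsum_twist (π.toFn_mem φ)

theorem BivectorField.twist_components_iff (μ γ φ ψ : ChartFn n M) :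
    (μ.HasBideg 1 2 ∧ γ.HasBideg 2 1 ∧ φ.HasBideg 0 3 ∧ ψ.HasBideg 3 0 ∧
      ChartFn.twist π.toFn (ChartFn.hamDeRham n M) = μ + γ + φ + ψ) ↔
    (μ = ChartFn.hamDeRham n M ∧ γ = ChartFn.hamSchouten π.toFn ∧ φ = 0 ∧
      ψ = -((1 / 2 : ℝ) • ChartFn.schouten π.toFn π.toFn)) := by
  constructor
  · rintro ⟨hμ, hγ, hφ, hψ, h⟩
    have key := fun χ : Chart n M => (LocalFn.darboux χ.image).bideg_decomposition (hμ χ) (hγ χ)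
      (hφ χ) (hψ χ) LocalFn.ham_deRham_mem (LocalFn.hamDual_schouten_mem (π.toFn_mem χ))
      (Submodule.zero_mem _) (LocalFn.neg_half_schouten_self_mem (π.toFn_mem χ)) (by
        rw [add_zero]
        exact (congrFun h χ).symm.trans (π.twist_hamDeRham χ))
    exact ⟨funext fun χ => (key χ).1, funext fun χ => (key χ).2.1,
      funext fun χ => (key χ).2.2.1, funext fun χ => (key χ).2.2.2⟩
  · rintro ⟨rfl, rfl, rfl, rfl⟩
    refine ⟨fun χ => LocalFn.ham_deRham_mem,
      fun χ => LocalFn.hamDual_schouten_mem (π.toFn_mem χ), hasBideg_zero 0 3,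
      fun χ => LocalFn.neg_half_schouten_self_mem (π.toFn_mem χ), ?_⟩
    rw [add_zero]
    exact funext fun χ => π.twist_hamDeRham χ

variable [IsManifold (𝓡 n) ∞ M]

theorem isLieAlgebroid_hamDeRham : IsLieAlgebroid (ChartFn.hamDeRham n M) where
  isGlobal := isGlobal_hamDeRham
  hasBideg _ := LocalFn.ham_deRham_mem
  d_sq _ _ α _ := LocalFn.poisson_ham_deRham_sq α

theorem isLieBialgebroid_hamDeRham_zero :
    IsLieBialgebroid (ChartFn.hamDeRham n M) (0 : ChartFn n M) where
  lie := isLieAlgebroid_hamDeRham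
  lie_dual :=
    { isGlobal := isGlobal_zero
      hasBideg := hasBideg_zero 2 1
      d_sq := fun φ k X _ => LocalFn.poisson_zero_left _ }
  compat φ k l α _ β _ := by
    have h : ∀ X Y : LocalFn φ.image, derived 0 X Y = 0 := fun X Y => by
      rw [derived, LocalFn.poisson_zero_right, LocalFn.poisson_zero_left]
    rw [Pi.zero_apply, h, h, h, LocalFn.poisson_zero_right, smul_zero, add_zero]

theorem BivectorField.isQuasiLieBialgebroidDual :
    IsQuasiLieBialgebroidDual (ChartFn.hamDeRham n M) (ChartFn.hamSchouten π.toFn)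
      (-((1 / 2 : ℝ) • ChartFn.schouten π.toFn π.toFn)) where
  global_mu := isGlobal_hamDeRham
  global_gamma := π.isGlobal_hamSchouten
  global_psi := π.isGlobal_neg_half_schouten
  bideg_mu _ := LocalFn.ham_deRham_mem
  bideg_gamma φ := LocalFn.hamDual_schouten_mem (π.toFn_mem φ)
  bideg_psi φ := LocalFn.neg_half_schouten_self_mem (π.toFn_mem φ)
  gamma_gamma := funext fun φ =>
    eq_neg_iff_add_eq_zero.1 (LocalFn.half_poisson_hamDual_self (π.toFn_mem φ))
  mu_mu := funext fun _ => LocalFn.poisson_ham_deRham_self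
  mu_gamma := funext fun φ => LocalFn.poisson_ham_deRham_hamDual (π.toFn_mem φ)
  gamma_psi := funext fun φ => LocalFn.poisson_hamDual_neg_half_schouten (π.toFn_mem φ)

theorem BivectorField.isLieBialgebroidDual_iff :
    IsLieBialgebroidDual (ChartFn.hamDeRham n M) (ChartFn.hamSchouten π.toFn) ↔
      ChartFn.schouten π.toFn π.toFn = 0 := by
  constructor
  · intro h
    -- It suffices to apply `d_γ² = 0` in degree `0`, to the coordinate functions of each chart.
    exact funext fun φ => LocalFn.schouten_self_eq_zero_of_poisson_poisson_x (π.toFn_mem φ)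
      fun j => h.lie_dual.d_sq φ 0 _ (LocalFn.x_mem_bideg j)
  · intro h
    exact
      { lie := isLieAlgebroid_hamDeRham
        lie_dual :=
          { isGlobal := π.isGlobal_hamSchouten
            hasBideg := fun φ => LocalFn.hamDual_schouten_mem (π.toFn_mem φ)
            d_sq := fun φ k X hX =>
              LocalFn.poisson_hamDual_poisson_hamDual (π.toFn_mem φ) (congrFun h φ) hX }
        compat := fun φ k l X hX Y hY => LocalFn.poisson_hamDual_derived (π.toFn_mem φ) hX hY }

/-- With `ψ = 0` the first structure equation reduces to `{γ,γ} = 0`, which forces `[π,π] = 0`.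
Conversely the quasi-Lie structure of the twist then has `ψ_π = 0`. -/
theorem BivectorField.isQuasiLieBialgebroidDual_zero_iff :
    IsQuasiLieBialgebroidDual (ChartFn.hamDeRham n M) (ChartFn.hamSchouten π.toFn) 0 ↔
      ChartFn.schouten π.toFn π.toFn = 0 := by
  constructor
  · intro h
    refine funext fun φ => LocalFn.schouten_self_eq_zero_of_poisson_hamDual (π.toFn_mem φ) ?_
    have h1 : (1 / 2 : ℝ) • LocalFn.poisson (LocalFn.hamDual (LocalFn.schouten (π.toFn φ)))
        (LocalFn.hamDual (LocalFn.schouten (π.toFn φ))) +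
        LocalFn.poisson (LocalFn.ham LocalFn.deRham) 0 = 0 := congrFun h.gamma_gamma φ
    rw [LocalFn.poisson_zero_right, add_zero] at h1
    exact (smul_eq_zero.1 h1).resolve_left (by norm_num)
  · intro h
    have := π.isQuasiLieBialgebroidDual
    rwa [h, smul_zero, neg_zero] at this

end Manifold

end Twist

end SuperCotangent

theorem mainTheorem4 (n : ℕ) (M : Type*) [TopologicalSpace M]
    [ChartedSpace (EuclideanSpace ℝ (Fin n)) M] [IsManifold (𝓡 n) ∞ M]
    (π : SuperCotangent.BivectorField n M) :
    -- `h_d` (with `γ = 0`) is a Lie bialgebroid structure on `(TM, T*M)`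
    SuperCotangent.IsLieBialgebroid (SuperCotangent.ChartFn.hamDeRham n M) 0 ∧
    SuperCotangent.ChartFn.poisson (SuperCotangent.ChartFn.hamDeRham n M)
      (SuperCotangent.ChartFn.hamDeRham n M) = 0 ∧
    -- its derived bracket is the ordinary Schouten bracket of multivector fields
    (∀ (k l : ℕ) (P Q : SuperCotangent.ChartFn n M), P.HasBideg k 0 → Q.HasBideg l 0 →
      SuperCotangent.ChartFn.poisson
        (SuperCotangent.ChartFn.poisson P (SuperCotangent.ChartFn.hamDeRham n M)) Q =
        SuperCotangent.ChartFn.schouten P Q) ∧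
    -- the exponential series of the twist terminates
    (∀ k : ℕ, 3 ≤ k → (SuperCotangent.ChartFn.poisson π.toFn)^[k]
      (SuperCotangent.ChartFn.hamDeRham n M) = 0) ∧
    -- the components `μ_π`, `γ_π`, `φ_π`, `ψ_π` of the twist
    (∀ μ γ φ ψ : SuperCotangent.ChartFn n M,
      (μ.HasBideg 1 2 ∧ γ.HasBideg 2 1 ∧ φ.HasBideg 0 3 ∧ ψ.HasBideg 3 0 ∧
        SuperCotangent.ChartFn.twist π.toFn (SuperCotangent.ChartFn.hamDeRham n M) =
          μ + γ + φ + ψ) ↔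
      (μ = SuperCotangent.ChartFn.hamDeRham n M ∧
        γ = SuperCotangent.ChartFn.hamSchouten π.toFn ∧
        φ = 0 ∧
        ψ = -((1 / 2 : ℝ) • SuperCotangent.ChartFn.schouten π.toFn π.toFn))) ∧
    -- the twist satisfies the structure equation
    SuperCotangent.ChartFn.poisson
      (SuperCotangent.ChartFn.twist π.toFn (SuperCotangent.ChartFn.hamDeRham n M))
      (SuperCotangent.ChartFn.twist π.toFn (SuperCotangent.ChartFn.hamDeRham n M)) = 0 ∧
    -- it is a quasi-Lie bialgebroid structure on `(T*M, TM)`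
    SuperCotangent.IsQuasiLieBialgebroidDual (SuperCotangent.ChartFn.hamDeRham n M)
      (SuperCotangent.ChartFn.hamSchouten π.toFn)
      (-((1 / 2 : ℝ) • SuperCotangent.ChartFn.schouten π.toFn π.toFn)) ∧
    -- it is a Lie bialgebroid structure if and only if `[π,π] = 0`
    (SuperCotangent.IsLieBialgebroidDual (SuperCotangent.ChartFn.hamDeRham n M)
      (SuperCotangent.ChartFn.hamSchouten π.toFn) ↔
      SuperCotangent.ChartFn.schouten π.toFn π.toFn = 0) ∧
    (SuperCotangent.IsQuasiLieBialgebroidDual (SuperCotangent.ChartFn.hamDeRham n M)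
      (SuperCotangent.ChartFn.hamSchouten π.toFn) 0 ↔
      SuperCotangent.ChartFn.schouten π.toFn π.toFn = 0) :=
  ⟨SuperCotangent.isLieBialgebroid_hamDeRham_zero,
    funext fun _ => SuperCotangent.LocalFn.poisson_ham_deRham_self,
    fun _ _ _ _ hP hQ => funext fun φ =>
      SuperCotangent.LocalFn.poisson_poisson_ham_deRham (hP φ) (hQ φ),
    fun k hk => funext fun φ => (SuperCotangent.ChartFn.iterate_poisson_apply _ _ k φ).trans
      (SuperCotangent.LocalFn.iterate_poisson_bivector (π.toFn_mem φ) hk),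
    π.twist_components_iff,
    funext fun φ => by
      rw [SuperCotangent.ChartFn.poisson, π.twist_hamDeRham]
      exact SuperCotangent.LocalFn.poisson_twist_self (π.toFn_mem φ),
    π.isQuasiLieBialgebroidDual, π.isLieBialgebroidDual_iff,
    π.isQuasiLieBialgebroidDual_zero_iff⟩
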